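/- **Theorem (Whitham equations for the $SO(2N)$ Seiberg–Witten curve).** Let $N\ge 2$, $M\ge 1$, $\mu\in\mathbb C$. For $u=(u_1,\dots,u_N)\in\mathbb C^N$ put $$Q_u(\xi)=\xi^N-\sum_{j=1}^N u_j\xi^{N-j},\qquad W_u(x)=x^{-2}Q_u(x^2),$$ and let $C_u$ be the compact curve $z+\mu^2/z=W_u(x)$, i.e. $y^2=Q_u(x^2)^2-4\mu^2x^4$ with $y=x^2(z-\mu^2/z)$. Call $u$ smooth if $Q_u(x^2)^2-4\mu^2x^4$ has no multiple root (then $C_u$ has genus $2N-1$). Let $\sigma_2(x,z)=(-x,z)$. For $n\ge1$ let $$R_n(x)=\bigl(W_u(x)^{(2n-1)/(2N-2)}\bigr)_+,\qquad d\hat\Omega_n=R_n(x)\,\frac{dz}{z},$$ where $(\cdots)_+$ is the polynomial part of the Laurent series $W_u(x)^{(2n-1)/(2N-2)}=x^{2n-1}+\cdots$ at $x=\infty$. For $T=(T_1,\dots,T_M)\in\mathbb C^M$ let $dS=\sum_{n=1}^M T_n\,d\hat\Omega_n$, so that $dS=x\,dz/z$ at $T=(1,0,\dots,0)$. Let $u^0$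 be smooth, and let $A_1(u),\dots,A_N(u)$ be closed paths on $C_u$ depending smoothly on $u$ in a neighbourhood $U$ of $u^0$. Suppose that there are closed paths $B_1,\dots,B_N$ on $C_{u^0}$ such that, with $A_j=A_j(u^0)$, the $4N-2$ cycles $A_j,-\sigma_2(A_j),B_j,-\sigma_2(B_j)$ $(1\le j\le N-1)$ and $A_N,B_N$ form a symplectic basis of cycles of $C_{u^0}$ and the homology classes $[A_N],[B_N]$ are odd under $\sigma_2$. (All these paths avoid the branch points of $x$ and the points over $x=0,\infty$.) Then there are open neighbourhoods $V\subseteq U$ of $u^0$ and $\mathcal T\subseteq\mathbb C^M$ of $(1,0,\dots,0)$ such that: 1. Every $u\in V$ is smooth, and on $C_u$ there are unique holomorphic differentials $d\omega_1,\dots,d\omega_N$ with $\sigma_2^*d\omega_j=-d\omega_j$ and $\oint_{A_k(u)}d\omega_j=\delta_{jk}$. 2. Let $a_j(u,T)=\oint_{A_j(u)}dS$. The map $(u,T)\mapsto(a(u,T),T)$ is injective on $V\times\mathcal T$, its image $D$ is open in $\mathbb C^N\times\mathbb C^M$, and the moduli $u=u(a,T)$ obtained by inverting it form a holomorphic map $D\to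 V$. 3. On $C_{u(a,T)}$, $(a,T)\in D$, put $c_j^{(n)}=\oint_{A_j}d\hat\Omega_n$ and $d\Omega_n=d\hat\Omega_n-\sum_{j=1}^N c^{(n)}_j\,d\omega_j$. Then $\oint_{A_j}d\Omega_n=0$ for all $j$, and $$dS=\sum_{n=1}^M T_n\,d\Omega_n+\sum_{j=1}^N a_j\,d\omega_j .$$ 4. On $C_{u(a,T)}$, with $u=u(a,T)$ as a function of the independent variables $(a,T)\in D$, $dS$ satisfies the Whitham equations $$\left.\frac{\partial}{\partial a_j}dS\right|_{z=\mathrm{const}}=d\omega_j\quad(1\le j\le N),\qquad \left.\frac{\partial}{\partial T_n}dS\right|_{z=\mathrm{const}}=d\Omega_n\quad(1\le n\le M).$$ Here $\partial/\partial s|_{z=\mathrm{const}}$ of a family of differentials means: near each point with $W_u'(x)\ne0$ write the family as $f(s,z)\,dz$ by solving the equation of the curve for $x=x(s,z)$, and take $(\partial f/\partial s)\,dz$. -/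

import Mathlib

open scoped ContDiff Topology
open Polynomial

noncomputable section

namespace SOWhitham

/-! ### The curve

Throughout, `N` is the rank, `u : Fin N → ℂ` are the moduli (`u j` in Lean is the modulus usually
called `u_{j+1}`) and `μ` is the scale. -/

/-- `Q(ξ) = ξ^N - ∑_{j=1}^N u_j ξ^{N-j}`. -/
def Q {N : ℕ} (u : Fin N → ℂ) : ℂ[X] :=
  X ^ N - ∑ j : Fin N, C (u j) * X ^ (N - 1 - (j : ℕ))

/-- The superpotential `W(x) = x^{-2} Q(x²)`. -/
def W {N : ℕ} (u : Fin N → ℂ) (x : ℂ) : ℂ :=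
  (x ^ 2)⁻¹ * (Q u).eval (x ^ 2)

/-- The hyperelliptic polynomial `Q(x²)² - 4 μ² x⁴` of the curve `z + μ²/z = W(x)`; in terms of
`y = x² (z - μ²/z)` the curve is `y² = Q(x²)² - 4 μ² x⁴`. -/
def hyperellipticPoly {N : ℕ} (μ : ℂ) (u : Fin N → ℂ) : ℂ[X] :=
  ((Q u).comp (X ^ 2)) ^ 2 - C (4 * μ ^ 2) * X ^ 4

/-- The curve is nonsingular (of genus `2N - 1`): the hyperelliptic polynomial, of degree `4N`, has
no multiple root. -/
def IsSmoothCurve {N : ℕ} (μ : ℂ) (u : Fin N → ℂ) : Prop :=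
  (hyperellipticPoly μ u).Separable

/-- The points `(x, z)` of the curve `z + μ²/z = W(x)` other than the branch points (`z² = μ²`).
The compact curve `C` consists of this set and finitely many further points: the `4N` branch
points, the two points over `x = 0` and the two points over `x = ∞`. On this set `x` is a
local coordinate. -/
def curve {N : ℕ} (μ : ℂ) (u : Fin N → ℂ) : Set (ℂ × ℂ) :=
  {p | p.1 ≠ 0 ∧ p.2 ≠ 0 ∧ p.2 ^ 2 ≠ μ ^ 2 ∧ p.2 + μ ^ 2 / p.2 = W u p.1}

/-- `y = x² (z - μ²/z)`. -/
def yCoord (μ : ℂ) (p : ℂ × ℂ) : ℂ :=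
  p.1 ^ 2 * (p.2 - μ ^ 2 / p.2)

/-- A holomorphic local section `x ↦ (x, ζ x)` of `x : C → ℂ` over the open set `s`, that is,
a local parametrization of the curve by the coordinate `x`. -/
def IsSection {N : ℕ} (μ : ℂ) (u : Fin N → ℂ) (s : Set ℂ) (ζ : ℂ → ℂ) : Prop :=
  IsOpen s ∧ DifferentiableOn ℂ ζ s ∧ ∀ x ∈ s, (x, ζ x) ∈ curve μ u

/-! ### Differential forms on the curve -/

/-- A complex-valued real 1-form on `curve μ u`, written in the coordinate `x`: the value of `α p`
at `v : ℂ` is the value of the form at the tangent vector at `p` whose `x`-component is `v`. -/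
abbrev RealForm := ℂ × ℂ → ℂ →L[ℝ] ℂ

/-- A closed smooth 1-form on the compact curve `C` minus the finitely many points that are missing
in `curve μ u`, which is bounded near each of these points (with respect to a local
coordinate of `C`). The bound is written in the coordinate `x`: near a branch point `y` is a local
coordinate of `C` and `dx` is `y dy` times a nonvanishing function; near `x = 0` the coordinate is
`x` and `y` is bounded and bounded away from `0`; near `x = ∞` the coordinate is `1/x`,
`dx = -x² d(1/x)` and `y` has order `x^{2N}`. The periods of such a form around the missing points
vanish, and the classes of these forms are the classes in `H¹(C, ℂ)`. -/
def IsClosedForm {N : ℕ} (μ : ℂ) (u : Fin N → ℂ) (α : RealForm) : Prop :=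
  (∀ s ζ, IsSection μ u s ζ →
    ContDiffOn ℝ ∞ (fun x => α (x, ζ x)) s ∧
    ∀ x ∈ s, fderiv ℝ (fun x => α (x, ζ x)) x 1 Complex.I =
      fderiv ℝ (fun x => α (x, ζ x)) x Complex.I 1) ∧
  ∃ K : ℝ, ∀ p ∈ curve μ u, ‖α p‖ * ‖yCoord μ p‖ ≤ K * (1 + ‖p.1‖) ^ (2 * N - 2)

/-- `∬_C α ∧ β`, computed in the coordinate `x` by summing over the (generically two) points of the
curve above `x`; the orientation is the complex one. -/
def wedgeIntegral {N : ℕ} (μ : ℂ) (u : Fin N → ℂ) (α β : RealForm) : ℂ :=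
  ∫ x : ℂ, ∑ᶠ z ∈ {z : ℂ | (x, z) ∈ curve μ u},
    (α (x, z) 1 * β (x, z) Complex.I - α (x, z) Complex.I * β (x, z) 1)

/-- A differential `φ dx` of type (1,0) on the curve, given by its coefficient `φ`. -/
abbrev Differential := ℂ × ℂ → ℂ

/-- `φ dx` is a holomorphic differential on the compact curve `C`: it is holomorphic on
`curve μ u`, and it is bounded near each of the missing points with respect to a local
coordinate of `C` (see `IsClosedForm` for the form of the bound), so that it extends holomorphically
to them. -/
def IsHolomorphic {N : ℕ} (μ : ℂ) (u : Fin N → ℂ) (φ : Differential) : Prop :=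
  (∀ s ζ, IsSection μ u s ζ → DifferentiableOn ℂ (fun x => φ (x, ζ x)) s) ∧
  ∃ K : ℝ, ∀ p ∈ curve μ u, ‖φ p‖ * ‖yCoord μ p‖ ≤ K * (1 + ‖p.1‖) ^ (2 * N - 2)

/-- The involution `σ₂ : (x, z) ↦ (-x, z)`. -/
def sigma2 (p : ℂ × ℂ) : ℂ × ℂ := (-p.1, p.2)

/-- The pullback `σ₂^* (φ dx)`. -/
def pullbackSigma2 (φ : Differential) : Differential := fun p => -φ (sigma2 p)

/-- `φ dx` is odd (a Prym differential): `σ₂^* (φ dx) = - φ dx`. -/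
def IsOdd {N : ℕ} (μ : ℂ) (u : Fin N → ℂ) (φ : Differential) : Prop :=
  ∀ p ∈ curve μ u, pullbackSigma2 φ p = -φ p

/-! ### Cycles -/

/-- A smooth closed path, of period `1`, on the curve, avoiding the missing points. -/
def IsLoop {N : ℕ} (μ : ℂ) (u : Fin N → ℂ) (γ : ℝ → ℂ × ℂ) : Prop :=
  ContDiff ℝ ∞ γ ∧ Function.Periodic γ 1 ∧ ∀ t, γ t ∈ curve μ u

/-- `∮_γ α`. -/
def loopIntegral (γ : ℝ → ℂ × ℂ) (α : RealForm) : ℂ :=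
  ∫ t in (0 : ℝ)..1, α (γ t) (deriv (fun s => (γ s).1) t)

/-- `∮_γ φ dx`. -/
def period (γ : ℝ → ℂ × ℂ) (φ : Differential) : ℂ :=
  ∫ t in (0 : ℝ)..1, φ (γ t) * deriv (fun s => (γ s).1) t

/-- `σ₂(γ)`. -/
def sigma2Loop (γ : ℝ → ℂ × ℂ) : ℝ → ℂ × ℂ := fun t => sigma2 (γ t)

/-- `-γ`, the loop `γ` with the opposite direction. -/
def revLoop (γ : ℝ → ℂ × ℂ) : ℝ → ℂ × ℂ := fun t => γ (-t)

/-- `[δ] = ∑ n_i [c_i]` in `H₁(C, ℤ)`, by de Rham duality (`H₁(C, ℤ)` is torsion free): both sides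
have the same integral for every closed form. -/
def IsHomologous {N : ℕ} (μ : ℂ) (u : Fin N → ℂ) {ι : Type} [Fintype ι] (δ : ℝ → ℂ × ℂ)
    (n : ι → ℤ) (c : ι → ℝ → ℂ × ℂ) : Prop :=
  ∀ α, IsClosedForm μ u α → loopIntegral δ α = ∑ i, (n i : ℂ) * loopIntegral (c i) α

/-- The closed form `η` is Poincaré dual to the loop `γ` in `C`: `∮_γ α = ∬_C α ∧ η` for every
closed form `α`. -/
def IsPoincareDual {N : ℕ} (μ : ℂ) (u : Fin N → ℂ) (γ : ℝ → ℂ × ℂ) (η : RealForm) : Prop :=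
  IsClosedForm μ u η ∧ ∀ α, IsClosedForm μ u α → loopIntegral γ α = wedgeIntegral μ u α η

/-- The intersection number `γ · δ` of two loops in `C` equals `n`. The intersection number is
`∬_C η_γ ∧ η_δ`, for Poincaré dual forms `η_γ`, `η_δ` (it does not depend on their choice). -/
def HasIntersectionNumber {N : ℕ} (μ : ℂ) (u : Fin N → ℂ) (γ δ : ℝ → ℂ × ℂ) (n : ℤ) : Prop :=
  ∃ η θ, IsPoincareDual μ u γ η ∧ IsPoincareDual μ u δ θ ∧ wedgeIntegral μ u η θ = (n : ℂ)

/-- The loops `a i`, `b i` form a symplectic basis of cycles of `C`: their intersection numbers are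
`a_i · a_k = b_i · b_k = 0`, `a_i · b_k = δ_{ik}`, and their classes generate `H₁(C, ℤ)`. -/
structure IsSymplecticBasis {N : ℕ} (μ : ℂ) (u : Fin N → ℂ) {ι : Type} [Fintype ι] [DecidableEq ι]
    (a b : ι → ℝ → ℂ × ℂ) : Prop where
  isLoop_a : ∀ i, IsLoop μ u (a i)
  isLoop_b : ∀ i, IsLoop μ u (b i)
  inter_aa : ∀ i k, HasIntersectionNumber μ u (a i) (a k) 0
  inter_bb : ∀ i k, HasIntersectionNumber μ u (b i) (b k) 0
  inter_ab : ∀ i k, HasIntersectionNumber μ u (a i) (b k) (if i = k then 1 else 0)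
  generate : ∀ δ, IsLoop μ u δ → ∃ n : ι ⊕ ι → ℤ, IsHomologous μ u δ n (Sum.elim a b)

/-- The family `γ_1, …, γ_N, -σ₂(γ_1), …, -σ₂(γ_{N-1})` made from `γ_1, …, γ_N`. -/
def doubled {N : ℕ} (γ : Fin N → ℝ → ℂ × ℂ) : Fin N ⊕ Fin (N - 1) → ℝ → ℂ × ℂ :=
  Sum.elim γ (fun j => revLoop (sigma2Loop (γ (Fin.castLE (Nat.sub_le N 1) j))))

/-- The condition on the cycles `A_1, …, A_N, B_1, …, B_N`: the classes of `A_N` and `B_N` are odd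
under `σ₂`, and the `4N - 2` cycles `A_j, -σ₂(A_j), B_j, -σ₂(B_j)` (`1 ≤ j ≤ N - 1`) and `A_N, B_N`
form a symplectic basis of cycles of `C`. -/
structure IsPrymCycles {N : ℕ} (μ : ℂ) (u : Fin N → ℂ) (A B : Fin N → ℝ → ℂ × ℂ) : Prop where
  symplectic : IsSymplecticBasis μ u (doubled A) (doubled B)
  odd_A : ∀ j : Fin N, (j : ℕ) + 1 = N →
    IsHomologous μ u (sigma2Loop (A j)) (fun _ : Unit => -1) (fun _ => A j)
  odd_B : ∀ j : Fin N, (j : ℕ) + 1 = N →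
    IsHomologous μ u (sigma2Loop (B j)) (fun _ : Unit => -1) (fun _ => B j)

/-- A smooth family of loops `γ u` on the curves with moduli `u ∈ U`. -/
def IsLoopFamily {N : ℕ} (μ : ℂ) (U : Set (Fin N → ℂ)) (γ : (Fin N → ℂ) → ℝ → ℂ × ℂ) : Prop :=
  ContDiffOn ℝ ∞ (fun q : (Fin N → ℂ) × ℝ => γ q.1 q.2) (U ×ˢ Set.univ) ∧
  ∀ u ∈ U, IsLoop μ u (γ u)

/-- `om_1 dx, …, om_N dx` are the normalized odd holomorphic differentials: they are holomorphic,
odd, and `∮_{A_k} om_j dx = δ_{jk}`. -/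
def IsNormalizedPrym {N : ℕ} (μ : ℂ) (u : Fin N → ℂ) (A : Fin N → ℝ → ℂ × ℂ)
    (om : Fin N → Differential) : Prop :=
  ∀ j, IsHolomorphic μ u (om j) ∧ IsOdd μ u (om j) ∧
    ∀ k, period (A k) (om j) = if j = k then 1 else 0

/-! ### The differentials `dΩ̂_n` and `dS` -/

/-- The power series `(1 - ∑_{j=1}^N u_j t^{2j})^r` (binomial series). Since
`W(x) = x^{2N-2} (1 - ∑_j u_j x^{-2j})`, the Laurent expansion at `x = ∞` of `W(x)^r` is
`x^{(2N-2) r}` times this series at `t = 1/x`, when `(2N-2) r` is an integer. -/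
def powSeries {N : ℕ} (u : Fin N → ℂ) (r : ℚ) : PowerSeries ℂ :=
  (PowerSeries.binomialSeries ℂ r).subst
    (-∑ j : Fin N, PowerSeries.C (u j) * PowerSeries.X ^ (2 * ((j : ℕ) + 1)) : PowerSeries ℂ)

/-- `R_n = (W^{(2n-1)/(2N-2)})_+` for `n ≥ 1`, where `(⋯)_+` is the polynomial part of the Laurent
series `x^{2n-1} + ⋯` at `x = ∞`. -/
def R {N : ℕ} (u : Fin N → ℂ) (n : ℕ) : ℂ[X] :=
  ∑ k ∈ Finset.range (2 * n),
    C (PowerSeries.coeff k (powSeries u ((2 * (n : ℚ) - 1) / (2 * (N : ℚ) - 2)))) *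
      X ^ (2 * n - 1 - k)

/-- The differential `dz/z = W'(x) dx / (z - μ²/z)` on the curve. -/
def dlogz {N : ℕ} (μ : ℂ) (u : Fin N → ℂ) : Differential :=
  fun p => deriv (W u) p.1 / (p.2 - μ ^ 2 / p.2)

/-- `dΩ̂_n = R_n(x) dz/z`. -/
def dOmegaHat {N : ℕ} (μ : ℂ) (u : Fin N → ℂ) (n : ℕ) : Differential :=
  fun p => (R u n).eval p.1 * dlogz μ u p

/-- `dS = ∑_{n=1}^M T_n dΩ̂_n` (`T n` in Lean is `T_{n+1}`). -/
def dS {N M : ℕ} (μ : ℂ) (u : Fin N → ℂ) (T : Fin M → ℂ) : Differential :=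
  fun p => ∑ n : Fin M, T n * dOmegaHat μ u ((n : ℕ) + 1) p

/-- The point `T = (1, 0, 0, …)`. -/
def T₀ (M : ℕ) : Fin M → ℂ := fun n => if (n : ℕ) = 0 then 1 else 0

/-- The A-period map `a_j(u, T) = ∮_{A_j} dS`. -/
def periodMap {N M : ℕ} (μ : ℂ) (A : Fin N → (Fin N → ℂ) → ℝ → ℂ × ℂ) (u : Fin N → ℂ)
    (T : Fin M → ℂ) : Fin N → ℂ :=
  fun j => period (A j u) (dS μ u T)

/-- `dΩ_n = dΩ̂_n - ∑_j c_j^{(n)} dω_j`, where `c_j^{(n)} = ∮_{A_j} dΩ̂_n`. -/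
def dOmega {N : ℕ} (μ : ℂ) (A : Fin N → ℝ → ℂ × ℂ) (u : Fin N → ℂ) (om : Fin N → Differential)
    (n : ℕ) : Differential :=
  fun p => dOmegaHat μ u n p - ∑ j, period (A j) (dOmegaHat μ u n) * om j p

/-! ### Differentiation at constant `z` -/

/-- The coefficient `φ dx/dz` of the differential `φ dx` with respect to `dz`, where
`dz/dx = W'(x) / (1 - μ²/z²)` on the curve. -/
def dzCoeff {N : ℕ} (μ : ℂ) (u : Fin N → ℂ) (φ : Differential) (p : ℂ × ℂ) : ℂ :=
  φ p * ((1 - μ ^ 2 / p.2 ^ 2) / deriv (W u) p.1)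

/-- `x s` is a continuous solution of the equation `z + μ²/z = W_{v s}(x)` of the curve, for `s` near
`s₀` and with the constant value `z = p.2`, that starts at `x s₀ = p.1`. -/
def IsBranch {N : ℕ} (μ : ℂ) (v : ℂ → Fin N → ℂ) (s₀ : ℂ) (p : ℂ × ℂ) (x : ℂ → ℂ) : Prop :=
  x s₀ = p.1 ∧ ContinuousAt x s₀ ∧ ∀ᶠ s in 𝓝 s₀, (x s, p.2) ∈ curve μ (v s)

/-- `(∂/∂s) Φ_s |_{z = const} = ψ` at `s = s₀`, for differentials `Φ_s` on the curves with moduli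
`v s`: in the coordinate `z` (that is, at every point with `W'(x) ≠ 0`) write `Φ_s = f(s, z) dz`
by solving the equation of the curve for `x`; then `∂f/∂s dz = ψ` at `s = s₀`. -/
def HasDerivConstZ {N : ℕ} (μ : ℂ) (v : ℂ → Fin N → ℂ) (Φ : ℂ → Differential) (ψ : Differential)
    (s₀ : ℂ) : Prop :=
  ∀ p ∈ curve μ (v s₀), deriv (W (v s₀)) p.1 ≠ 0 →
    (∃ x, IsBranch μ v s₀ p x) ∧
    ∀ x, IsBranch μ v s₀ p x →
      HasDerivAt (fun s => dzCoeff μ (v s) (Φ s) (x s, p.2)) (dzCoeff μ (v s₀) ψ p) s₀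

end SOWhitham

end

/-!
# Whitham equations for the `SO(2N)` Seiberg–Witten curve

Write `r = (2n - 1) / (2N - 2)`, `R_n = (W^r)_+` and `dΩ̂_n = R_n dz / z`. Differentiating `dΩ̂_n` with
respect to the moduli `u` in a direction `v`, at constant `z`, gives
`((∂_v R_n) W' - R_n' (∂_v W)) x² dx / y`. If `R_n` is replaced by the full power `W^r`, the bracket
vanishes identically. Passing to the polynomial part therefore leaves only terms of low degree, and
the result is `(∑ c_i x^{2i}) dx / y` with `i < N`, an odd holomorphic differential
(`exists_RDot_mul_deriv_W_sub`, `exists_dOmegaHatDot_eq_oddDiff`). Conversely, by Liouville's theorem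
applied to sums over the two sheets, every odd holomorphic differential has this form
(`IsHolomorphic.exists_eq_oddDiff`), so these differentials form a space of dimension `N`.

On the curve with moduli `u₀` an odd holomorphic differential is determined by its periods along
`A_1, …, A_N` (`IsPrymCycles.eq_zero_of_period_eq_zero`). This is Riemann's bilinear relation: if
these periods of `ω` vanish, then `ω` minus a combination of the Poincaré duals of the A-cycles has no
periods at all, hence a primitive (`IsClosedForm.exists_isPrimitive`), and Stokes' theorem gives
`∬ ω ∧ ω̄ = 0`. The curve is given without its branch points and the points over `x = 0, ∞`, and
forms are only bounded near the missing points, in the sense of a growth condition. Stokes' theorem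
(`IsPrimitive.integral_wedgeAt_eq_zero`) is therefore proved on the `x`-plane, for sums over the
two sheets, with cut-off functions of `log |x y²|` and a truncation of the primitive.

The A-periods of `dΩ̂_n` are holomorphic functions of `u`, although the paths depend only smoothly on
`u`: the derivative of a period is the period of the derivative at constant `z`
(`IsLoopFamily.exists_hasFDerivAt_period`). At `T = (1, 0, …, 0)` the derivative of the period map
`(u, T) ↦ (a, T)` is thus given by the period matrix of the odd holomorphic differentials
(`fderiv_periodMap_T₀`), which is invertible at `u₀`. The inverse function theorem yields `u(a, T)`
and the invertibility of the period matrix nearby, hence the normalized differentials `dω_j`.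

Finally, along a variation `(δ, S)` of `(u, T)` the derivative of `dS` at constant `z` is
`∑ S_n dΩ̂_n` plus an odd holomorphic differential (`hasDerivConstZ_dS`), and the latter is
determined by the A-periods of the whole, which are the corresponding variations of `a`
(`sum_dOmega_add_eq`). Varying `a_j` at fixed `T` leaves `dω_j`, and varying `T_n` at fixed `a`
leaves `dΩ_n`.
-/

open scoped ContDiff Topology
open Polynomial MeasureTheory

noncomputable section

namespace SOWhitham

/-! ### Powers of the superpotential -/

theorem succ_mul_choose_succ (r : ℚ) (n : ℕ) :
    ((n : ℚ) + 1) * Ring.choose r (n + 1) = (r - n) * Ring.choose r n := by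
  have h1 := Ring.descPochhammer_eq_factorial_smul_choose r (n + 1)
  have h2 := Ring.descPochhammer_eq_factorial_smul_choose r n
  rw [descPochhammer_succ_right, Polynomial.smeval_mul, h2, Nat.factorial_succ] at h1
  have h3 : (n.factorial : ℚ) ≠ 0 := by exact_mod_cast n.factorial_ne_zero
  have h4 : (X - (n : ℤ[X])).smeval r = r - n := by
    simp [Polynomial.smeval_sub, Polynomial.smeval_X, Polynomial.smeval_natCast]
  rw [h4] at h1
  simp only [nsmul_eq_mul, Nat.cast_mul, Nat.cast_add, Nat.cast_one] at h1
  apply mul_left_cancel₀ h3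
  linear_combination -h1

/-- The differential equation `(1 + X) B' = r B` of the binomial series. -/
theorem one_add_X_mul_derivative_binomialSeries (r : ℚ) :
    (1 + PowerSeries.X) * PowerSeries.derivative ℂ (PowerSeries.binomialSeries ℂ r) =
      PowerSeries.C (r : ℂ) * PowerSeries.binomialSeries ℂ r := by
  ext n
  have key := fun n => congrArg (fun q : ℚ => (q : ℂ)) (succ_mul_choose_succ r n)
  push_cast at key
  rw [add_mul, one_mul, map_add, PowerSeries.coeff_C_mul]
  cases n with
  | zero =>
    have := key 0
    simp [PowerSeries.coeff_derivative, Rat.smul_def] at this ⊢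
  | succ n =>
    rw [PowerSeries.coeff_succ_X_mul]
    simp only [PowerSeries.coeff_derivative, PowerSeries.binomialSeries_coeff, Rat.smul_def]
    have := key (n + 1)
    push_cast at this ⊢
    linear_combination this

/-- The power series `-∑ u_j t^{2j}`, so that `W(x) = x^{2N-2} (1 + moduliSeries u)` at
`t = 1/x`. -/
def moduliSeries {N : ℕ} (u : Fin N → ℂ) : PowerSeries ℂ :=
  -∑ j : Fin N, PowerSeries.C (u j) * PowerSeries.X ^ (2 * ((j : ℕ) + 1))

theorem constantCoeff_moduliSeries {N : ℕ} (u : Fin N → ℂ) :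
    PowerSeries.constantCoeff (moduliSeries u) = 0 := by
  simp [moduliSeries]

theorem hasSubst_moduliSeries {N : ℕ} (u : Fin N → ℂ) :
    PowerSeries.HasSubst (moduliSeries u) :=
  PowerSeries.HasSubst.of_constantCoeff_zero' (constantCoeff_moduliSeries u)

theorem moduliSeries_add_smul {N : ℕ} (u v : Fin N → ℂ) (c : ℂ) :
    moduliSeries (u + c • v) = moduliSeries u + PowerSeries.C c * moduliSeries v := by
  simp only [moduliSeries, Pi.add_apply, Pi.smul_apply, smul_eq_mul, map_add, map_mul, add_mul,
    Finset.sum_add_distrib, neg_add, mul_neg, Finset.mul_sum]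
  congr 3
  ext j : 1
  ring

/-- The series `r (1 + s)^{r-1}` for `s = moduliSeries u`, so that `D ((1 + s)^r)` is this factor
times `D s` for every derivation `D`. It is defined as the composition of `B'` with `s`, where `B`
is the binomial series. -/
def powSeriesFactor {N : ℕ} (u : Fin N → ℂ) (r : ℚ) : PowerSeries ℂ :=
  (PowerSeries.derivative ℂ (PowerSeries.binomialSeries ℂ r)).subst (moduliSeries u)

/-- The relation `(1 + s) · r (1 + s)^{r-1} = r (1 + s)^r`. -/
theorem one_add_mul_powSeriesFactor {N : ℕ} (u : Fin N → ℂ) (r : ℚ) :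
    (1 + moduliSeries u) * powSeriesFactor u r = PowerSeries.C (r : ℂ) * powSeries u r := by
  have h := congrArg (PowerSeries.subst (moduliSeries u))
    (one_add_X_mul_derivative_binomialSeries r)
  have hs := hasSubst_moduliSeries u
  rw [PowerSeries.subst_mul hs, PowerSeries.subst_mul hs, PowerSeries.subst_add hs,
    PowerSeries.subst_X hs] at h
  have h1 : PowerSeries.subst (moduliSeries u) (1 : PowerSeries ℂ) = 1 := by
    rw [← PowerSeries.coe_substAlgHom hs, map_one]
  have h2 : PowerSeries.subst (moduliSeries u) (PowerSeries.C (r : ℂ) : PowerSeries ℂ) =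
      PowerSeries.C (r : ℂ) :=
    PowerSeries.subst_C (S := ℂ) (r : ℂ)
  rw [h1, h2] at h
  exact h

theorem derivative_powSeries {N : ℕ} (u : Fin N → ℂ) (r : ℚ) :
    PowerSeries.derivative ℂ (powSeries u r) =
      powSeriesFactor u r * PowerSeries.derivative ℂ (moduliSeries u) :=
  PowerSeries.derivative_subst (hasSubst_moduliSeries u)

theorem coeff_moduliSeries_pow_of_lt {N : ℕ} (u : Fin N → ℂ) {k n : ℕ} (h : k < n) :
    PowerSeries.coeff k (moduliSeries u ^ n) = 0 := by
  apply PowerSeries.coeff_of_lt_order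
  have h1 : (1 : ℕ∞) ≤ (moduliSeries u).order :=
    PowerSeries.one_le_order_iff_constCoeff_eq_zero.2 (constantCoeff_moduliSeries u)
  calc (k : ℕ∞) < n := by exact_mod_cast h
    _ = n • (1 : ℕ∞) := by simp
    _ ≤ n • (moduliSeries u).order := by gcongr
    _ ≤ _ := PowerSeries.le_order_pow (φ := moduliSeries u) n

theorem coeff_subst_moduliSeries {N : ℕ} (u : Fin N → ℂ) (f : PowerSeries ℂ) (k : ℕ) :
    PowerSeries.coeff k (f.subst (moduliSeries u)) =
      ∑ n ∈ Finset.range (k + 1), PowerSeries.coeff n f *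
        PowerSeries.coeff k (moduliSeries u ^ n) := by
  rw [PowerSeries.coeff_subst' (hasSubst_moduliSeries u)]
  rw [finsum_eq_sum_of_support_subset]
  · rfl
  · intro n hn
    by_contra h
    apply hn
    simp [coeff_moduliSeries_pow_of_lt u (show k < n by simpa using h)]

/-- A family of power series is differentiable coefficientwise, with derivative `F'` at `0`. -/
def HasCoeffDeriv (F : ℂ → PowerSeries ℂ) (F' : PowerSeries ℂ) : Prop :=
  ∀ k, HasDerivAt (fun s => PowerSeries.coeff k (F s)) (PowerSeries.coeff k F') 0

theorem HasCoeffDeriv.mul {F G : ℂ → PowerSeries ℂ} {F' G' : PowerSeries ℂ}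
    (hF : HasCoeffDeriv F F') (hG : HasCoeffDeriv G G') :
    HasCoeffDeriv (fun s => F s * G s) (F' * G 0 + F 0 * G') := by
  intro k
  simp only [PowerSeries.coeff_mul, map_add]
  rw [← Finset.sum_add_distrib]
  exact HasDerivAt.fun_sum fun p _ => (hF p.1).mul (hG p.2)

theorem HasCoeffDeriv.pow {F : ℂ → PowerSeries ℂ} {F' : PowerSeries ℂ}
    (hF : HasCoeffDeriv F F') (n : ℕ) :
    HasCoeffDeriv (fun s => F s ^ n) ((n : PowerSeries ℂ) * F 0 ^ (n - 1) * F') := by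
  induction n with
  | zero => intro k; simpa using hasDerivAt_const (0 : ℂ) _
  | succ n ih =>
    have h := ih.mul hF
    have h' : (fun s => F s ^ (n + 1)) = fun s => F s ^ n * F s := funext fun s => pow_succ _ _
    rw [h']
    convert h using 1
    rcases n with _ | n
    · simp
    · simp only [Nat.add_sub_cancel]
      push_cast
      ring

theorem hasCoeffDeriv_moduliSeries {N : ℕ} (u v : Fin N → ℂ) :
    HasCoeffDeriv (fun s => moduliSeries (u + s • v)) (moduliSeries v) := by
  intro k
  simp only [moduliSeries_add_smul, map_add, PowerSeries.coeff_C_mul]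
  simpa using ((hasDerivAt_id (0 : ℂ)).mul_const (PowerSeries.coeff k (moduliSeries v))).const_add
    (PowerSeries.coeff k (moduliSeries u))

/-- The chain rule for `u ↦ (1 + moduliSeries u)^r`: each coefficient is a finite sum over the
terms of the binomial series, which can be differentiated term by term. -/
theorem hasCoeffDeriv_powSeries {N : ℕ} (u v : Fin N → ℂ) (r : ℚ) :
    HasCoeffDeriv (fun s => powSeries (u + s • v) r) (powSeriesFactor u r * moduliSeries v) := by
  intro k
  set B := PowerSeries.binomialSeries ℂ r with hB
  have h1 : ∀ w : Fin N → ℂ, PowerSeries.coeff k (powSeries w r) =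
      ∑ n ∈ Finset.range (k + 2), PowerSeries.coeff n B *
        PowerSeries.coeff k (moduliSeries w ^ n) := by
    intro w
    rw [Finset.sum_range_succ, coeff_moduliSeries_pow_of_lt w (Nat.lt_succ_self k), mul_zero,
      add_zero]
    exact coeff_subst_moduliSeries w B k
  have h2 : PowerSeries.coeff k (powSeriesFactor u r * moduliSeries v) =
      ∑ n ∈ Finset.range (k + 2), PowerSeries.coeff n B *
        PowerSeries.coeff k ((n : PowerSeries ℂ) * moduliSeries u ^ (n - 1) * moduliSeries v) := by
    rw [Finset.sum_range_succ']
    simp only [Nat.cast_zero, zero_mul, map_zero, mul_zero, add_zero, Nat.add_sub_cancel]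
    rw [PowerSeries.coeff_mul]
    have h3 : ∀ p ∈ Finset.HasAntidiagonal.antidiagonal k,
        PowerSeries.coeff p.1 (powSeriesFactor u r) * PowerSeries.coeff p.2 (moduliSeries v) =
        ∑ n ∈ Finset.range (k + 1), PowerSeries.coeff n (PowerSeries.derivative ℂ B) *
          PowerSeries.coeff p.1 (moduliSeries u ^ n) * PowerSeries.coeff p.2 (moduliSeries v) := by
      intro p hp
      rw [powSeriesFactor, coeff_subst_moduliSeries, Finset.sum_mul]
      refine Finset.sum_subset ?_ ?_
      · have : p.1 ≤ k := by
          rw [Finset.HasAntidiagonal.mem_antidiagonal] at hp; omega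
        intro n hn
        simp only [Finset.mem_range] at hn ⊢
        omega
      · intro n _ hn
        rw [coeff_moduliSeries_pow_of_lt u (by simpa using hn)]
        simp
    rw [Finset.sum_congr rfl h3, Finset.sum_comm]
    refine Finset.sum_congr rfl fun n _ => ?_
    rw [mul_assoc ((n + 1 : ℕ) : PowerSeries ℂ), ← map_natCast (PowerSeries.C (R := ℂ)) (n + 1),
      PowerSeries.coeff_C_mul, PowerSeries.coeff_mul, PowerSeries.coeff_derivative,
      ← mul_assoc, Finset.mul_sum]
    refine Finset.sum_congr rfl fun p _ => ?_
    push_cast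
    ring
  rw [h2]
  simp only [h1]
  refine HasDerivAt.fun_sum fun n _ => HasDerivAt.const_mul _ ?_
  have := (hasCoeffDeriv_moduliSeries u v).pow n k
  simpa using this

theorem contDiff_coeff_powSeries {N : ℕ} (r : ℚ) (k : ℕ) :
    ContDiff ℂ ω (fun u : Fin N → ℂ => PowerSeries.coeff k (powSeries u r)) := by
  have h0 : ∀ k, ContDiff ℂ ω (fun u : Fin N → ℂ => PowerSeries.coeff k (moduliSeries u)) := by
    intro k
    simp only [moduliSeries, map_neg, map_sum, PowerSeries.coeff_C_mul]
    fun_prop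
  have h1 : ∀ n k, ContDiff ℂ ω
      (fun u : Fin N → ℂ => PowerSeries.coeff k (moduliSeries u ^ n)) := by
    intro n
    induction n with
    | zero => intro k; simp only [pow_zero]; fun_prop
    | succ n ih =>
      intro k
      simp only [pow_succ, PowerSeries.coeff_mul]
      exact ContDiff.sum fun p _ => (ih p.1).mul (h0 p.2)
  have h2 : (fun u : Fin N → ℂ => PowerSeries.coeff k (powSeries u r)) = fun u =>
      ∑ n ∈ Finset.range (k + 1), PowerSeries.coeff n (PowerSeries.binomialSeries ℂ r) *
        PowerSeries.coeff k (moduliSeries u ^ n) :=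
    funext fun u => coeff_subst_moduliSeries u _ k
  rw [h2]
  exact ContDiff.sum fun n _ => contDiff_const.mul (h1 n k)

theorem fderiv_coeff_powSeries {N : ℕ} (r : ℚ) (k : ℕ) (u v : Fin N → ℂ) :
    fderiv ℂ (fun u : Fin N → ℂ => PowerSeries.coeff k (powSeries u r)) u v =
      PowerSeries.coeff k (powSeriesFactor u r * moduliSeries v) := by
  have h1 : DifferentiableAt ℂ (fun u : Fin N → ℂ => PowerSeries.coeff k (powSeries u r)) u :=
    (contDiff_coeff_powSeries r k).differentiable (by simp) u
  rw [← h1.lineDeriv_eq_fderiv]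
  exact HasDerivAt.deriv (hasCoeffDeriv_powSeries u v r k)

/-- The series contains only even powers. -/
def IsEvenSeries (f : PowerSeries ℂ) : Prop :=
  ∀ k, ¬ 2 ∣ k → PowerSeries.coeff k f = 0

theorem IsEvenSeries.mul {f g : PowerSeries ℂ} (hf : IsEvenSeries f) (hg : IsEvenSeries g) :
    IsEvenSeries (f * g) := by
  intro k hk
  rw [PowerSeries.coeff_mul]
  refine Finset.sum_eq_zero fun p hp => ?_
  rw [Finset.HasAntidiagonal.mem_antidiagonal] at hp
  by_cases h : 2 ∣ p.1
  · rw [hg p.2 (by omega), mul_zero]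
  · rw [hf _ h, zero_mul]

theorem IsEvenSeries.add {f g : PowerSeries ℂ} (hf : IsEvenSeries f) (hg : IsEvenSeries g) :
    IsEvenSeries (f + g) := fun k hk => by rw [map_add, hf k hk, hg k hk, add_zero]

theorem IsEvenSeries.sub {f g : PowerSeries ℂ} (hf : IsEvenSeries f) (hg : IsEvenSeries g) :
    IsEvenSeries (f - g) := fun k hk => by rw [map_sub, hf k hk, hg k hk, sub_zero]

theorem isEvenSeries_C (c : ℂ) : IsEvenSeries (PowerSeries.C c) := fun k hk => by
  have : k ≠ 0 := by rintro rfl; simp at hk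
  simp [PowerSeries.coeff_C, this]

theorem IsEvenSeries.X_mul_derivative {f : PowerSeries ℂ} (hf : IsEvenSeries f) :
    IsEvenSeries (PowerSeries.X * PowerSeries.derivative ℂ f) := fun k hk => by
  rcases k with _ | k
  · simp at hk
  · rw [PowerSeries.coeff_succ_X_mul, PowerSeries.coeff_derivative, hf _ hk, zero_mul]

theorem isEvenSeries_moduliSeries {N : ℕ} (u : Fin N → ℂ) : IsEvenSeries (moduliSeries u) := by
  intro k hk
  simp only [moduliSeries, map_neg, map_sum, PowerSeries.coeff_C_mul,
    PowerSeries.coeff_X_pow, neg_eq_zero]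
  refine Finset.sum_eq_zero fun j _ => ?_
  rw [if_neg (by omega), mul_zero]

theorem isEvenSeries_subst_moduliSeries {N : ℕ} (u : Fin N → ℂ) (f : PowerSeries ℂ) :
    IsEvenSeries (f.subst (moduliSeries u)) := by
  have h : ∀ n, IsEvenSeries (moduliSeries u ^ n) := by
    intro n
    induction n with
    | zero => simpa using isEvenSeries_C 1
    | succ n ih => rw [pow_succ]; exact ih.mul (isEvenSeries_moduliSeries u)
  intro k hk
  rw [coeff_subst_moduliSeries]
  exact Finset.sum_eq_zero fun n _ => by rw [h n k hk, mul_zero]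

/-! ### Variation of the differentials with the moduli -/

/-- The derivative of `W u x` with respect to the moduli `u`, in the direction `v`. -/
def WDot {N : ℕ} (v : Fin N → ℂ) (x : ℂ) : ℂ :=
  -((x ^ 2)⁻¹ * ∑ j : Fin N, v j * (x ^ 2) ^ (N - 1 - (j : ℕ)))

/-- The exponent `(2n - 1) / (2N - 2)` in the definition of `R_n`. -/
def rExp (N n : ℕ) : ℚ := (2 * (n : ℚ) - 1) / (2 * (N : ℚ) - 2)

/-- The derivative of the polynomial `R u n` with respect to the moduli `u`, in the direction
`v`. -/
def RDot {N : ℕ} (u v : Fin N → ℂ) (n : ℕ) : ℂ[X] :=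
  ∑ k ∈ Finset.range (2 * n),
    C (PowerSeries.coeff k (powSeriesFactor u (rExp N n) * moduliSeries v)) * X ^ (2 * n - 1 - k)

/-- The derivative of `dΩ̂_n` with respect to the moduli `u` at constant `z`, in the direction
`v`. -/
def dOmegaHatDot {N : ℕ} (μ : ℂ) (u v : Fin N → ℂ) (n : ℕ) : Differential := fun p =>
  ((RDot u v n).eval p.1 * deriv (W u) p.1 - (derivative (R u n)).eval p.1 * WDot v p.1) /
    (p.2 - μ ^ 2 / p.2)

theorem sum_C_mul_X_pow_eval (f : PowerSeries ℂ) (n : ℕ) {x : ℂ} (hx : x ≠ 0) :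
    (∑ k ∈ Finset.range (2 * n), C (PowerSeries.coeff k f) * X ^ (2 * n - 1 - k) : ℂ[X]).eval x =
      x ^ (2 * n - 1) * (PowerSeries.trunc (2 * n) f).eval x⁻¹ := by
  rw [PowerSeries.trunc_apply, ← Finset.range_eq_Ico, eval_finsetSum, eval_finsetSum, Finset.mul_sum]
  refine Finset.sum_congr rfl fun k hk => ?_
  have hk' : k ≤ 2 * n - 1 := by have := Finset.mem_range.1 hk; omega
  simp only [eval_mul, eval_C, eval_pow, eval_X, eval_monomial]
  rw [inv_pow, pow_sub₀ x hx hk']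
  ring

theorem WDot_eq {N : ℕ} (hN : 1 ≤ N) (v : Fin N → ℂ) {x : ℂ} (hx : x ≠ 0) :
    WDot v x = x ^ (2 * N - 2) *
      (-∑ j : Fin N, C (v j) * X ^ (2 * ((j : ℕ) + 1)) : ℂ[X]).eval x⁻¹ := by
  rw [WDot, eval_neg, eval_finsetSum, mul_neg, neg_inj, Finset.mul_sum, Finset.mul_sum]
  refine Finset.sum_congr rfl fun j _ => ?_
  simp only [eval_mul, eval_C, eval_pow, eval_X]
  have h1 : 2 * N - 2 = 2 * (N - 1 - (j : ℕ)) + 2 * j := by omega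
  rw [inv_pow, h1, pow_add, mul_add 2, pow_add x (2 * (j : ℕ)), ← pow_mul]
  field_simp
  ring

theorem W_eq {N : ℕ} (hN : 1 ≤ N) (u : Fin N → ℂ) {x : ℂ} (hx : x ≠ 0) :
    W u x = x ^ (2 * N - 2) *
      (1 + -∑ j : Fin N, C (u j) * X ^ (2 * ((j : ℕ) + 1)) : ℂ[X]).eval x⁻¹ := by
  rw [eval_add, mul_add, ← WDot_eq hN u hx, W, Q, WDot, eval_sub, eval_finsetSum, mul_sub,
    sub_eq_add_neg]
  congr 1
  · simp only [eval_pow, eval_X, eval_one, mul_one]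
    rw [← pow_mul, show 2 * N = 2 + (2 * N - 2) by omega, pow_add]
    field_simp
    simp
  · simp

theorem hasDerivAt_pow_mul_eval_inv (m : ℕ) (p : ℂ[X]) {x : ℂ} (hx : x ≠ 0) :
    HasDerivAt (fun x => x ^ (m + 1) * p.eval x⁻¹)
      (x ^ m * ((C ((m : ℂ) + 1) * p - X * derivative p).eval x⁻¹)) x := by
  have h := (hasDerivAt_pow (m + 1) x).mul ((p.hasDerivAt x⁻¹).comp x (hasDerivAt_inv hx))
  refine HasDerivAt.congr_deriv h ?_
  simp only [eval_sub, eval_mul, eval_C, eval_X, Function.comp_apply]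
  push_cast
  field_simp
  ring

theorem sum_range_two_mul (f : ℕ → ℂ) (K : ℕ) : ∑ l ∈ Finset.range (2 * K), f l =
    ∑ i ∈ Finset.range K, (f (2 * i) + f (2 * i + 1)) := by
  induction K with
  | zero => simp
  | succ K ih =>
    rw [mul_add, mul_one, Finset.sum_range_succ, Finset.sum_range_succ, ih, Finset.sum_range_succ]
    ring

/-- An even polynomial with no terms below degree `2n` and none from degree `2(n + N)` on has only
`N` coefficients. -/
theorem IsEvenSeries.eval_eq_of_coeff_eq_zero {G : ℂ[X]} {n N : ℕ}
    (heven : IsEvenSeries (G : PowerSeries ℂ)) (hlow : ∀ l < 2 * n, G.coeff l = 0)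
    (hdeg : G.natDegree < 2 * (n + N)) (t : ℂ) :
    G.eval t = ∑ i ∈ Finset.range N, G.coeff (2 * (n + i)) * t ^ (2 * (n + i)) := by
  have hodd : ∀ i, G.coeff (2 * i + 1) = 0 := fun i => by
    have := heven (2 * i + 1) (by omega)
    rwa [Polynomial.coeff_coe] at this
  rw [eval_eq_sum_range' hdeg, sum_range_two_mul, Finset.sum_range_add]
  have : ∑ i ∈ Finset.range n, (G.coeff (2 * i) * t ^ (2 * i) +
      G.coeff (2 * i + 1) * t ^ (2 * i + 1)) = 0 := by
    refine Finset.sum_eq_zero fun i hi => ?_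
    rw [hodd, hlow _ (by have := Finset.mem_range.1 hi; omega)]
    ring
  rw [this, zero_add]
  refine Finset.sum_congr rfl fun i _ => ?_
  rw [hodd]
  ring

theorem coeff_mul_eq_of_coeff_eq {f f' : PowerSeries ℂ} {K : ℕ}
    (h : ∀ l < K, PowerSeries.coeff l f = PowerSeries.coeff l f') (g : PowerSeries ℂ) {l : ℕ}
    (hl : l < K) : PowerSeries.coeff l (f * g) = PowerSeries.coeff l (f' * g) := by
  simp only [PowerSeries.coeff_mul]
  refine Finset.sum_congr rfl fun p hp => ?_
  rw [Finset.HasAntidiagonal.mem_antidiagonal] at hp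
  rw [h p.1 (by omega)]

theorem coe_bracket (a b : ℂ) (p q f g : ℂ[X]) :
    ((p * (C a * q - X * derivative q) - (C b * f - X * derivative f) * g : ℂ[X]) :
      PowerSeries ℂ) = (p : PowerSeries ℂ) * (PowerSeries.C a * (q : PowerSeries ℂ) -
        PowerSeries.X * PowerSeries.derivative ℂ (q : PowerSeries ℂ)) -
      (PowerSeries.C b * (f : PowerSeries ℂ) - PowerSeries.X *
        PowerSeries.derivative ℂ (f : PowerSeries ℂ)) * (g : PowerSeries ℂ) := by
  simp only [Polynomial.coe_sub, Polynomial.coe_mul, Polynomial.coe_C, Polynomial.coe_X,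
    PowerSeries.derivative_coe]

/-- At constant `z`, the derivatives of the differentials `dΩ̂_n` with respect to the moduli are
holomorphic. For the full power `P = W^r` in place of `R_n`, the bracket
`(∂_v P) W' - P' (∂_v W)` vanishes, both terms being `r W^{r-1} W' ∂_v W`. Passing to the polynomial
part changes the bracket by terms of low degree only. -/
theorem exists_RDot_mul_deriv_W_sub {N : ℕ} (hN : 2 ≤ N) (u v : Fin N → ℂ) (n : ℕ) :
    ∃ c : Fin N → ℂ, ∀ x : ℂ, x ≠ 0 →
      x ^ 2 * ((RDot u v (n + 1)).eval x * deriv (W u) x -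
        (derivative (R u (n + 1))).eval x * WDot v x) = ∑ i : Fin N, c i * x ^ (2 * (i : ℕ)) := by
  set r : ℚ := rExp N (n + 1) with hr
  set F := powSeriesFactor u r with hF
  set P := powSeries u r with hP
  set s : (Fin N → ℂ) → ℂ[X] := fun v => -∑ j : Fin N, C (v j) * X ^ (2 * ((j : ℕ) + 1)) with hs
  have hs_coe : ∀ v, ((s v : ℂ[X]) : PowerSeries ℂ) = moduliSeries v := by
    intro v
    rw [← Polynomial.coeToPowerSeries.ringHom_apply]
    simp only [hs, moduliSeries, map_neg, map_sum, map_mul, map_pow]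
    simp
  set m : ℕ := 2 * n with hm
  -- the polynomial `G` is the bracket at `x = 1 / t`, up to a power of `t`
  set G : ℂ[X] := PowerSeries.trunc (2 * (n + 1)) (F * moduliSeries v) *
      (C (((2 * N - 3 : ℕ) : ℂ) + 1) * (1 + s u) - X * derivative (1 + s u)) -
    (C ((m : ℂ) + 1) * PowerSeries.trunc (2 * (n + 1)) P -
      X * derivative (PowerSeries.trunc (2 * (n + 1)) P)) * s v with hG
  have hE : ∀ x : ℂ, x ≠ 0 → (RDot u v (n + 1)).eval x * deriv (W u) x -
        (derivative (R u (n + 1))).eval x * WDot v x =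
      x ^ (2 * n + 1 + (2 * N - 3)) * G.eval x⁻¹ := by
    intro x hx
    have h1 : HasDerivAt (W u) (x ^ (2 * N - 3) *
        ((C (((2 * N - 3 : ℕ) : ℂ) + 1) * (1 + s u) - X * derivative (1 + s u)).eval x⁻¹)) x := by
      refine (hasDerivAt_pow_mul_eval_inv (2 * N - 3) (1 + s u) hx).congr_of_eventuallyEq ?_
      filter_upwards [isOpen_ne.mem_nhds hx] with y hy
      rw [W_eq (by omega) u hy, show 2 * N - 3 + 1 = 2 * N - 2 by omega]
    have h2 : (derivative (R u (n + 1))).eval x = x ^ m *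
        ((C ((m : ℂ) + 1) * PowerSeries.trunc (2 * (n + 1)) P -
          X * derivative (PowerSeries.trunc (2 * (n + 1)) P)).eval x⁻¹) := by
      refine ((R u (n + 1)).hasDerivAt x).unique ?_
      refine (hasDerivAt_pow_mul_eval_inv m (PowerSeries.trunc (2 * (n + 1)) P)
        hx).congr_of_eventuallyEq ?_
      filter_upwards [isOpen_ne.mem_nhds hx] with y hy
      rw [show m + 1 = 2 * (n + 1) - 1 by omega, ← sum_C_mul_X_pow_eval P (n + 1) hy]
      simp [R, hP, hr, rExp]
    rw [h1.deriv, h2, RDot, sum_C_mul_X_pow_eval _ _ hx, WDot_eq (by omega) v hx, hG]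
    simp only [eval_sub, eval_mul]
    rw [show 2 * N - 2 = 2 * N - 3 + 1 by omega, show 2 * (n + 1) - 1 = 2 * n + 1 by omega, hm]
    ring
  have hcoe : (G : PowerSeries ℂ) =
      ((PowerSeries.trunc (2 * (n + 1)) (F * moduliSeries v) : ℂ[X]) : PowerSeries ℂ) *
      (PowerSeries.C (((2 * N - 3 : ℕ) : ℂ) + 1) * (1 + moduliSeries u) -
        PowerSeries.X * PowerSeries.derivative ℂ (1 + moduliSeries u)) -
    (PowerSeries.C ((m : ℂ) + 1) * ((PowerSeries.trunc (2 * (n + 1)) P : ℂ[X]) : PowerSeries ℂ) -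
      PowerSeries.X * PowerSeries.derivative ℂ
        ((PowerSeries.trunc (2 * (n + 1)) P : ℂ[X]) : PowerSeries ℂ)) * moduliSeries v := by
    have hone : (1 : PowerSeries ℂ) + moduliSeries u = ((1 + s u : ℂ[X]) : PowerSeries ℂ) := by
      rw [Polynomial.coe_add, hs_coe, Polynomial.coe_one]
    rw [hone, hG]
    generalize PowerSeries.trunc (2 * (n + 1)) (F * moduliSeries v) = p
    rw [← hs_coe v]
    generalize PowerSeries.trunc (2 * (n + 1)) P = p'
    generalize s v = g
    generalize 1 + s u = q
    exact coe_bracket _ _ p q p' g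
  have htr : ∀ (f : PowerSeries ℂ), ∀ l < 2 * (n + 1), PowerSeries.coeff l
      ((PowerSeries.trunc (2 * (n + 1)) f : ℂ[X]) : PowerSeries ℂ) = PowerSeries.coeff l f := by
    intro f l hl
    rw [Polynomial.coeff_coe, PowerSeries.coeff_trunc, if_pos hl]
  have htr_even : ∀ (f : PowerSeries ℂ), IsEvenSeries f →
      IsEvenSeries ((PowerSeries.trunc (2 * (n + 1)) f : ℂ[X]) : PowerSeries ℂ) := by
    intro f hf l hl
    rw [Polynomial.coeff_coe, PowerSeries.coeff_trunc, hf l hl, ite_self]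
  have hone : IsEvenSeries (1 + moduliSeries u) := by
    simpa using (isEvenSeries_C 1).add (isEvenSeries_moduliSeries u)
  have heven : IsEvenSeries (G : PowerSeries ℂ) := by
    rw [hcoe]
    have h1 := htr_even _ (isEvenSeries_subst_moduliSeries u (PowerSeries.binomialSeries ℂ r))
    exact ((htr_even _ ((isEvenSeries_subst_moduliSeries u _).mul
      (isEvenSeries_moduliSeries v))).mul (((isEvenSeries_C _).mul hone).sub
        hone.X_mul_derivative)).sub ((((isEvenSeries_C _).mul h1).sub h1.X_mul_derivative).mul
          (isEvenSeries_moduliSeries v))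
  -- without truncation the bracket vanishes
  have hzero : F * moduliSeries v * (PowerSeries.C (((2 * N - 3 : ℕ) : ℂ) + 1) *
      (1 + moduliSeries u) - PowerSeries.X * PowerSeries.derivative ℂ (1 + moduliSeries u)) -
    (PowerSeries.C ((m : ℂ) + 1) * P - PowerSeries.X * PowerSeries.derivative ℂ P) *
      moduliSeries v = 0 := by
    have h1 := one_add_mul_powSeriesFactor u r
    have h2 := derivative_powSeries u r
    have hr1 : (r : ℂ) * (((2 * N - 3 : ℕ) : ℂ) + 1) = (m : ℂ) + 1 := by
      have h3 : ((2 * N - 3 : ℕ) : ℂ) = 2 * N - 3 := by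
        rw [Nat.cast_sub (by omega)]; push_cast; ring
      have h4 : (2 : ℂ) * N - 2 ≠ 0 := by
        intro h
        have : (2 * (N : ℂ)) = ((2 : ℕ) : ℂ) := by push_cast; linear_combination h
        norm_cast at this
        omega
      rw [h3, hr, rExp, hm]
      push_cast
      rw [div_mul_eq_mul_div, div_eq_iff h4]
      ring
    rw [← hP, ← hF] at h1 h2
    rw [h2, map_add (PowerSeries.derivative ℂ), Derivation.map_one_eq_zero, zero_add]
    have hC : PowerSeries.C (r : ℂ) * PowerSeries.C (((2 * N - 3 : ℕ) : ℂ) + 1) =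
        PowerSeries.C ((m : ℂ) + 1) := by rw [← map_mul, hr1]
    rw [← hC]
    linear_combination moduliSeries v * PowerSeries.C (((2 * N - 3 : ℕ) : ℂ) + 1) * h1
  -- truncation at degree `2 (n + 1)` does not affect the coefficients below this degree
  have hlow : ∀ l < 2 * (n + 1), G.coeff l = 0 := by
    intro l hl
    have h1 : PowerSeries.coeff l (G : PowerSeries ℂ) = 0 := by
      rw [hcoe, ← (PowerSeries.coeff l).map_zero, ← hzero, map_sub, map_sub]
      congr 1
      · exact coeff_mul_eq_of_coeff_eq (htr _) _ hl
      · refine coeff_mul_eq_of_coeff_eq (fun l hl => ?_) _ hl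
        rw [map_sub, map_sub, PowerSeries.coeff_C_mul, PowerSeries.coeff_C_mul, htr _ _ hl]
        congr 1
        rcases l with _ | l
        · simp
        · rw [PowerSeries.coeff_succ_X_mul, PowerSeries.coeff_succ_X_mul,
            PowerSeries.coeff_derivative, PowerSeries.coeff_derivative, htr _ _ hl]
    rwa [Polynomial.coeff_coe] at h1
  have hdeg : G.natDegree < 2 * (n + 1 + N) := by
    have hsdeg : ∀ v, (s v).natDegree ≤ 2 * N := by
      intro v
      rw [hs, natDegree_neg]
      refine natDegree_sum_le_of_forall_le _ _ fun j _ => ?_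
      exact (natDegree_C_mul_X_pow_le _ _).trans (by omega)
    have hX : ∀ (p : ℂ[X]) (d : ℕ), p.natDegree ≤ d → ∀ c : ℂ,
        (C c * p - X * derivative p).natDegree ≤ d := by
      intro p d hp c
      refine (natDegree_sub_le_of_le ((natDegree_C_mul_le _ _).trans hp) (n := d) ?_).trans (by simp)
      rcases Nat.eq_zero_or_pos p.natDegree with h0 | h0
      · rw [natDegree_eq_zero.1 h0 |>.choose_spec.symm]
        simp
      · refine natDegree_mul_le.trans ?_
        have := natDegree_derivative_lt h0.ne'
        rw [natDegree_X]
        omega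
    have htd : ∀ f : PowerSeries ℂ, (PowerSeries.trunc (2 * (n + 1)) f).natDegree ≤ 2 * n + 1 :=
      fun f => by
        have := PowerSeries.natDegree_trunc_lt f (2 * n + 1)
        exact Nat.lt_succ_iff.1 this
    refine lt_of_le_of_lt (natDegree_sub_le_of_le (m := 2 * n + 1 + 2 * N)
      (n := 2 * n + 1 + 2 * N) ?_ ?_) (by simp; omega)
    · refine natDegree_mul_le_of_le (htd _) (hX _ _ ?_ _)
      exact (natDegree_add_le_of_le (m := 2 * N) (by rw [natDegree_one]; omega)
        (hsdeg u)).trans (by simp)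
    · exact natDegree_mul_le_of_le (hX _ _ (htd _) _) (hsdeg v)
  refine ⟨fun i => G.coeff (2 * (n + 1 + (N - 1 - i))), fun x hx => ?_⟩
  rw [hE x hx, heven.eval_eq_of_coeff_eq_zero hlow hdeg,
    Fin.sum_univ_eq_sum_range (fun i => G.coeff (2 * (n + 1 + (N - 1 - i))) * x ^ (2 * i)),
    ← Finset.sum_range_reflect (fun i => G.coeff (2 * (n + 1 + (N - 1 - i))) * x ^ (2 * i)),
    Finset.mul_sum, Finset.mul_sum]
  refine Finset.sum_congr rfl fun i hi => ?_
  have hi' := Finset.mem_range.1 hi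
  have h1 : 2 + (2 * n + 1 + (2 * N - 3)) = 2 * (N - 1 - i) + 2 * (n + 1 + i) := by omega
  rw [show N - 1 - (N - 1 - i) = i by omega, inv_pow, ← mul_assoc, ← pow_add, h1, pow_add]
  field_simp

/-! ### The two sheets of the curve -/

theorem eval_hyperellipticPoly {N : ℕ} (μ : ℂ) (u : Fin N → ℂ) (x : ℂ) :
    (hyperellipticPoly μ u).eval x = (Q u).eval (x ^ 2) ^ 2 - 4 * μ ^ 2 * x ^ 4 := by
  simp [hyperellipticPoly]

theorem degree_sum_moduli_lt {N : ℕ} (u : Fin N → ℂ) :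
    (∑ j : Fin N, C (u j) * X ^ (N - 1 - (j : ℕ))).degree < (N : WithBot ℕ) := by
  refine lt_of_le_of_lt (degree_sum_le _ _) ?_
  refine (Finset.sup_lt_iff (WithBot.bot_lt_coe N)).2 ?_
  intro j _
  refine lt_of_le_of_lt (degree_C_mul_X_pow_le _ _) ?_
  have hj : N - 1 - (j : ℕ) < N := by omega
  exact WithBot.coe_lt_coe.2 hj

theorem monic_Q {N : ℕ} (u : Fin N → ℂ) : (Q u).Monic :=
  monic_X_pow_sub (degree_sum_moduli_lt u)

theorem natDegree_Q {N : ℕ} (u : Fin N → ℂ) : (Q u).natDegree = N := by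
  refine natDegree_eq_of_degree_eq_some ?_
  rw [Q, degree_sub_eq_left_of_degree_lt, degree_X_pow]
  rw [degree_X_pow]
  exact degree_sum_moduli_lt u

theorem monic_Q_comp_sq {N : ℕ} (u : Fin N → ℂ) : (((Q u).comp (X ^ 2)) ^ 2).Monic :=
  ((monic_Q u).comp (monic_X_pow 2) (by simp)).pow 2

theorem natDegree_Q_comp_sq {N : ℕ} (u : Fin N → ℂ) :
    (((Q u).comp (X ^ 2)) ^ 2).natDegree = 4 * N := by
  rw [natDegree_pow, natDegree_comp, natDegree_Q, natDegree_X_pow]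
  ring

theorem natDegree_C_mul_X_pow_lt {N : ℕ} (hN : 2 ≤ N) (μ : ℂ) (u : Fin N → ℂ) :
    (C (4 * μ ^ 2) * X ^ 4).natDegree < (((Q u).comp (X ^ 2)) ^ 2).natDegree := by
  rw [natDegree_Q_comp_sq]
  exact lt_of_le_of_lt (natDegree_C_mul_X_pow_le _ _) (by omega)

theorem monic_hyperellipticPoly {N : ℕ} (hN : 2 ≤ N) (μ : ℂ) (u : Fin N → ℂ) :
    (hyperellipticPoly μ u).Monic :=
  (monic_Q_comp_sq u).sub_of_left (degree_lt_degree (natDegree_C_mul_X_pow_lt hN μ u))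

theorem natDegree_hyperellipticPoly {N : ℕ} (hN : 2 ≤ N) (μ : ℂ) (u : Fin N → ℂ) :
    (hyperellipticPoly μ u).natDegree = 4 * N := by
  rw [hyperellipticPoly, natDegree_sub_eq_left_of_natDegree_lt (natDegree_C_mul_X_pow_lt hN μ u),
    natDegree_Q_comp_sq]

/-- For `μ = 0` the hyperelliptic polynomial is a square. -/
theorem IsSmoothCurve.ne_zero {N : ℕ} (hN : 2 ≤ N) {μ : ℂ} {u : Fin N → ℂ}
    (h : IsSmoothCurve μ u) : μ ≠ 0 := by
  rintro rfl
  have h1 : hyperellipticPoly 0 u = (Q u).comp (X ^ 2) ^ 2 := by simp [hyperellipticPoly]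
  have h2 : IsUnit ((Q u).comp (X ^ 2)) :=
    (h.squarefree : Squarefree (hyperellipticPoly 0 u)) _ (by rw [h1, sq ((Q u).comp (X ^ 2))])
  have h3 := natDegree_eq_zero_of_isUnit (h2.pow 2)
  rw [natDegree_Q_comp_sq] at h3
  omega

theorem IsSmoothCurve.eval_zero_ne {N : ℕ} {μ : ℂ} {u : Fin N → ℂ} (h : IsSmoothCurve μ u) :
    (hyperellipticPoly μ u).eval 0 ≠ 0 := by
  intro h0
  have hQ : (Q u).eval 0 = 0 := by simpa [eval_hyperellipticPoly] using h0
  have h1 : (derivative (hyperellipticPoly μ u)).eval 0 = 0 := by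
    simp [hyperellipticPoly, derivative_pow, hQ]
  obtain ⟨a, b, hab⟩ := h
  have := congrArg (eval 0) hab
  simp [h0, h1] at this

/-- The points of the `x`-plane over which `curve μ u` has its two sheets. -/
def regularSet {N : ℕ} (μ : ℂ) (u : Fin N → ℂ) : Set ℂ :=
  {x | x ≠ 0 ∧ (hyperellipticPoly μ u).eval x ≠ 0}

theorem isOpen_regularSet {N : ℕ} (μ : ℂ) (u : Fin N → ℂ) : IsOpen (regularSet μ u) :=
  isOpen_ne.inter ((isOpen_ne (x := (0 : ℂ))).preimage (hyperellipticPoly μ u).continuous)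

theorem IsSmoothCurve.finite_compl_regularSet {N : ℕ} {μ : ℂ} {u : Fin N → ℂ}
    (h : IsSmoothCurve μ u) : (regularSet μ u)ᶜ.Finite := by
  have h0 : X * hyperellipticPoly μ u ≠ 0 := by
    refine mul_ne_zero X_ne_zero fun h1 => h.eval_zero_ne ?_
    rw [h1, eval_zero]
  refine (Polynomial.finite_setOfPred_isRoot h0).subset fun x hx => ?_
  simp only [regularSet, Set.mem_compl_iff, Set.mem_ofPred_eq, not_and_or, not_not] at hx
  simpa [IsRoot] using hx

/-- The involution `(x, z) ↦ (x, μ²/z)`, i.e. `(x, y) ↦ (x, -y)`, that exchanges the sheets. -/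
def tau (μ : ℂ) (p : ℂ × ℂ) : ℂ × ℂ := (p.1, μ ^ 2 / p.2)

theorem yCoord_tau {μ : ℂ} (hμ : μ ≠ 0) {p : ℂ × ℂ} (hp : p.2 ≠ 0) :
    yCoord μ (tau μ p) = -yCoord μ p := by
  simp only [yCoord, tau]
  field_simp
  ring

theorem sub_div_ne_zero {N : ℕ} {μ : ℂ} {u : Fin N → ℂ} {p : ℂ × ℂ} (hp : p ∈ curve μ u) :
    p.2 - μ ^ 2 / p.2 ≠ 0 := by
  obtain ⟨_, h2, h3, _⟩ := hp
  intro h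
  apply h3
  field_simp at h
  linear_combination h

theorem yCoord_ne_zero {N : ℕ} {μ : ℂ} {u : Fin N → ℂ} {p : ℂ × ℂ} (hp : p ∈ curve μ u) :
    yCoord μ p ≠ 0 :=
  mul_ne_zero (pow_ne_zero 2 hp.1) (sub_div_ne_zero hp)

theorem W_eq_add {N : ℕ} {μ : ℂ} {u : Fin N → ℂ} {p : ℂ × ℂ} (hp : p ∈ curve μ u) :
    (Q u).eval (p.1 ^ 2) = p.1 ^ 2 * (p.2 + μ ^ 2 / p.2) := by
  obtain ⟨h1, _, _, h4⟩ := hp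
  rw [h4, W, ← mul_assoc, mul_inv_cancel₀ (pow_ne_zero 2 h1), one_mul]

theorem yCoord_sq {N : ℕ} {μ : ℂ} {u : Fin N → ℂ} {p : ℂ × ℂ} (hp : p ∈ curve μ u) :
    yCoord μ p ^ 2 = (hyperellipticPoly μ u).eval p.1 := by
  have h2 : p.2 ≠ 0 := hp.2.1
  rw [eval_hyperellipticPoly, W_eq_add hp, yCoord]
  field_simp
  ring

theorem fst_mem_regularSet {N : ℕ} {μ : ℂ} {u : Fin N → ℂ} {p : ℂ × ℂ} (hp : p ∈ curve μ u) :
    p.1 ∈ regularSet μ u :=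
  ⟨hp.1, by rw [← yCoord_sq hp]; exact pow_ne_zero 2 (yCoord_ne_zero hp)⟩

/-- The point of the curve with given `x` and `y`. -/
def ofXY {N : ℕ} (u : Fin N → ℂ) (x y : ℂ) : ℂ × ℂ := (x, (W u x + y / x ^ 2) / 2)

theorem ofXY_yCoord {N : ℕ} {μ : ℂ} {u : Fin N → ℂ} {p : ℂ × ℂ} (hp : p ∈ curve μ u) :
    ofXY u p.1 (yCoord μ p) = p := by
  have h1 := hp.1
  refine Prod.ext rfl ?_
  have h2 := hp.2.1
  simp only [ofXY, yCoord]
  rw [← hp.2.2.2]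
  field_simp
  ring

theorem ofXY_mem_curve {N : ℕ} {μ : ℂ} (hμ : μ ≠ 0) {u : Fin N → ℂ} {x y : ℂ}
    (hx : x ∈ regularSet μ u) (hy : y ^ 2 = (hyperellipticPoly μ u).eval x) :
    ofXY u x y ∈ curve μ u ∧ yCoord μ (ofXY u x y) = y := by
  obtain ⟨hx0, hh⟩ := hx
  have hy0 : y ≠ 0 := by rintro rfl; apply hh; rw [← hy]; ring
  have hW : (Q u).eval (x ^ 2) = x ^ 2 * W u x := by
    rw [W, ← mul_assoc, mul_inv_cancel₀ (pow_ne_zero 2 hx0), one_mul]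
  rw [eval_hyperellipticPoly, hW] at hy
  set w := W u x with hw
  have hprod : (w + y / x ^ 2) / 2 * ((w - y / x ^ 2) / 2) = μ ^ 2 := by
    field_simp
    linear_combination -hy
  have hz : (w + y / x ^ 2) / 2 ≠ 0 := by
    intro h
    rw [h, zero_mul] at hprod
    exact pow_ne_zero 2 hμ hprod.symm
  have hdiv : μ ^ 2 / ((w + y / x ^ 2) / 2) = (w - y / x ^ 2) / 2 := by
    rw [div_eq_iff hz, mul_comm, hprod]
  refine ⟨⟨hx0, hz, ?_, ?_⟩, ?_⟩
  · show ((w + y / x ^ 2) / 2) ^ 2 ≠ μ ^ 2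
    intro h
    rw [← hprod, sq, mul_right_inj' hz] at h
    have : y / x ^ 2 = 0 := by linear_combination h
    exact (div_ne_zero hy0 (pow_ne_zero 2 hx0)) this
  · show (w + y / x ^ 2) / 2 + μ ^ 2 / ((w + y / x ^ 2) / 2) = w
    rw [hdiv]; ring
  · show x ^ 2 * ((w + y / x ^ 2) / 2 - μ ^ 2 / ((w + y / x ^ 2) / 2)) = y
    rw [hdiv]; field_simp; ring

theorem tau_mem_curve {N : ℕ} {μ : ℂ} (hμ : μ ≠ 0) {u : Fin N → ℂ} {p : ℂ × ℂ}
    (hp : p ∈ curve μ u) : tau μ p ∈ curve μ u := by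
  have h := ofXY_mem_curve hμ (fst_mem_regularSet hp)
    (y := -yCoord μ p) (by rw [neg_sq, yCoord_sq hp])
  convert h.1 using 1
  have h1 := hp.1
  refine Prod.ext rfl ?_
  simp only [ofXY, yCoord, tau]
  rw [← hp.2.2.2]
  field_simp
  ring

theorem exists_mem_curve {N : ℕ} {μ : ℂ} (hμ : μ ≠ 0) {u : Fin N → ℂ} {x : ℂ}
    (hx : x ∈ regularSet μ u) : ∃ z, (x, z) ∈ curve μ u := by
  obtain ⟨y, hy⟩ := IsAlgClosed.exists_pow_nat_eq ((hyperellipticPoly μ u).eval x) two_pos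
  exact ⟨_, (ofXY_mem_curve hμ hx hy).1⟩

theorem fibre_eq {N : ℕ} {μ : ℂ} (hμ : μ ≠ 0) {u : Fin N → ℂ} {p : ℂ × ℂ}
    (hp : p ∈ curve μ u) : {z | (p.1, z) ∈ curve μ u} = {p.2, μ ^ 2 / p.2} := by
  ext z
  simp only [Set.mem_ofPred_eq, Set.mem_insert_iff, Set.mem_singleton_iff]
  constructor
  · intro hz
    have h1 := yCoord_sq hz
    rw [← yCoord_sq hp, sq_eq_sq_iff_eq_or_eq_neg] at h1
    rcases h1 with h1 | h1
    · left
      have h2 : (p.1, z) = p := calc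
        (p.1, z) = ofXY u p.1 (yCoord μ (p.1, z)) := (ofXY_yCoord hz).symm
        _ = p := by rw [h1, ofXY_yCoord hp]
      exact congrArg Prod.snd h2
    · right
      rw [← yCoord_tau hμ hp.2.1] at h1
      have h2 : (p.1, z) = tau μ p := calc
        (p.1, z) = ofXY u p.1 (yCoord μ (p.1, z)) := (ofXY_yCoord hz).symm
        _ = ofXY u (tau μ p).1 (yCoord μ (tau μ p)) := by rw [h1]; rfl
        _ = tau μ p := ofXY_yCoord (tau_mem_curve hμ hp)
      exact congrArg Prod.snd h2
  · rintro (rfl | rfl)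
    · exact hp
    · exact tau_mem_curve hμ hp

/-- The sum of a function over the points of the curve above `x`. -/
def sheetSum {N : ℕ} {E : Type*} [AddCommMonoid E] (μ : ℂ) (u : Fin N → ℂ) (F : ℂ × ℂ → E)
    (x : ℂ) : E :=
  ∑ᶠ z ∈ {z : ℂ | (x, z) ∈ curve μ u}, F (x, z)

theorem sheetSum_eq {N : ℕ} {E : Type*} [AddCommMonoid E] {μ : ℂ} (hμ : μ ≠ 0) {u : Fin N → ℂ}
    (F : ℂ × ℂ → E) {p : ℂ × ℂ} (hp : p ∈ curve μ u) :
    sheetSum μ u F p.1 = F p + F (tau μ p) := by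
  rw [sheetSum, fibre_eq hμ hp, finsum_mem_pair]
  · rfl
  · intro h
    exact sub_div_ne_zero hp (sub_eq_zero.2 h)

theorem sheetSum_of_notMem {N : ℕ} {E : Type*} [AddCommMonoid E] {μ : ℂ} {u : Fin N → ℂ}
    (F : ℂ × ℂ → E) {x : ℂ} (hx : x ∉ regularSet μ u) : sheetSum μ u F x = 0 := by
  have : {z : ℂ | (x, z) ∈ curve μ u} = ∅ :=
    Set.eq_empty_iff_forall_notMem.2 fun z hz => hx (fst_mem_regularSet hz)
  rw [sheetSum, this, finsum_mem_empty]

/-- Local sections exist through every point, and a point of the curve near `p` lies on the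
section. -/
theorem exists_section {N : ℕ} {μ : ℂ} (hμ : μ ≠ 0) {u : Fin N → ℂ} {p : ℂ × ℂ}
    (hp : p ∈ curve μ u) : ∃ r > 0, ∃ ζ, IsSection μ u (Metric.ball p.1 r) ζ ∧ ζ p.1 = p.2 ∧
      ∀ᶠ q in 𝓝 p, q ∈ curve μ u → q.2 = ζ q.1 := by
  set h := hyperellipticPoly μ u with hh
  have hp1 := fst_mem_regularSet hp
  set y₀ := yCoord μ p with hy₀
  have hy₀0 : y₀ ≠ 0 := yCoord_ne_zero hp
  have hy₀2 : y₀ ^ 2 = h.eval p.1 := yCoord_sq hp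
  -- the branch of the square root of `h` with the value `y₀` at the centre
  set g : ℂ → ℂ := fun x => y₀ * Complex.exp (Complex.log (h.eval x / h.eval p.1) / 2) with hg
  have hcont : ContinuousAt (fun x => h.eval x / h.eval p.1) p.1 :=
    h.continuous.continuousAt.div_const _
  have hslit : ∀ᶠ x in 𝓝 p.1, h.eval x / h.eval p.1 ∈ Complex.slitPlane := by
    refine hcont.eventually_mem (Complex.isOpen_slitPlane.mem_nhds ?_)
    rw [div_self hp1.2]
    exact Complex.one_mem_slitPlane
  obtain ⟨r, hr, hball⟩ := Metric.eventually_nhds_iff_ball.1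
    (hslit.and ((isOpen_regularSet μ u).mem_nhds hp1))
  have hg2 : ∀ x ∈ Metric.ball p.1 r, g x ^ 2 = h.eval x := by
    intro x hx
    have h0 : h.eval x / h.eval p.1 ≠ 0 := div_ne_zero (hball x hx).2.2 hp1.2
    simp only [hg]
    rw [mul_pow, hy₀2, ← Complex.exp_nat_mul]
    have : ((2 : ℕ) : ℂ) * (Complex.log (h.eval x / h.eval p.1) / 2) =
      Complex.log (h.eval x / h.eval p.1) := by push_cast; ring
    rw [this, Complex.exp_log h0, mul_div_cancel₀ _ hp1.2]
  have hgp : g p.1 = y₀ := by simp [hg]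
  have hgd : DifferentiableOn ℂ g (Metric.ball p.1 r) := by
    intro x hx
    have h1 : DifferentiableAt ℂ (fun x => h.eval x / h.eval p.1) x :=
      h.differentiableAt.div_const _
    exact ((((h1.clog (hball x hx).1).div_const 2).cexp).const_mul y₀).differentiableWithinAt
  have hWd : ∀ x, x ≠ 0 → DifferentiableAt ℂ (W u) x := by
    intro x hx
    have h1 : DifferentiableAt ℂ (fun x : ℂ => (x ^ 2)⁻¹) x :=
      ((differentiableAt_id.pow 2).inv (pow_ne_zero 2 hx))
    have h2 : DifferentiableAt ℂ (fun x : ℂ => (Q u).eval (x ^ 2)) x := by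
      have := ((Q u).comp (X ^ 2)).differentiableAt (x := x)
      simpa [eval_comp] using this
    exact h1.mul h2
  refine ⟨r, hr, fun x => (ofXY u x (g x)).2, ⟨Metric.isOpen_ball, ?_, ?_⟩, ?_, ?_⟩
  · intro x hx
    have hx0 := (hball x hx).2.1
    have h1 := (hWd x hx0).differentiableWithinAt (s := Metric.ball p.1 r)
    have h2 : DifferentiableWithinAt ℂ (fun x : ℂ => x ^ 2) (Metric.ball p.1 r) x :=
      (differentiableAt_id.pow 2).differentiableWithinAt
    exact (h1.add ((hgd x hx).div h2 (pow_ne_zero 2 hx0))).div_const 2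
  · exact fun x hx => (ofXY_mem_curve hμ (hball x hx).2 (hg2 x hx)).1
  · show (ofXY u p.1 (g p.1)).2 = p.2
    rw [hgp, hy₀, ofXY_yCoord hp]
  · have hyc : ContinuousAt (yCoord μ) p := by
      have h1 : ContinuousAt (fun q : ℂ × ℂ => μ ^ 2 / q.2) p :=
        continuousAt_const.div continuousAt_snd hp.2.1
      exact (continuousAt_fst.pow 2).mul (continuousAt_snd.sub h1)
    have hgc : ContinuousAt (fun q : ℂ × ℂ => g q.1) p :=
      ContinuousAt.comp (f := Prod.fst) (x := p)
        (hgd.differentiableAt (Metric.ball_mem_nhds _ hr)).continuousAt continuousAt_fst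
    have hne : ∀ᶠ q in 𝓝 p, yCoord μ q + g q.1 ≠ 0 := by
      refine (hyc.add hgc).eventually_ne ?_
      show yCoord μ p + g p.1 ≠ 0
      rw [hgp, ← two_mul]
      exact mul_ne_zero two_ne_zero hy₀0
    filter_upwards [hne, (continuousAt_fst (p := p)).eventually_mem (Metric.ball_mem_nhds _ hr)]
      with q hq hqb hqc
    have h1 := yCoord_sq hqc
    rw [← hh, ← hg2 q.1 hqb, sq_eq_sq_iff_eq_or_eq_neg] at h1
    rcases h1 with h1 | h1
    · show q.2 = (ofXY u q.1 (g q.1)).2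
      rw [← h1, ofXY_yCoord hqc]
    · exact absurd (by rw [h1]; ring) hq

theorem IsSection.mono {N : ℕ} {μ : ℂ} {u : Fin N → ℂ} {s t : Set ℂ} {ζ : ℂ → ℂ}
    (h : IsSection μ u s ζ) (ht : IsOpen t) (hts : t ⊆ s) : IsSection μ u t ζ :=
  ⟨ht, h.2.1.mono hts, fun x hx => h.2.2 x (hts hx)⟩

theorem IsSection.tau {N : ℕ} {μ : ℂ} (hμ : μ ≠ 0) {u : Fin N → ℂ} {s : Set ℂ} {ζ : ℂ → ℂ}
    (h : IsSection μ u s ζ) : IsSection μ u s (fun x => μ ^ 2 / ζ x) :=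
  ⟨h.1, fun x hx => (differentiableWithinAt_const _).div (h.2.1 x hx) (h.2.2 x hx).2.1,
    fun x hx => tau_mem_curve hμ (h.2.2 x hx)⟩

theorem IsSection.sheetSum_eq {N : ℕ} {E : Type*} [AddCommMonoid E] {μ : ℂ} (hμ : μ ≠ 0)
    {u : Fin N → ℂ} {s : Set ℂ} {ζ : ℂ → ℂ} (h : IsSection μ u s ζ) (F : ℂ × ℂ → E) {x : ℂ}
    (hx : x ∈ s) : sheetSum μ u F x = F (x, ζ x) + F (x, μ ^ 2 / ζ x) :=
  SOWhitham.sheetSum_eq hμ F (h.2.2 x hx)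

theorem exists_section_of_mem_regularSet {N : ℕ} {μ : ℂ} (hμ : μ ≠ 0) {u : Fin N → ℂ} {x : ℂ}
    (hx : x ∈ regularSet μ u) : ∃ r > 0, ∃ ζ, IsSection μ u (Metric.ball x r) ζ := by
  obtain ⟨z, hz⟩ := exists_mem_curve hμ hx
  obtain ⟨r, hr, ζ, hζ, -, -⟩ := exists_section hμ hz
  exact ⟨r, hr, ζ, hζ⟩

theorem IsSection.differentiableOn_yCoord {N : ℕ} {μ : ℂ} {u : Fin N → ℂ} {s : Set ℂ}
    {ζ : ℂ → ℂ} (h : IsSection μ u s ζ) :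
    DifferentiableOn ℂ (fun x => yCoord μ (x, ζ x)) s := fun x hx =>
  ((differentiableAt_id.pow 2).differentiableWithinAt).mul
    ((h.2.1 x hx).sub ((differentiableWithinAt_const _).div (h.2.1 x hx) (h.2.2 x hx).2.1))

/-! ### Holomorphic differentials -/

/-- An entire function of polynomial growth is a polynomial. -/
theorem exists_polynomial_of_growth {f : ℂ → ℂ} (hf : Differentiable ℂ f) {K : ℝ} {k : ℕ}
    (hb : ∀ x, ‖f x‖ ≤ K * (1 + ‖x‖) ^ k) : ∃ P : ℂ[X], P.natDegree ≤ k ∧ ∀ x, f x = P.eval x := by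
  have hzero : ∀ n, k < n → iteratedDeriv n f 0 = 0 := by
    intro n hn
    have hK : 0 ≤ K := by simpa using (norm_nonneg (f 0)).trans (hb 0)
    have h1 : ∀ r : ℝ, 1 ≤ r → ‖iteratedDeriv n f 0‖ ≤ n.factorial * (K * 2 ^ k) * r⁻¹ := by
      intro r hr
      have hr0 : 0 < r := by linarith
      have h2 := Complex.norm_iteratedDeriv_le_of_forall_mem_sphere_norm_le n hr0
        (hf.diffContOnCl (s := Metric.ball 0 r)) (C := K * (2 * r) ^ k) (fun z hz => by
          refine (hb z).trans ?_
          have : ‖z‖ = r := by simpa using hz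
          rw [this]
          gcongr
          linarith)
      refine h2.trans ?_
      have h3 : r ^ (k + 1) ≤ r ^ n := pow_le_pow_right₀ hr hn
      rw [div_le_iff₀ (pow_pos hr0 n)]
      calc (n.factorial : ℝ) * (K * (2 * r) ^ k)
          = n.factorial * (K * 2 ^ k) * r⁻¹ * r ^ (k + 1) := by
            rw [mul_pow, pow_succ]; field_simp
        _ ≤ _ := by gcongr
    have h2 : Filter.Tendsto (fun r : ℝ => n.factorial * (K * 2 ^ k) * r⁻¹) Filter.atTop (𝓝 0) := by
      simpa using tendsto_inv_atTop_zero.const_mul ((n.factorial : ℝ) * (K * 2 ^ k))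
    have h3 : ‖iteratedDeriv n f 0‖ ≤ 0 :=
      ge_of_tendsto h2 ((Filter.eventually_ge_atTop 1).mono h1)
    exact norm_le_zero_iff.1 h3
  refine ⟨∑ n ∈ Finset.range (k + 1), C ((n.factorial : ℂ)⁻¹ * iteratedDeriv n f 0) * X ^ n,
    natDegree_sum_le_of_forall_le _ _ fun n hn => (natDegree_C_mul_X_pow_le _ _).trans
      (by have := Finset.mem_range.1 hn; omega), fun x => ?_⟩
  have h1 := Complex.taylorSeries_eq_of_entire' 0 x hf
  rw [← h1, tsum_eq_sum (s := Finset.range (k + 1))]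
  · simp [eval_finsetSum]
  · intro n hn
    rw [hzero n (by simpa using hn)]
    simp

/-- Riemann's extension theorem and Liouville's theorem for a function with finitely many
singularities. -/
theorem exists_polynomial_of_growth_of_finite {f : ℂ → ℂ} {E : Set ℂ} (hE : E.Finite)
    (hf : DifferentiableOn ℂ f Eᶜ) {K : ℝ} {k : ℕ} (hb : ∀ x ∈ Eᶜ, ‖f x‖ ≤ K * (1 + ‖x‖) ^ k) :
    ∃ P : ℂ[X], P.natDegree ≤ k ∧ ∀ x ∈ Eᶜ, f x = P.eval x := by
  have hopen : IsOpen Eᶜ := hE.isClosed.isOpen_compl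
  have hpunct : ∀ c, ∀ᶠ x in 𝓝 c, x ≠ c → x ∈ Eᶜ := by
    intro c
    have h1 : (E \ {c})ᶜ ∈ 𝓝 c :=
      (hE.subset Set.sdiff_subset).isClosed.isOpen_compl.mem_nhds (by simp)
    filter_upwards [h1] with x hx hxc hxE
    exact hx ⟨hxE, hxc⟩
  set g : ℂ → ℂ := fun x => Filter.limUnder (𝓝[≠] x) f with hg
  have hgf : ∀ x ∈ Eᶜ, g x = f x := fun x hx =>
    ((hf.differentiableAt (hopen.mem_nhds hx)).continuousAt.tendsto.mono_left
      nhdsWithin_le_nhds).limUnder_eq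
  have hgd : Differentiable ℂ g := by
    intro c
    obtain ⟨r, hr, hball⟩ := Metric.eventually_nhds_iff_ball.1 (hpunct c)
    have h1 : DifferentiableOn ℂ (Function.update f c (Filter.limUnder (𝓝[≠] c) f))
        (Metric.ball c r) := by
      refine Complex.differentiableOn_update_limUnder_of_bddAbove (Metric.ball_mem_nhds c hr)
        (hf.mono fun x hx => hball x hx.1 hx.2) ⟨|K| * (1 + (‖c‖ + r)) ^ k, ?_⟩
      rintro _ ⟨x, hx, rfl⟩
      refine (hb x (hball x hx.1 hx.2)).trans ?_
      have h2 : ‖x‖ ≤ ‖c‖ + r := by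
        have h3 : ‖x - c‖ < r := by simpa [dist_eq_norm] using hx.1
        have h4 := norm_add_le c (x - c)
        rw [add_sub_cancel] at h4
        linarith
      have h5 : K ≤ |K| := le_abs_self K
      gcongr
    refine (h1.differentiableAt (Metric.ball_mem_nhds c hr)).congr_of_eventuallyEq ?_
    filter_upwards [Metric.ball_mem_nhds c hr] with x hx
    by_cases hxc : x = c
    · subst hxc; simp [hg]
    · rw [Function.update_of_ne hxc]
      exact hgf x (hball x hx hxc)
  have hdense : Dense Eᶜ := by
    have : E.Countable := hE.countable
    exact this.dense_compl ℝ
  have hgb : ∀ x, ‖g x‖ ≤ K * (1 + ‖x‖) ^ k := by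
    have hcl : IsClosed {x | ‖g x‖ ≤ K * (1 + ‖x‖) ^ k} :=
      isClosed_le hgd.continuous.norm (by fun_prop)
    intro x
    have := hdense.closure_eq ▸ Set.mem_univ x
    exact closure_minimal (fun y hy => by
      show ‖g y‖ ≤ _
      rw [hgf y hy]; exact hb y hy) hcl this
  obtain ⟨P, hP, hgP⟩ := exists_polynomial_of_growth hgd hgb
  exact ⟨P, hP, fun x hx => by rw [← hgf x hx, hgP]⟩

theorem exists_norm_eval_le (p : ℂ[X]) :
    ∃ K : ℝ, 0 ≤ K ∧ ∀ x : ℂ, ‖p.eval x‖ ≤ K * (1 + ‖x‖) ^ p.natDegree := by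
  refine ⟨∑ i ∈ Finset.range (p.natDegree + 1), ‖p.coeff i‖, by positivity, fun x => ?_⟩
  rw [eval_eq_sum_range, Finset.sum_mul]
  refine (norm_sum_le _ _).trans (Finset.sum_le_sum fun i hi => ?_)
  rw [norm_mul, norm_pow]
  gcongr ‖_‖ * ?_
  have h1 : (0 : ℝ) ≤ ‖x‖ := norm_nonneg x
  have h2 : i ≤ p.natDegree := by have := Finset.mem_range.1 hi; omega
  calc ‖x‖ ^ i ≤ (1 + ‖x‖) ^ i := by gcongr; linarith
    _ ≤ _ := pow_le_pow_right₀ (by linarith) h2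

theorem differentiableOn_sheetSum {N : ℕ} {μ : ℂ} (hμ : μ ≠ 0) {u : Fin N → ℂ}
    {F : ℂ × ℂ → ℂ}
    (hF : ∀ s ζ, IsSection μ u s ζ → DifferentiableOn ℂ (fun x => F (x, ζ x)) s) :
    DifferentiableOn ℂ (sheetSum μ u F) (regularSet μ u) := by
  intro x hx
  obtain ⟨r, hr, ζ, hζ⟩ := exists_section_of_mem_regularSet hμ hx
  have h1 : DifferentiableOn ℂ (sheetSum μ u F) (Metric.ball x r) :=
    ((hF _ _ hζ).add (hF _ _ (hζ.tau hμ))).congr fun y hy => hζ.sheetSum_eq hμ F hy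
  exact (h1.differentiableAt (Metric.ball_mem_nhds x hr)).differentiableWithinAt

/-- A holomorphic differential is `P(x) dx / y` with a polynomial `P`. The sum of `y φ` over the
two sheets is a polynomial by its growth; the sum of `y² φ` is a polynomial that vanishes at all
roots of `y²` and has too small a degree, so that `φ` is odd under the exchange of the sheets. -/
theorem IsHolomorphic.exists_polynomial {N : ℕ} (hN : 2 ≤ N) {μ : ℂ} {u : Fin N → ℂ}
    (hu : IsSmoothCurve μ u) {φ : Differential} (hφ : IsHolomorphic μ u φ) :
    ∃ P : ℂ[X], P.natDegree ≤ 2 * N - 2 ∧ ∀ p ∈ curve μ u, φ p * yCoord μ p = P.eval p.1 := by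
  have hμ := hu.ne_zero hN
  obtain ⟨hhol, K, hK⟩ := hφ
  set h := hyperellipticPoly μ u with hh
  have hreg : (regularSet μ u)ᶜᶜ = regularSet μ u := compl_compl _
  obtain ⟨Ch, hCh0, hCh⟩ := exists_norm_eval_le h
  rw [hh, natDegree_hyperellipticPoly hN, ← hh] at hCh
  have hy : ∀ p ∈ curve μ u, ‖yCoord μ p‖ ≤ (1 + Ch) * (1 + ‖p.1‖) ^ (2 * N) := by
    intro p hp
    have h1 : ‖yCoord μ p‖ ^ 2 ≤ Ch * (1 + ‖p.1‖) ^ (4 * N) := by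
      rw [← norm_pow, yCoord_sq hp]; exact hCh _
    refine le_of_sq_le_sq ?_ (by positivity)
    refine h1.trans ?_
    rw [mul_pow, ← pow_mul, show 2 * N * 2 = 4 * N by ring]
    gcongr
    nlinarith
  have hK0 : ∀ x ∈ regularSet μ u, 0 ≤ K * (1 + ‖x‖) ^ (2 * N - 2) := by
    intro x hx
    obtain ⟨z, hz⟩ := exists_mem_curve hμ hx
    exact le_trans (by positivity) (hK _ hz)
  -- the sum of `y φ` over the two sheets
  obtain ⟨F, hFdeg, hF⟩ := exists_polynomial_of_growth_of_finite hu.finite_compl_regularSet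
    (f := sheetSum μ u fun p => φ p * yCoord μ p) (K := 2 * K) (k := 2 * N - 2)
    (by rw [hreg]
        exact differentiableOn_sheetSum hμ fun s ζ hs =>
          (hhol s ζ hs).mul hs.differentiableOn_yCoord)
    (by rw [hreg]
        intro x hx
        obtain ⟨z, hz⟩ := exists_mem_curve hμ hx
        rw [sheetSum_eq hμ _ hz]
        refine (norm_add_le _ _).trans ?_
        rw [norm_mul, norm_mul]
        have h1 := hK _ hz
        have h2 := hK _ (tau_mem_curve hμ hz)
        simp only [tau] at h1 h2 ⊢
        linarith)
  -- the sum of `y² φ` over the two sheets, with one factor `y` left in its bound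
  have hGb : ∀ x ∈ regularSet μ u, ∃ z, (x, z) ∈ curve μ u ∧
      ‖sheetSum μ u (fun p => φ p * yCoord μ p ^ 2) x‖ ≤
        2 * (K * (1 + ‖x‖) ^ (2 * N - 2)) * ‖yCoord μ (x, z)‖ := by
    intro x hx
    obtain ⟨z, hz⟩ := exists_mem_curve hμ hx
    refine ⟨z, hz, ?_⟩
    rw [sheetSum_eq hμ _ hz]
    refine (norm_add_le _ _).trans ?_
    have hty : ‖yCoord μ (tau μ (x, z))‖ = ‖yCoord μ (x, z)‖ := by
      rw [yCoord_tau hμ hz.2.1, norm_neg]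
    rw [norm_mul, norm_mul, norm_pow, norm_pow, sq, sq, ← mul_assoc, ← mul_assoc]
    have h1 := hK _ hz
    have h2 := hK _ (tau_mem_curve hμ hz)
    have h3 : ‖φ (x, z)‖ * ‖yCoord μ (x, z)‖ * ‖yCoord μ (x, z)‖ ≤
      K * (1 + ‖x‖) ^ (2 * N - 2) * ‖yCoord μ (x, z)‖ :=
      mul_le_mul_of_nonneg_right h1 (norm_nonneg _)
    have h4 : ‖φ (tau μ (x, z))‖ * ‖yCoord μ (tau μ (x, z))‖ * ‖yCoord μ (tau μ (x, z))‖ ≤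
      K * (1 + ‖x‖) ^ (2 * N - 2) * ‖yCoord μ (x, z)‖ := by
      rw [hty] at h2 ⊢
      exact mul_le_mul_of_nonneg_right h2 (norm_nonneg _)
    linarith
  obtain ⟨G, hGdeg, hG⟩ := exists_polynomial_of_growth_of_finite hu.finite_compl_regularSet
    (f := sheetSum μ u fun p => φ p * yCoord μ p ^ 2) (K := 2 * K * (1 + Ch)) (k := 4 * N - 2)
    (by rw [hreg]
        exact differentiableOn_sheetSum hμ fun s ζ hs =>
          (hhol s ζ hs).mul (hs.differentiableOn_yCoord.pow 2))
    (by rw [hreg]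
        intro x hx
        obtain ⟨z, hz, hzb⟩ := hGb x hx
        refine hzb.trans ?_
        have h1 := hK0 x hx
        calc 2 * (K * (1 + ‖x‖) ^ (2 * N - 2)) * ‖yCoord μ (x, z)‖
            ≤ 2 * (K * (1 + ‖x‖) ^ (2 * N - 2)) * ((1 + Ch) * (1 + ‖x‖) ^ (2 * N)) := by
              gcongr; exact hy _ hz
          _ = 2 * K * (1 + Ch) * (1 + ‖x‖) ^ (2 * N - 2 + 2 * N) := by rw [pow_add]; ring
          _ = _ := by rw [show 2 * N - 2 + 2 * N = 4 * N - 2 by omega])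
  have hdense : Dense (regularSet μ u) := by
    have := hu.finite_compl_regularSet.countable.dense_compl ℝ
    rwa [hreg] at this
  -- by density the bound for the sum of `y² φ` also holds at the roots of `y²`
  have hGsq : ∀ x, ‖G.eval x‖ ^ 2 ≤ (2 * (K * (1 + ‖x‖) ^ (2 * N - 2))) ^ 2 * ‖h.eval x‖ := by
    have hcl : IsClosed {x | ‖G.eval x‖ ^ 2 ≤
        (2 * (K * (1 + ‖x‖) ^ (2 * N - 2))) ^ 2 * ‖h.eval x‖} :=
      isClosed_le (G.continuous.norm.pow 2) (by
        have := h.continuous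
        fun_prop)
    intro x
    refine closure_minimal (fun x hx => ?_) hcl (hdense x)
    obtain ⟨z, hz, hzb⟩ := hGb x hx
    rw [hG x (by rwa [hreg])] at hzb
    show ‖G.eval x‖ ^ 2 ≤ _
    rw [show h.eval x = yCoord μ (x, z) ^ 2 from (yCoord_sq hz).symm, norm_pow, ← mul_pow]
    gcongr
  -- a polynomial of degree at most `4N - 2` with `4N` distinct roots
  have hG0 : G = 0 := by
    classical
    have hcard : h.roots.toFinset.card = 4 * N := by
      rw [Multiset.toFinset_card_of_nodup (nodup_roots hu),
        ← (IsAlgClosed.splits h).natDegree_eq_card_roots, natDegree_hyperellipticPoly hN]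
    refine eq_zero_of_natDegree_lt_card_of_eval_eq_zero' G h.roots.toFinset (fun x hx => ?_)
      (by omega)
    have hx0 : h.eval x = 0 := by
      rw [Multiset.mem_toFinset] at hx
      exact isRoot_of_mem_roots hx
    have h1 := hGsq x
    rw [hx0, norm_zero, mul_zero] at h1
    have h2 : ‖G.eval x‖ ^ 2 = 0 := le_antisymm h1 (by positivity)
    exact norm_eq_zero.1 (pow_eq_zero_iff two_ne_zero |>.1 h2)
  have hodd : ∀ p ∈ curve μ u, φ (tau μ p) = -φ p := by
    intro p hp
    have h1 := hG p.1 (by rw [hreg]; exact fst_mem_regularSet hp)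
    rw [hG0, eval_zero, sheetSum_eq hμ _ hp, yCoord_tau hμ hp.2.1, neg_sq, ← add_mul] at h1
    rcases mul_eq_zero.1 h1 with h2 | h2
    · linear_combination h2
    · exact absurd h2 (pow_ne_zero 2 (yCoord_ne_zero hp))
  refine ⟨C (1 / 2) * F, (natDegree_C_mul_le _ _).trans hFdeg, fun p hp => ?_⟩
  have h1 := hF p.1 (by rw [hreg]; exact fst_mem_regularSet hp)
  rw [sheetSum_eq hμ _ hp, yCoord_tau hμ hp.2.1, hodd p hp] at h1
  rw [eval_mul, eval_C, ← h1]
  ring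

theorem sigma2_mem_curve {N : ℕ} {μ : ℂ} {u : Fin N → ℂ} {p : ℂ × ℂ} (hp : p ∈ curve μ u) :
    sigma2 p ∈ curve μ u := by
  obtain ⟨h1, h2, h3, h4⟩ := hp
  exact ⟨neg_ne_zero.2 h1, h2, h3, by simpa [W, sigma2] using h4⟩

theorem yCoord_sigma2 (μ : ℂ) (p : ℂ × ℂ) : yCoord μ (sigma2 p) = yCoord μ p := by
  simp [yCoord, sigma2]

/-- The odd holomorphic differential `(∑ c_i x^{2i}) dx / y`. -/
def oddDiff {N : ℕ} (μ : ℂ) (c : Fin N → ℂ) : Differential := fun p =>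
  (∑ i : Fin N, c i * p.1 ^ (2 * (i : ℕ))) / yCoord μ p

theorem isHolomorphic_oddDiff {N : ℕ} (μ : ℂ) (u c : Fin N → ℂ) :
    IsHolomorphic μ u (oddDiff μ c) := by
  constructor
  · intro s ζ hs
    refine DifferentiableOn.div (by fun_prop) hs.differentiableOn_yCoord fun x hx =>
      yCoord_ne_zero (hs.2.2 x hx)
  · refine ⟨∑ i, ‖c i‖, fun p hp => ?_⟩
    rw [oddDiff, norm_div, div_mul_cancel₀ _ (norm_ne_zero_iff.2 (yCoord_ne_zero hp)),
      Finset.sum_mul]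
    refine (norm_sum_le _ _).trans (Finset.sum_le_sum fun i _ => ?_)
    rw [norm_mul, norm_pow]
    have h1 : (0 : ℝ) ≤ ‖p.1‖ := norm_nonneg _
    gcongr ‖_‖ * ?_
    calc ‖p.1‖ ^ (2 * (i : ℕ)) ≤ (1 + ‖p.1‖) ^ (2 * (i : ℕ)) := by gcongr; linarith
      _ ≤ _ := pow_le_pow_right₀ (by linarith) (by omega)

theorem oddDiff_sigma2 {N : ℕ} (μ : ℂ) (c : Fin N → ℂ) (p : ℂ × ℂ) :
    oddDiff μ c (sigma2 p) = oddDiff μ c p := by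
  rw [oddDiff, oddDiff, yCoord_sigma2]
  simp only [sigma2, pow_mul, neg_sq]

theorem isOdd_oddDiff {N : ℕ} (μ : ℂ) (u c : Fin N → ℂ) : IsOdd μ u (oddDiff μ c) := by
  intro p _
  rw [pullbackSigma2, oddDiff_sigma2]

/-- The odd holomorphic differentials are the `(∑ c_i x^{2i}) dx / y`: since `y` is invariant under
`σ₂` while `dx` changes its sign, only even powers of `x` occur. -/
theorem IsHolomorphic.exists_eq_oddDiff {N : ℕ} (hN : 2 ≤ N) {μ : ℂ} {u : Fin N → ℂ}
    (hu : IsSmoothCurve μ u) {φ : Differential} (hφ : IsHolomorphic μ u φ)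
    (hodd : IsOdd μ u φ) : ∃ c : Fin N → ℂ, ∀ p ∈ curve μ u, φ p = oddDiff μ c p := by
  obtain ⟨P, hP, hφP⟩ := hφ.exists_polynomial hN hu
  have hP' : ∀ x, P.eval x + P.eval (-x) =
      2 * ∑ i : Fin N, P.coeff (2 * (i : ℕ)) * x ^ (2 * (i : ℕ)) := by
    intro x
    rw [eval_eq_sum_range' (show P.natDegree < 2 * N by omega),
      eval_eq_sum_range' (show P.natDegree < 2 * N by omega), ← Finset.sum_add_distrib,
      sum_range_two_mul,
      Fin.sum_univ_eq_sum_range (fun i => P.coeff (2 * i) * x ^ (2 * i)), Finset.mul_sum]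
    refine Finset.sum_congr rfl fun i _ => ?_
    simp only [pow_succ, pow_mul]
    ring
  refine ⟨fun i => P.coeff (2 * (i : ℕ)), fun p hp => ?_⟩
  rw [oddDiff, eq_div_iff (yCoord_ne_zero hp)]
  have h3 := hφP p hp
  have h4 := hφP _ (sigma2_mem_curve hp)
  have h5 : φ (sigma2 p) = φ p := neg_injective (hodd p hp)
  rw [h5, yCoord_sigma2] at h4
  have h6 := hP' p.1
  rw [← h3, show (-p.1) = (sigma2 p).1 from rfl, ← h4] at h6
  linear_combination h6 / 2

/-- The derivatives of the differentials `dΩ̂_n` with respect to the moduli are odd holomorphic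
differentials. -/
theorem exists_dOmegaHatDot_eq_oddDiff {N : ℕ} (hN : 2 ≤ N) (μ : ℂ) (u v : Fin N → ℂ) (n : ℕ) :
    ∃ c : Fin N → ℂ, ∀ p ∈ curve μ u, dOmegaHatDot μ u v (n + 1) p = oddDiff μ c p := by
  obtain ⟨c, hc⟩ := exists_RDot_mul_deriv_W_sub hN u v n
  refine ⟨c, fun p hp => ?_⟩
  rw [oddDiff, ← hc p.1 hp.1, dOmegaHatDot, yCoord, mul_div_mul_left _ _ (pow_ne_zero 2 hp.1)]

/-! ### Integrability near the punctures -/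

open Filter in
theorem integrableAtFilter_norm_sub_rpow (e : ℂ) {s : ℝ} (hs2 : s < 2) :
    IntegrableAtFilter (fun x : ℂ => ‖x - e‖ ^ (-s)) (𝓝 e) volume := by
  refine ⟨Metric.ball e 1, Metric.ball_mem_nhds e one_pos, ?_⟩
  have h1 : IntegrableOn (fun x : ℂ => ‖x‖ ^ (-s)) (Metric.ball 0 1) volume := by
    rw [integrableOn_fun_norm_addHaar volume (f := fun r => r ^ (-s)), Complex.finrank_real_complex]
    have h2 : IntegrableOn (fun y : ℝ => y ^ (1 - s)) (Set.Ioo 0 1) :=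
      (intervalIntegral.integrableOn_Ioo_rpow_iff one_pos).2 (by linarith)
    refine h2.congr_fun (fun y hy => ?_) measurableSet_Ioo
    simp only [Nat.add_one_sub_one, pow_one, smul_eq_mul]
    rw [sub_eq_add_neg, Real.rpow_add hy.1, Real.rpow_one]
  rw [← integrable_indicator_iff measurableSet_ball] at h1 ⊢
  have h3 := h1.comp_sub_right e
  refine h3.congr (Eventually.of_forall fun x => ?_)
  simp [Set.indicator, dist_eq_norm]

/-- `|p|^{-s}` is locally integrable in the plane for `s < 2` if `p` has simple roots. -/
theorem locallyIntegrable_mul_norm_eval_rpow {p : ℂ[X]} (hp : p.Separable) {s : ℝ} (hs : 0 < s)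
    (hs2 : s < 2) {A : ℂ → ℝ} (hA : Continuous A) :
    LocallyIntegrable (fun x => A x * ‖p.eval x‖ ^ (-s)) := by
  intro e
  have hmeas : AEStronglyMeasurable (fun x => A x * ‖p.eval x‖ ^ (-s)) := by
    have h1 : Measurable fun x => ‖p.eval x‖ := p.continuous.norm.measurable
    exact (hA.measurable.mul (h1.pow_const _)).aestronglyMeasurable
  have hAO : A =O[𝓝 e] (fun _ => (1 : ℝ)) := hA.continuousAt.isBigO_one ℝ
  by_cases hpe : p.eval e = 0
  · have hd : (derivative p).eval e ≠ 0 := by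
      intro hd
      obtain ⟨a, b, hab⟩ := hp
      have := congrArg (eval e) hab
      simp [hpe, hd] at this
    have h1 : (fun x => x - e) =O[𝓝 e] fun x => p.eval x := by
      have h2 : (fun x => p.eval x) = fun x => p.eval x - p.eval e := by simp [hpe]
      have h3 := (p.hasDerivAt e).isTheta_sub hd
      obtain ⟨C, hC⟩ := h3.2.bound
      rw [h2]
      refine Asymptotics.IsBigO.of_bound C ?_
      have h4 : Filter.Tendsto (fun x => (x, e)) (𝓝 e) (𝓝 e ×ˢ pure e) :=
        Filter.Tendsto.prodMk Filter.tendsto_id (Filter.tendsto_pure.2 (by simp))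
      exact h4.eventually hC
    obtain ⟨C, hC0, hC⟩ := h1.exists_pos
    have h2 : (fun x => ‖p.eval x‖ ^ (-s)) =O[𝓝 e] fun x => ‖x - e‖ ^ (-s) := by
      refine Asymptotics.IsBigO.of_bound (C ^ s) ?_
      filter_upwards [hC.bound] with x hx
      rw [Real.norm_of_nonneg (by positivity), Real.norm_of_nonneg (by positivity)]
      rcases eq_or_ne x e with rfl | hxe
      · rw [hpe, norm_zero, Real.zero_rpow (by linarith)]
        positivity
      · have h5 : 0 < ‖x - e‖ := norm_pos_iff.2 (sub_ne_zero.2 hxe)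
        have h6 : 0 < ‖p.eval x‖ := by
          by_contra h
          have : ‖p.eval x‖ = 0 := le_antisymm (not_lt.1 h) (norm_nonneg _)
          rw [this, mul_zero] at hx
          linarith
        rw [Real.rpow_neg h6.le, Real.rpow_neg h5.le, inv_le_comm₀ (by positivity) (by positivity),
          mul_inv, inv_inv]
        have h7 := Real.rpow_le_rpow h5.le hx hs.le
        rw [Real.mul_rpow hC0.le h6.le] at h7
        rw [inv_mul_le_iff₀ (by positivity)]
        exact h7
    have h3 := hAO.mul h2
    simp only [one_mul] at h3
    exact h3.integrableAtFilter hmeas.stronglyMeasurableAtFilter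
      (integrableAtFilter_norm_sub_rpow e hs2)
  · have h1 : ContinuousAt (fun x => A x * ‖p.eval x‖ ^ (-s)) e :=
      hA.continuousAt.mul (p.continuous.norm.continuousAt.rpow_const
        (Or.inl (norm_ne_zero_iff.2 hpe)))
    exact (h1.isBigO_one ℝ).integrableAtFilter hmeas.stronglyMeasurableAtFilter
      (locallyIntegrable_const (1 : ℝ) e)

theorem exists_eventually_pow_le_norm_eval {p : ℂ[X]} (hp : p ≠ 0) :
    ∃ C > 0, ∀ᶠ x in Filter.cocompact ℂ, (1 + ‖x‖) ^ p.natDegree ≤ C * ‖p.eval x‖ := by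
  have h1 : (fun x : ℂ => p.leadingCoeff * x ^ p.natDegree) =O[Filter.cocompact ℂ] p.eval := by
    rw [← Metric.cobounded_eq_cocompact]
    exact isEquivalent_cobounded_leading_monomial.symm.isBigO
  obtain ⟨C, hC0, hC⟩ := h1.exists_pos
  have hlc : 0 < ‖p.leadingCoeff‖ := norm_pos_iff.2 (leadingCoeff_ne_zero.2 hp)
  refine ⟨2 ^ p.natDegree * (‖p.leadingCoeff‖⁻¹ * C), by positivity, ?_⟩
  have h2 : ∀ᶠ x in Filter.cocompact ℂ, 1 ≤ ‖x‖ :=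
    (tendsto_norm_cocompact_atTop).eventually_ge_atTop 1
  filter_upwards [hC.bound, h2] with x hx hx1
  rw [norm_mul, norm_pow] at hx
  calc (1 + ‖x‖) ^ p.natDegree ≤ (2 * ‖x‖) ^ p.natDegree := by gcongr; linarith
    _ = 2 ^ p.natDegree * (‖p.leadingCoeff‖⁻¹ * (‖p.leadingCoeff‖ * ‖x‖ ^ p.natDegree)) := by
      rw [mul_pow]; field_simp
    _ ≤ 2 ^ p.natDegree * (‖p.leadingCoeff‖⁻¹ * (C * ‖p.eval x‖)) := by gcongr
    _ = _ := by ring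

theorem integrable_of_decay {f : ℂ → ℝ} (hf : LocallyIntegrable f) {C : ℝ}
    (h : ∀ᶠ x in Filter.cocompact ℂ, ‖f x‖ ≤ C * (1 + ‖x‖) ^ (-3 : ℝ)) : Integrable f := by
  have h1 : Integrable (fun x : ℂ => (1 + ‖x‖) ^ (-3 : ℝ)) :=
    integrable_one_add_norm (by rw [Complex.finrank_real_complex]; norm_num)
  refine hf.integrable_of_isBigO_cocompact (g := fun x : ℂ => (1 + ‖x‖) ^ (-3 : ℝ))
    (Asymptotics.IsBigO.of_bound C ?_) (h1.integrableAtFilter _)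
  filter_upwards [h] with x hx
  rwa [Real.norm_of_nonneg (show 0 ≤ (1 + ‖x‖) ^ (-3 : ℝ) by positivity)]

/-- The bound `(1 + |x|)^{4N-4} / |y|²` for the wedge product of two closed forms is integrable. -/
theorem integrable_wedge_bound {N : ℕ} (hN : 2 ≤ N) {μ : ℂ} {u : Fin N → ℂ}
    (hu : IsSmoothCurve μ u) : Integrable (fun x : ℂ =>
      (1 + ‖x‖) ^ (4 * N - 4) * ‖(hyperellipticPoly μ u).eval x‖ ^ (-1 : ℝ)) := by
  obtain ⟨C, hC0, hC⟩ := exists_eventually_pow_le_norm_eval (monic_hyperellipticPoly hN μ u).ne_zero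
  rw [natDegree_hyperellipticPoly hN] at hC
  refine integrable_of_decay (locallyIntegrable_mul_norm_eval_rpow hu one_pos (by norm_num)
    (by fun_prop)) (C := C) ?_
  filter_upwards [hC] with x hx
  have h1 : (1 : ℝ) ≤ 1 + ‖x‖ := by linarith [norm_nonneg x]
  have h2 : 0 < ‖(hyperellipticPoly μ u).eval x‖ := by
    by_contra h
    have h3 : ‖(hyperellipticPoly μ u).eval x‖ = 0 := le_antisymm (not_lt.1 h) (norm_nonneg _)
    rw [h3, mul_zero] at hx
    exact absurd hx (not_le.2 (by positivity))
  rw [Real.norm_of_nonneg (by positivity), Real.rpow_neg h2.le, Real.rpow_one,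
    Real.rpow_neg (by positivity), show (3 : ℝ) = (3 : ℕ) by norm_num, Real.rpow_natCast,
    ← div_eq_mul_inv, ← div_eq_mul_inv, div_le_div_iff₀ h2 (by positivity), ← pow_add]
  exact (pow_le_pow_right₀ h1 (by omega)).trans hx

/-- The polynomial `x y²`, whose roots are the values of `x` at the finite missing points. -/
def puncturePoly {N : ℕ} (μ : ℂ) (u : Fin N → ℂ) : ℂ[X] := X * hyperellipticPoly μ u

theorem separable_puncturePoly {N : ℕ} {μ : ℂ} {u : Fin N → ℂ} (hu : IsSmoothCurve μ u) :
    (puncturePoly μ u).Separable := by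
  refine separable_X.mul hu ?_
  refine (irreducible_X.coprime_iff_not_dvd).2 fun h => hu.eval_zero_ne ?_
  rw [X_dvd_iff] at h
  rwa [← coeff_zero_eq_eval_zero]

theorem natDegree_puncturePoly {N : ℕ} (hN : 2 ≤ N) (μ : ℂ) (u : Fin N → ℂ) :
    (puncturePoly μ u).natDegree = 4 * N + 1 := by
  rw [puncturePoly, natDegree_X_mul (monic_hyperellipticPoly hN μ u).ne_zero,
    natDegree_hyperellipticPoly hN]

/-- The logarithmic derivative of `p = x y²` times the bound `(1 + |x|)^{2N-2} / |y|` for a closed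
form is integrable. The factor `1 / |y|` is rewritten as `|x|^{1/2} |p|^{-1/2}`, which leaves
`|p|^{-3/2}` with `p` of degree `4N + 1`. -/
theorem integrable_logDeriv_bound {N : ℕ} (hN : 2 ≤ N) {μ : ℂ} {u : Fin N → ℂ}
    (hu : IsSmoothCurve μ u) : Integrable (fun x : ℂ =>
      ‖(derivative (puncturePoly μ u)).eval x‖ * ‖x‖ ^ (1 / 2 : ℝ) * (1 + ‖x‖) ^ (2 * N - 2) *
        ‖(puncturePoly μ u).eval x‖ ^ (-(3 / 2) : ℝ)) := by
  have hp := separable_puncturePoly hu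
  obtain ⟨C, hC0, hC⟩ := exists_eventually_pow_le_norm_eval hp.ne_zero
  obtain ⟨K, hK0, hK⟩ := exists_norm_eval_le (derivative (puncturePoly μ u))
  have hdeg := natDegree_derivative_le (puncturePoly μ u)
  rw [natDegree_puncturePoly hN] at hC hdeg
  refine integrable_of_decay (locallyIntegrable_mul_norm_eval_rpow hp (by norm_num) (by norm_num)
    ?_) (C := K * C ^ (3 / 2 : ℝ)) ?_
  · have h1 := (derivative (puncturePoly μ u)).continuous
    have h2 : Continuous fun x : ℂ => ‖x‖ ^ (1 / 2 : ℝ) :=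
      continuous_norm.rpow_const fun x => Or.inr (by norm_num)
    fun_prop
  filter_upwards [hC] with x hx
  set a := 1 + ‖x‖ with ha
  have h1 : (1 : ℝ) ≤ a := by linarith [norm_nonneg x]
  have ha0 : 0 < a := by linarith
  set b := ‖(puncturePoly μ u).eval x‖ with hb
  have h2 : 0 < b := by
    by_contra h
    have h3 : b = 0 := le_antisymm (not_lt.1 h) (norm_nonneg _)
    rw [h3, mul_zero] at hx
    exact absurd hx (not_le.2 (by positivity))
  rw [Real.norm_of_nonneg (by positivity)]
  have hb' : b ^ (-(3 / 2) : ℝ) ≤ C ^ (3 / 2 : ℝ) * a ^ (-((4 * N + 1 : ℕ) : ℝ) * (3 / 2)) := by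
    have h3 : a ^ (4 * N + 1) * C⁻¹ ≤ b := by
      rw [mul_inv_le_iff₀ hC0, mul_comm b]; exact hx
    have h4 := Real.rpow_le_rpow_of_nonpos (by positivity) h3
      (show (-(3 / 2) : ℝ) ≤ 0 by norm_num)
    refine h4.trans (le_of_eq ?_)
    rw [Real.mul_rpow (by positivity) (by positivity), ← Real.rpow_natCast a, ← Real.rpow_mul ha0.le,
      Real.inv_rpow hC0.le, Real.rpow_neg hC0.le, inv_inv, mul_comm]
    congr 2
    ring
  have hd : ‖(derivative (puncturePoly μ u)).eval x‖ ≤ K * a ^ ((4 * N : ℕ) : ℝ) := by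
    refine (hK x).trans ?_
    rw [Real.rpow_natCast]
    gcongr
    omega
  have hx2 : ‖x‖ ^ (1 / 2 : ℝ) ≤ a ^ (1 / 2 : ℝ) :=
    Real.rpow_le_rpow (norm_nonneg _) (by linarith) (by norm_num)
  calc _ ≤ (K * a ^ ((4 * N : ℕ) : ℝ)) * a ^ (1 / 2 : ℝ) * a ^ ((2 * N - 2 : ℕ) : ℝ) *
        (C ^ (3 / 2 : ℝ) * a ^ (-((4 * N + 1 : ℕ) : ℝ) * (3 / 2))) := by
        rw [← Real.rpow_natCast a (2 * N - 2)]
        gcongr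
    _ = K * C ^ (3 / 2 : ℝ) * (a ^ ((4 * N : ℕ) : ℝ) * a ^ (1 / 2 : ℝ) *
        a ^ ((2 * N - 2 : ℕ) : ℝ) * a ^ (-((4 * N + 1 : ℕ) : ℝ) * (3 / 2))) := by ring
    _ = _ := by
      rw [← Real.rpow_add ha0, ← Real.rpow_add ha0, ← Real.rpow_add ha0]
      congr 2
      rw [Nat.cast_sub (by omega)]
      push_cast
      ring

/-! ### Stokes' theorem on the curve -/

/-- The coefficient of `dx₁ ∧ dx₂` in `α ∧ β`, for `x = x₁ + i x₂`. -/
def wedgeAt (α β : RealForm) (p : ℂ × ℂ) : ℂ :=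
  α p 1 * β p Complex.I - α p Complex.I * β p 1

theorem norm_wedgeAt_le (α β : RealForm) (p : ℂ × ℂ) :
    ‖wedgeAt α β p‖ ≤ 2 * (‖α p‖ * ‖β p‖) := by
  have h : ∀ (γ : RealForm) (v : ℂ), ‖v‖ = 1 → ‖γ p v‖ ≤ ‖γ p‖ := fun γ v hv => by
    simpa [hv] using (γ p).le_opNorm v
  refine (norm_sub_le _ _).trans ?_
  rw [norm_mul, norm_mul, two_mul]
  have h1 := h α 1 (by simp)
  have h2 := h α Complex.I (by simp)
  have h3 := h β 1 (by simp)
  have h4 := h β Complex.I (by simp)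
  gcongr

/-- The growth condition in the definition of closed forms. -/
def IsBoundedForm {N : ℕ} (μ : ℂ) (u : Fin N → ℂ) (α : RealForm) : Prop :=
  ∃ K : ℝ, ∀ p ∈ curve μ u, ‖α p‖ * ‖yCoord μ p‖ ≤ K * (1 + ‖p.1‖) ^ (2 * N - 2)

theorem norm_yCoord {N : ℕ} {μ : ℂ} {u : Fin N → ℂ} {p : ℂ × ℂ} (hp : p ∈ curve μ u) :
    ‖yCoord μ p‖ = ‖(hyperellipticPoly μ u).eval p.1‖ ^ (1 / 2 : ℝ) := by
  rw [← yCoord_sq hp, norm_pow, ← Real.sqrt_eq_rpow, Real.sqrt_sq (norm_nonneg _)]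

theorem norm_sheetSum_le {N : ℕ} {μ : ℂ} (hμ : μ ≠ 0) {u : Fin N → ℂ} {F : ℂ × ℂ → ℂ} {x : ℂ}
    {b : ℝ} (hb : 0 ≤ b) (hF : ∀ z, (x, z) ∈ curve μ u → ‖F (x, z)‖ ≤ b) :
    ‖sheetSum μ u F x‖ ≤ 2 * b := by
  by_cases hx : x ∈ regularSet μ u
  · obtain ⟨z, hz⟩ := exists_mem_curve hμ hx
    rw [sheetSum_eq hμ F hz]
    have h1 := hF _ hz
    have h2 := hF _ (tau_mem_curve hμ hz)
    have h3 := norm_add_le (F (x, z)) (F (tau μ (x, z)))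
    have h4 : tau μ (x, z) = (x, μ ^ 2 / z) := rfl
    rw [h4] at h3 ⊢
    linarith
  · rw [sheetSum_of_notMem F hx, norm_zero]
    positivity

theorem IsSmoothCurve.ae_mem_regularSet {N : ℕ} {μ : ℂ} {u : Fin N → ℂ} (hu : IsSmoothCurve μ u) :
    ∀ᵐ x : ℂ, x ∈ regularSet μ u :=
  mem_ae_iff.2 (hu.finite_compl_regularSet.measure_zero volume)

theorem IsSmoothCurve.aestronglyMeasurable {N : ℕ} {μ : ℂ} {u : Fin N → ℂ}
    (hu : IsSmoothCurve μ u) {f : ℂ → ℂ} (hf : ContinuousOn f (regularSet μ u)) :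
    AEStronglyMeasurable f volume := by
  have h := hf.aestronglyMeasurable (μ := volume) (isOpen_regularSet μ u).measurableSet
  rwa [Measure.restrict_eq_self_of_ae_mem hu.ae_mem_regularSet] at h

theorem continuousOn_sheetSum {N : ℕ} {μ : ℂ} (hμ : μ ≠ 0) {u : Fin N → ℂ} {F : ℂ × ℂ → ℂ}
    (hF : ∀ s ζ, IsSection μ u s ζ → ContinuousOn (fun x => F (x, ζ x)) s) :
    ContinuousOn (sheetSum μ u F) (regularSet μ u) := by
  intro x hx
  obtain ⟨r, hr, ζ, hζ⟩ := exists_section_of_mem_regularSet hμ hx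
  have h1 : ContinuousOn (sheetSum μ u F) (Metric.ball x r) :=
    ((hF _ _ hζ).add (hF _ _ (hζ.tau hμ))).congr fun y hy => hζ.sheetSum_eq hμ F hy
  exact (h1.continuousAt (Metric.ball_mem_nhds x hr)).continuousWithinAt

theorem contDiffOn_sheetSum {N : ℕ} {μ : ℂ} (hμ : μ ≠ 0) {u : Fin N → ℂ} {F : ℂ × ℂ → ℂ}
    (hF : ∀ s ζ, IsSection μ u s ζ → ContDiffOn ℝ 1 (fun x => F (x, ζ x)) s) :
    ContDiffOn ℝ 1 (sheetSum μ u F) (regularSet μ u) := by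
  intro x hx
  obtain ⟨r, hr, ζ, hζ⟩ := exists_section_of_mem_regularSet hμ hx
  have h1 : ContDiffOn ℝ 1 (sheetSum μ u F) (Metric.ball x r) :=
    ((hF _ _ hζ).add (hF _ _ (hζ.tau hμ))).congr fun y hy => hζ.sheetSum_eq hμ F hy
  exact (h1.contDiffAt (Metric.ball_mem_nhds x hr)).contDiffWithinAt

theorem continuousOn_wedgeAt {N : ℕ} {μ : ℂ} {u : Fin N → ℂ} {α β : RealForm}
    (hα : ∀ s ζ, IsSection μ u s ζ → ContinuousOn (fun x => α (x, ζ x)) s)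
    (hβ : ∀ s ζ, IsSection μ u s ζ → ContinuousOn (fun x => β (x, ζ x)) s) :
    ∀ s ζ, IsSection μ u s ζ → ContinuousOn (fun x => wedgeAt α β (x, ζ x)) s := by
  intro s ζ hs
  have h1 := hα s ζ hs
  have h2 := hβ s ζ hs
  simp only [wedgeAt]
  exact ((h1.clm_apply continuousOn_const).mul (h2.clm_apply continuousOn_const)).sub
    ((h1.clm_apply continuousOn_const).mul (h2.clm_apply continuousOn_const))

/-- The function that dominates the wedge product of two forms. -/
theorem exists_wedge_bound {N : ℕ} (hN : 2 ≤ N) {μ : ℂ} {u : Fin N → ℂ}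
    (hu : IsSmoothCurve μ u) {α β : RealForm} (hα : IsBoundedForm μ u α)
    (hβ : IsBoundedForm μ u β) : ∃ b : ℂ → ℝ, Integrable b ∧ (∀ x, 0 ≤ b x) ∧
      ∀ p ∈ curve μ u, ‖α p‖ * ‖β p‖ ≤ b p.1 := by
  obtain ⟨K, hK⟩ := hα
  obtain ⟨L, hL⟩ := hβ
  refine ⟨_, (integrable_wedge_bound hN hu).const_mul (|K| * |L|), fun x => by positivity,
    fun p hp => ?_⟩
  have hy : 0 < ‖yCoord μ p‖ := norm_pos_iff.2 (yCoord_ne_zero hp)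
  have h1 : ‖α p‖ * ‖yCoord μ p‖ ≤ |K| * (1 + ‖p.1‖) ^ (2 * N - 2) :=
    (hK p hp).trans (by gcongr; exact le_abs_self K)
  have h2 : ‖β p‖ * ‖yCoord μ p‖ ≤ |L| * (1 + ‖p.1‖) ^ (2 * N - 2) :=
    (hL p hp).trans (by gcongr; exact le_abs_self L)
  rw [← yCoord_sq hp, norm_pow, Real.rpow_neg_one, ← mul_assoc, ← div_eq_mul_inv,
    le_div_iff₀ (by positivity)]
  calc ‖α p‖ * ‖β p‖ * ‖yCoord μ p‖ ^ 2
      = (‖α p‖ * ‖yCoord μ p‖) * (‖β p‖ * ‖yCoord μ p‖) := by ring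
    _ ≤ (|K| * (1 + ‖p.1‖) ^ (2 * N - 2)) * (|L| * (1 + ‖p.1‖) ^ (2 * N - 2)) := by gcongr
    _ = |K| * |L| * (1 + ‖p.1‖) ^ (2 * N - 2 + (2 * N - 2)) := by rw [pow_add]; ring
    _ = _ := by rw [show 2 * N - 2 + (2 * N - 2) = 4 * N - 4 by omega]

theorem integrable_sheetSum_wedgeAt {N : ℕ} (hN : 2 ≤ N) {μ : ℂ} {u : Fin N → ℂ}
    (hu : IsSmoothCurve μ u) {α β : RealForm}
    (hαc : ∀ s ζ, IsSection μ u s ζ → ContinuousOn (fun x => α (x, ζ x)) s)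
    (hβc : ∀ s ζ, IsSection μ u s ζ → ContinuousOn (fun x => β (x, ζ x)) s)
    (hα : IsBoundedForm μ u α) (hβ : IsBoundedForm μ u β) :
    Integrable (sheetSum μ u (wedgeAt α β)) := by
  obtain ⟨b, hbi, hb0, hb⟩ := exists_wedge_bound hN hu hα hβ
  have hμ := hu.ne_zero hN
  refine (hbi.const_mul 4).mono' (hu.aestronglyMeasurable
    (continuousOn_sheetSum hμ (continuousOn_wedgeAt hαc hβc))) (ae_of_all _ fun x => ?_)
  refine (norm_sheetSum_le hμ (b := 2 * b x) (by have := hb0 x; positivity) fun z hz => ?_).trans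
    (by linarith)
  refine (norm_wedgeAt_le α β _).trans ?_
  have := hb _ hz
  gcongr

/-- Cut-off functions: compactly supported in the regular set, converging to `1`, with small
gradient with respect to the logarithmic derivative of `p = puncturePoly μ u`. They are functions
of `log |p|²`, which is a proper function on the regular set. -/
theorem exists_cutoff {N : ℕ} (hN : 2 ≤ N) (μ : ℂ) (u : Fin N → ℂ) :
    ∃ (χ : ℕ → ℂ → ℝ) (dχ : ℕ → ℂ → ℂ →L[ℝ] ℝ) (C : ℝ),
      0 ≤ C ∧ (∀ n x, HasFDerivAt (χ n) (dχ n x) x) ∧ (∀ n, Continuous (dχ n)) ∧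
      (∀ n, ∃ k, IsCompact k ∧ k ⊆ regularSet μ u ∧ ∀ x ∉ k, χ n x = 0 ∧ dχ n x = 0) ∧
      (∀ n x, ‖χ n x‖ ≤ 1) ∧
      (∀ x ∈ regularSet μ u, Filter.Tendsto (fun n => χ n x) Filter.atTop (𝓝 1)) ∧
      ∀ n, ∀ x ∈ regularSet μ u, ‖dχ n x‖ ≤
        C / (n + 1) * (‖(derivative (puncturePoly μ u)).eval x‖ / ‖(puncturePoly μ u).eval x‖) := by
  set p := puncturePoly μ u with hp
  have hmem : ∀ x, x ∈ regularSet μ u ↔ p.eval x ≠ 0 := fun x => by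
    simp [hp, puncturePoly, regularSet]
  let θ : ContDiffBump (0 : ℝ) := ⟨1, 2, one_pos, one_lt_two⟩
  set ρ : ℂ → ℝ := fun x => Real.log (‖p.eval x‖ ^ 2) with hρ
  set c : ℕ → Set ℂ := fun n => {x | Real.exp (-(2 * (n + 1))) ≤ ‖p.eval x‖ ^ 2 ∧
    ‖p.eval x‖ ^ 2 ≤ Real.exp (2 * (n + 1))} with hc
  have hcn : ∀ n x, x ∈ c n → p.eval x ≠ 0 := by
    rintro n x ⟨h1, -⟩ h0
    rw [h0, norm_zero, zero_pow two_ne_zero] at h1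
    exact absurd h1 (not_le.2 (Real.exp_pos _))
  have hcρ : ∀ n x, p.eval x ≠ 0 → x ∉ c n → 2 ≤ |ρ x / (n + 1)| := by
    intro n x hx hxc
    have h0 : 0 < ‖p.eval x‖ ^ 2 := by have := norm_pos_iff.2 hx; positivity
    have hn : (0 : ℝ) < n + 1 := by positivity
    rw [abs_div, abs_of_pos hn, le_div_iff₀ hn]
    by_contra hlt
    rw [not_le, abs_lt] at hlt
    refine hxc ⟨?_, ?_⟩
    · rw [← Real.le_log_iff_exp_le h0]; exact hlt.1.le
    · rw [← Real.log_le_iff_le_exp h0]; exact hlt.2.le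
  have hcclosed : ∀ n, IsClosed (c n) := fun n =>
    (isClosed_le continuous_const (p.continuous.norm.pow 2)).inter
      (isClosed_le (p.continuous.norm.pow 2) continuous_const)
  have hccompact : ∀ n, IsCompact (c n) := by
    intro n
    have h1 : Filter.Tendsto (fun x => ‖p.eval x‖) (Filter.cocompact ℂ) Filter.atTop :=
      p.tendsto_norm_atTop (by
        rw [← natDegree_pos_iff_degree_pos, hp, natDegree_puncturePoly hN]; omega)
        tendsto_norm_cocompact_atTop
    have h2 : (c n)ᶜ ∈ Filter.cocompact ℂ := by
      filter_upwards [h1.eventually_gt_atTop (Real.exp (2 * (n + 1))),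
        h1.eventually_ge_atTop 1] with x hx hx1 hxc
      have h3 : ‖p.eval x‖ ≤ ‖p.eval x‖ ^ 2 := by nlinarith
      linarith [hxc.2]
    obtain ⟨t, ht, hts⟩ := Filter.mem_cocompact.1 h2
    exact ht.of_isClosed_subset (hcclosed n) (Set.compl_subset_compl.1 hts)
  classical
  set χ : ℕ → ℂ → ℝ := fun n x => if p.eval x = 0 then 0 else θ (ρ x / (n + 1)) with hχ
  have hχ0 : ∀ n x, x ∉ c n → χ n x = 0 := by
    intro n x hx
    by_cases h0 : p.eval x = 0
    · simp [hχ, h0]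
    · simp only [hχ, if_neg h0]
      exact θ.zero_of_le_dist (by
        rw [Real.dist_eq, sub_zero]; exact hcρ n x h0 hx)
  have hsmooth : ∀ n x, ContDiffAt ℝ 1 (χ n) x := by
    intro n x
    by_cases hx : x ∈ c n
    · have hx0 := hcn n x hx
      have h1 : ContDiffAt ℝ 1 (fun x => p.eval x) x := by
        have : ContDiff ℂ 1 (fun x => p.eval x) := by
          simpa using p.contDiff_aeval (𝕜 := ℂ) 1
        exact (this.restrict_scalars ℝ).contDiffAt
      have h2 : ContDiffAt ℝ 1 ρ x := (h1.norm_sq ℝ).log (by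
        have := norm_pos_iff.2 hx0; positivity)
      have h3 : ContDiffAt ℝ 1 (fun x => θ (ρ x / (n + 1))) x :=
        (θ.contDiffAt (n := 1)).comp x (h2.div_const _)
      refine h3.congr_of_eventuallyEq ?_
      filter_upwards [p.continuous.continuousAt.eventually_ne hx0] with y hy
      simp only [hχ, if_neg hy]
    · refine (contDiffAt_const (c := (0 : ℝ))).congr_of_eventuallyEq ?_
      filter_upwards [(hcclosed n).isOpen_compl.mem_nhds hx] with y hy
      exact hχ0 n y hy
  have hθ1 : ContDiff ℝ 1 (θ : ℝ → ℝ) := θ.contDiff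
  obtain ⟨C, hC⟩ : ∃ C, ∀ t, ‖fderiv ℝ (θ : ℝ → ℝ) t‖ ≤ C :=
    (hθ1.continuous_fderiv one_ne_zero).bounded_above_of_compact_support
      (θ.hasCompactSupport.fderiv ℝ)
  have hC0 : 0 ≤ C := (norm_nonneg _).trans (hC 0)
  refine ⟨χ, fun n x => fderiv ℝ (χ n) x, 2 * C, by positivity, fun n x =>
    ((hsmooth n x).differentiableAt one_ne_zero).hasFDerivAt, fun n =>
      (contDiff_iff_contDiffAt.2 (hsmooth n)).continuous_fderiv one_ne_zero,
      fun n => ⟨c n, hccompact n, fun x hx => (hmem x).2 (hcn n x hx), fun x hx =>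
        ⟨hχ0 n x hx, ?_⟩⟩, fun n x => ?_, fun x hx => ?_, fun n x hx => ?_⟩
  · have : χ n =ᶠ[𝓝 x] fun _ => 0 := by
      filter_upwards [(hcclosed n).isOpen_compl.mem_nhds hx] with y hy
      exact hχ0 n y hy
    show fderiv ℝ (χ n) x = 0
    rw [this.fderiv_eq]
    simp
  · by_cases h0 : p.eval x = 0
    · simp [hχ, h0]
    · simp only [hχ, if_neg h0]
      rw [Real.norm_of_nonneg θ.nonneg]
      exact θ.le_one
  · have hx0 := (hmem x).1 hx
    simp only [hχ, if_neg hx0]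
    refine tendsto_const_nhds.congr' ?_
    filter_upwards [Filter.eventually_ge_atTop ⌈|ρ x|⌉₊] with n hn
    refine (θ.one_of_mem_closedBall ?_).symm
    have h1 : |ρ x| ≤ n := (Nat.le_ceil _).trans (by exact_mod_cast hn)
    rw [mem_closedBall_zero_iff, Real.norm_eq_abs, abs_div,
      abs_of_pos (by positivity : (0 : ℝ) < n + 1), div_le_iff₀ (by positivity)]
    show |ρ x| ≤ 1 * (n + 1)
    linarith
  · have hx0 := (hmem x).1 hx
    have hpx : 0 < ‖p.eval x‖ := norm_pos_iff.2 hx0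
    have h1 : HasFDerivAt (fun x => p.eval x)
        ((ContinuousLinearMap.toSpanSingleton ℂ ((derivative p).eval x)).restrictScalars ℝ) x :=
      (p.hasDerivAt x).hasFDerivAt.restrictScalars ℝ
    have h2 := (h1.norm_sq.log (by positivity : ‖p.eval x‖ ^ 2 ≠ 0)).mul_const ((n + 1 : ℝ)⁻¹)
    have h3 := (((hθ1.differentiable one_ne_zero) (ρ x * (n + 1 : ℝ)⁻¹)).hasFDerivAt).comp x h2
    have h4 : HasFDerivAt (χ n) _ x := h3.congr_of_eventuallyEq (by
      filter_upwards [p.continuous.continuousAt.eventually_ne hx0] with y hy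
      simp only [hχ, if_neg hy]
      rfl)
    show ‖fderiv ℝ (χ n) x‖ ≤ _
    rw [h4.fderiv]
    refine (ContinuousLinearMap.opNorm_comp_le _ _).trans ?_
    have h5 : ‖(innerSL ℝ (p.eval x)).comp ((ContinuousLinearMap.toSpanSingleton ℂ
        ((derivative p).eval x)).restrictScalars ℝ)‖ ≤ ‖p.eval x‖ * ‖(derivative p).eval x‖ := by
      refine (ContinuousLinearMap.opNorm_comp_le _ _).trans ?_
      rw [innerSL_apply_norm, ContinuousLinearMap.norm_restrictScalars,
        ContinuousLinearMap.norm_toSpanSingleton]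
    set L := (innerSL ℝ (p.eval x)).comp ((ContinuousLinearMap.toSpanSingleton ℂ
        ((derivative p).eval x)).restrictScalars ℝ) with hL
    have hn : (0 : ℝ) < n + 1 := by positivity
    have h6 : ‖((n : ℝ) + 1)⁻¹ • (‖p.eval x‖ ^ 2)⁻¹ • 2 • L‖ ≤
        ((n : ℝ) + 1)⁻¹ * ((‖p.eval x‖ ^ 2)⁻¹ * (2 * (‖p.eval x‖ * ‖(derivative p).eval x‖))) := by
      rw [norm_smul, norm_smul, Real.norm_of_nonneg (by positivity),
        Real.norm_of_nonneg (by positivity)]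
      gcongr
      refine norm_nsmul_le.trans ?_
      push_cast
      gcongr
    calc _ ≤ C * (((n : ℝ) + 1)⁻¹ *
          ((‖p.eval x‖ ^ 2)⁻¹ * (2 * (‖p.eval x‖ * ‖(derivative p).eval x‖)))) := by
          gcongr
          exact hC _
      _ = _ := by field_simp

/-- `f` is a smooth primitive of the form `α` along all local sections. -/
def IsPrimitive {N : ℕ} (μ : ℂ) (u : Fin N → ℂ) (f : ℂ × ℂ → ℂ) (α : RealForm) : Prop :=
  ∀ s ζ, IsSection μ u s ζ → ContDiffOn ℝ 1 (fun x => f (x, ζ x)) s ∧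
    ∀ x ∈ s, HasFDerivAt (fun x => f (x, ζ x)) (α (x, ζ x)) x

theorem IsPrimitive.continuousOn {N : ℕ} {μ : ℂ} {u : Fin N → ℂ} {f : ℂ × ℂ → ℂ} {α : RealForm}
    (h : IsPrimitive μ u f α) (s : Set ℂ) (ζ : ℂ → ℂ) (hs : IsSection μ u s ζ) :
    ContinuousOn (fun x => α (x, ζ x)) s := by
  have h1 := ((h s ζ hs).1.continuousOn_fderiv_of_isOpen hs.1 le_rfl)
  exact h1.congr fun x hx => ((h s ζ hs).2 x hx).fderiv.symm

theorem integrable_smul_of_compact {S k : Set ℂ} (hk : IsCompact k) (hkS : k ⊆ S) {g : ℂ → ℂ}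
    (hg : ContinuousOn g S) {χ : ℂ → ℝ} (hχ : Continuous χ) (h0 : ∀ x ∉ k, χ x = 0) :
    Integrable (fun x => χ x • g x) := by
  have h1 : IntegrableOn (fun x => χ x • g x) k :=
    (hχ.continuousOn.smul (hg.mono hkS)).integrableOn_compact hk
  exact h1.integrable_of_forall_notMem_eq_zero fun x hx => by simp [h0 x hx]

/-- Integration by parts in the plane against a cut-off function. -/
theorem integral_smul_fderiv_eq {S k : Set ℂ} (hS : IsOpen S) (hk : IsCompact k) (hkS : k ⊆ S)
    {g : ℂ → ℂ} (hg : ContDiffOn ℝ 1 g S) {χ : ℂ → ℝ} {dχ : ℂ → ℂ →L[ℝ] ℝ}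
    (hχ : ∀ x, HasFDerivAt χ (dχ x) x) (hdχ : Continuous dχ)
    (h0 : ∀ x ∉ k, χ x = 0 ∧ dχ x = 0) (v : ℂ) :
    Integrable (fun x => χ x • fderiv ℝ g x v) ∧ Integrable (fun x => dχ x v • g x) ∧
    ∫ x, χ x • fderiv ℝ g x v = -∫ x, dχ x v • g x := by
  have hχc : Continuous χ :=
    (show Differentiable ℝ χ from fun x => (hχ x).differentiableAt).continuous
  have h1 : Integrable (fun x => χ x • fderiv ℝ g x v) :=
    integrable_smul_of_compact hk hkS
      ((hg.continuousOn_fderiv_of_isOpen hS le_rfl).clm_apply continuousOn_const) hχc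
      fun x hx => (h0 x hx).1
  have h2 : Integrable (fun x => dχ x v • g x) :=
    integrable_smul_of_compact hk hkS hg.continuousOn (χ := fun x => dχ x v)
      (hdχ.clm_apply continuous_const) fun x hx => by simp [(h0 x hx).2]
  have h3 : Integrable (fun x => χ x • g x) :=
    integrable_smul_of_compact hk hkS hg.continuousOn hχc fun x hx => (h0 x hx).1
  have hsupp : tsupport χ ⊆ k :=
    closure_minimal (fun x hx => by
      by_contra h
      exact hx (h0 x h).1) hk.isClosed
  refine ⟨h1, h2, ?_⟩
  exact integral_bilinear_hasLineDerivAt_right_eq_neg_left_of_integrable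
    (B := ContinuousLinearMap.lsmul ℝ ℝ) (f := χ) (f' := fun x => dχ x v) (g := g)
    (g' := fun x => fderiv ℝ g x v) (v := v) h2 h1 h3
    (fun x _ => (hχ x).hasLineDerivAt v)
    (fun x hx => (((hg.contDiffAt (hS.mem_nhds (hkS (hsupp hx)))).differentiableAt
      one_ne_zero).hasFDerivAt).hasLineDerivAt v)

theorem hasFDerivAt_sheetSum {N : ℕ} {μ : ℂ} (hμ : μ ≠ 0) {u : Fin N → ℂ} {F : ℂ × ℂ → ℂ}
    {s : Set ℂ} {ζ : ℂ → ℂ} (hs : IsSection μ u s ζ) {x : ℂ} (hx : x ∈ s) {L L' : ℂ →L[ℝ] ℂ}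
    (h1 : HasFDerivAt (fun x => F (x, ζ x)) L x)
    (h2 : HasFDerivAt (fun x => F (x, μ ^ 2 / ζ x)) L' x) :
    HasFDerivAt (sheetSum μ u F) (L + L') x := by
  refine (h1.add h2).congr_of_eventuallyEq ?_
  filter_upwards [hs.1.mem_nhds hx] with y hy
  exact hs.sheetSum_eq hμ F hy

/-- Stokes' theorem `∬ df ∧ β = 0` for a bounded function `f`. The form `f β` is pushed down to the
`x`-plane and integrated by parts against the cut-off functions; the boundary terms are dominated by
the logarithmic derivative of `x y²` and tend to zero. -/
theorem IsPrimitive.integral_wedgeAt_eq_zero_of_bounded {N : ℕ} (hN : 2 ≤ N) {μ : ℂ}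
    {u : Fin N → ℂ} (hu : IsSmoothCurve μ u) {f : ℂ × ℂ → ℂ} {α β : RealForm}
    (hf : IsPrimitive μ u f α) (hα : IsBoundedForm μ u α) {M : ℝ}
    (hM : ∀ p ∈ curve μ u, ‖f p‖ ≤ M) (hβ : IsClosedForm μ u β) :
    ∫ x, sheetSum μ u (wedgeAt α β) x = 0 := by
  have hμ := hu.ne_zero hN
  set S := regularSet μ u with hS
  have hSo : IsOpen S := isOpen_regularSet μ u
  have hβ1 : ∀ s ζ, IsSection μ u s ζ → ContDiffOn ℝ 1 (fun x => β (x, ζ x)) s :=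
    fun s ζ hs => (hβ.1 s ζ hs).1.of_le (by exact_mod_cast le_top)
  set g : ℂ → ℂ → ℂ := fun v => sheetSum μ u (fun p => f p * β p v) with hg
  have hgF : ∀ v s ζ, IsSection μ u s ζ → ContDiffOn ℝ 1 (fun x => f (x, ζ x) * β (x, ζ x) v) s :=
    fun v s ζ hs => (hf s ζ hs).1.mul ((hβ1 s ζ hs).clm_apply contDiffOn_const)
  have hg1 : ∀ v, ContDiffOn ℝ 1 (g v) S := fun v => contDiffOn_sheetSum hμ (hgF v)
  -- the curl of `f β`
  have hcurl : ∀ x ∈ S, fderiv ℝ (g Complex.I) x 1 - fderiv ℝ (g 1) x Complex.I =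
      sheetSum μ u (wedgeAt α β) x := by
    intro x hx
    obtain ⟨r, hr, ζ, hζ⟩ := exists_section_of_mem_regularSet hμ hx
    have hxr : x ∈ Metric.ball x r := Metric.mem_ball_self hr
    have hd : ∀ (ξ : ℂ → ℂ), IsSection μ u (Metric.ball x r) ξ → ∀ v,
        HasFDerivAt (fun x => f (x, ξ x) * β (x, ξ x) v)
          (f (x, ξ x) • ((ContinuousLinearMap.apply ℝ ℂ v).comp
            (fderiv ℝ (fun x => β (x, ξ x)) x)) + β (x, ξ x) v • α (x, ξ x)) x := by
      intro ξ hξ v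
      have h1 := ((hβ1 _ ξ hξ).contDiffAt (Metric.ball_mem_nhds x hr)).differentiableAt one_ne_zero
      have h2 : HasFDerivAt (fun x => β (x, ξ x) v) ((ContinuousLinearMap.apply ℝ ℂ v).comp
            (fderiv ℝ (fun x => β (x, ξ x)) x)) x :=
        (ContinuousLinearMap.apply ℝ ℂ v).hasFDerivAt.comp x h1.hasFDerivAt
      exact ((hf _ ξ hξ).2 x hxr).mul h2
    have hfd := fun v => (hasFDerivAt_sheetSum hμ (F := fun p => f p * β p v) hζ hxr
      (hd ζ hζ v) (hd _ (hζ.tau hμ) v)).fderiv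
    have hc1 := (hβ.1 _ ζ hζ).2 x hxr
    have hc2 := (hβ.1 _ _ (hζ.tau hμ)).2 x hxr
    simp only [hg]
    rw [hfd, hfd, hζ.sheetSum_eq hμ _ hxr]
    simp only [add_apply, smul_apply,
      ContinuousLinearMap.comp_apply, ContinuousLinearMap.apply_apply, smul_eq_mul, wedgeAt]
    rw [hc1, hc2]
    ring
  obtain ⟨χ, dχ, C, hC0, hχ, hdχ, hk, hχ1, hχt, hdb⟩ := exists_cutoff hN μ u
  have hint : Integrable (sheetSum μ u (wedgeAt α β)) :=
    integrable_sheetSum_wedgeAt hN hu hf.continuousOn (fun s ζ hs => (hβ1 s ζ hs).continuousOn)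
      hα hβ.2
  -- the integral against the cut-off functions tends to the integral
  have hlim1 : Filter.Tendsto (fun n => ∫ x, χ n x • sheetSum μ u (wedgeAt α β) x) Filter.atTop
      (𝓝 (∫ x, sheetSum μ u (wedgeAt α β) x)) := by
    refine tendsto_integral_of_dominated_convergence (fun x => ‖sheetSum μ u (wedgeAt α β) x‖)
      (fun n => ?_) hint.norm (fun n => ae_of_all _ fun x => ?_) ?_
    · have hχc : Continuous (χ n) :=
        (show Differentiable ℝ (χ n) from fun x => (hχ n x).differentiableAt).continuous
      exact hχc.aestronglyMeasurable.smul hint.aestronglyMeasurable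
    · rw [norm_smul]
      exact mul_le_of_le_one_left (norm_nonneg _) (hχ1 n x)
    · filter_upwards [hu.ae_mem_regularSet] with x hx
      simpa using (hχt x hx).smul_const (sheetSum μ u (wedgeAt α β) x)
  obtain ⟨K, hK⟩ := hβ.2
  set b : ℂ → ℝ := fun x => ‖(derivative (puncturePoly μ u)).eval x‖ * ‖x‖ ^ (1 / 2 : ℝ) *
    (1 + ‖x‖) ^ (2 * N - 2) * ‖(puncturePoly μ u).eval x‖ ^ (-(3 / 2) : ℝ) with hb
  have hbi : Integrable b := integrable_logDeriv_bound hN hu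
  have hgb : ∀ v x, ‖v‖ = 1 → x ∈ S → ‖(derivative (puncturePoly μ u)).eval x‖ /
      ‖(puncturePoly μ u).eval x‖ * ‖g v x‖ ≤ 2 * |M| * |K| * b x := by
    intro v x hv hx
    have hx0 : 0 < ‖x‖ := norm_pos_iff.2 hx.1
    have hh0 : 0 < ‖(hyperellipticPoly μ u).eval x‖ := norm_pos_iff.2 hx.2
    have h1 : ‖g v x‖ ≤ 2 * (|M| * (|K| * (1 + ‖x‖) ^ (2 * N - 2) *
        ‖(hyperellipticPoly μ u).eval x‖ ^ (-(1 / 2) : ℝ))) := by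
      refine norm_sheetSum_le hμ (by positivity) fun z hz => ?_
      rw [norm_mul]
      have h2 : ‖β (x, z) v‖ ≤ ‖β (x, z)‖ := by simpa [hv] using (β (x, z)).le_opNorm v
      have h3 := hK _ hz
      rw [norm_yCoord hz] at h3
      have h4 : ‖β (x, z)‖ ≤ |K| * (1 + ‖x‖) ^ (2 * N - 2) *
          ‖(hyperellipticPoly μ u).eval x‖ ^ (-(1 / 2) : ℝ) := by
        rw [Real.rpow_neg hh0.le, ← div_eq_mul_inv, le_div_iff₀ (by positivity)]
        refine h3.trans ?_
        gcongr
        exact le_abs_self K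
      have h5 := (hM _ hz).trans (le_abs_self M)
      gcongr
      exact h2.trans h4
    have h6 : b x = ‖(derivative (puncturePoly μ u)).eval x‖ / ‖(puncturePoly μ u).eval x‖ *
        ((1 + ‖x‖) ^ (2 * N - 2) * ‖(hyperellipticPoly μ u).eval x‖ ^ (-(1 / 2) : ℝ)) := by
      have h7 : ‖(puncturePoly μ u).eval x‖ = ‖x‖ * ‖(hyperellipticPoly μ u).eval x‖ := by
        simp [puncturePoly]
      have h8 : ∀ t : ℝ, 0 < t → t ^ (-(3 / 2) : ℝ) = t⁻¹ * t ^ (-(1 / 2) : ℝ) := by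
        intro t ht
        rw [← Real.rpow_neg_one, ← Real.rpow_add ht]
        norm_num
      simp only [hb]
      rw [h7, Real.mul_rpow hx0.le hh0.le, h8 _ hx0, h8 _ hh0, Real.rpow_neg hx0.le]
      have h9 : ‖x‖ ^ (1 / 2 : ℝ) ≠ 0 := by positivity
      field_simp
    rw [h6]
    calc _ ≤ ‖(derivative (puncturePoly μ u)).eval x‖ / ‖(puncturePoly μ u).eval x‖ *
          (2 * (|M| * (|K| * (1 + ‖x‖) ^ (2 * N - 2) *
        ‖(hyperellipticPoly μ u).eval x‖ ^ (-(1 / 2) : ℝ)))) := by gcongr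
      _ = _ := by ring
  have hlim2 : Filter.Tendsto (fun n => ∫ x, χ n x • sheetSum μ u (wedgeAt α β) x) Filter.atTop
      (𝓝 0) := by
    have hparts : ∀ n, ‖∫ x, χ n x • sheetSum μ u (wedgeAt α β) x‖ ≤
        (2 * (C * (2 * |M| * |K|)) * ∫ x, b x) * (1 / ((n : ℝ) + 1)) := by
      intro n
      obtain ⟨k, hkc, hkS, hk0⟩ := hk n
      obtain ⟨i1, j1, e1⟩ := integral_smul_fderiv_eq hSo hkc hkS (hg1 Complex.I) (hχ n) (hdχ n)
        hk0 1
      obtain ⟨i2, j2, e2⟩ := integral_smul_fderiv_eq hSo hkc hkS (hg1 1) (hχ n) (hdχ n)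
        hk0 Complex.I
      have h1 : ∫ x, χ n x • sheetSum μ u (wedgeAt α β) x =
          (∫ x, χ n x • fderiv ℝ (g Complex.I) x 1) -
            ∫ x, χ n x • fderiv ℝ (g 1) x Complex.I := by
        rw [← integral_sub i1 i2]
        refine integral_congr_ae ?_
        filter_upwards [hu.ae_mem_regularSet] with x hx
        rw [← hcurl x hx, smul_sub]
      have hest : ∀ v w : ℂ, ‖v‖ = 1 → ‖w‖ = 1 → ‖∫ x, dχ n x v • g w x‖ ≤
          C / (n + 1) * (2 * |M| * |K|) * ∫ x, b x := by
        intro v w hv hw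
        rw [← integral_const_mul]
        refine norm_integral_le_of_norm_le (hbi.const_mul _) ?_
        filter_upwards [hu.ae_mem_regularSet] with x hx
        rw [norm_smul]
        have h2 : ‖dχ n x v‖ ≤ ‖dχ n x‖ := by simpa [hv] using (dχ n x).le_opNorm v
        have h3 := hdb n x hx
        have h4 := hgb w x hw hx
        calc ‖dχ n x v‖ * ‖g w x‖ ≤ C / (n + 1) * (‖(derivative (puncturePoly μ u)).eval x‖ /
              ‖(puncturePoly μ u).eval x‖) * ‖g w x‖ := by
              gcongr
              exact h2.trans h3
          _ = C / (n + 1) * (‖(derivative (puncturePoly μ u)).eval x‖ /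
              ‖(puncturePoly μ u).eval x‖ * ‖g w x‖) := by ring
          _ ≤ C / (n + 1) * (2 * |M| * |K| * b x) := by gcongr
          _ = _ := by ring
      rw [h1, e1, e2]
      have h5 := hest 1 Complex.I (by simp) (by simp)
      have h6 := hest Complex.I 1 (by simp) (by simp)
      refine (norm_sub_le _ _).trans ?_
      rw [norm_neg, norm_neg]
      refine (add_le_add h5 h6).trans (le_of_eq ?_)
      ring
    refine squeeze_zero_norm hparts ?_
    simpa using tendsto_one_div_add_atTop_nhds_zero_nat.const_mul
      (2 * (C * (2 * |M| * |K|)) * ∫ x, b x)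
  exact tendsto_nhds_unique hlim1 hlim2

/-- Stokes' theorem `∬ df ∧ β = 0`. The function `f` is truncated by composition with bounded
functions with bounded gradients that converge to the identity. -/
theorem IsPrimitive.integral_wedgeAt_eq_zero {N : ℕ} (hN : 2 ≤ N) {μ : ℂ}
    {u : Fin N → ℂ} (hu : IsSmoothCurve μ u) {f : ℂ × ℂ → ℂ} {α β : RealForm}
    (hf : IsPrimitive μ u f α) (hα : IsBoundedForm μ u α) (hβ : IsClosedForm μ u β) :
    ∫ x, sheetSum μ u (wedgeAt α β) x = 0 := by
  have hμ := hu.ne_zero hN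
  let θ : ContDiffBump (0 : ℂ) := ⟨1, 2, one_pos, one_lt_two⟩
  set Φ : ℂ → ℂ := fun w => θ w • w with hΦ
  have hΦ1 : ContDiff ℝ 1 Φ := θ.contDiff.smul contDiff_id
  have hΦs : HasCompactSupport Φ := θ.hasCompactSupport.smul_right
  obtain ⟨C, hC⟩ := (hΦ1.continuous_fderiv one_ne_zero).bounded_above_of_compact_support
    (hΦs.fderiv ℝ)
  obtain ⟨M, hM⟩ := hΦ1.continuous.bounded_above_of_compact_support hΦs
  have hC0 : 0 ≤ C := (norm_nonneg _).trans (hC 0)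
  set T : ℕ → ℂ → ℂ := fun n w => ((n : ℝ) + 1) • Φ (((n : ℝ) + 1)⁻¹ • w) with hT
  have hT1 : ∀ n, ContDiff ℝ 1 (T n) := fun n => (hΦ1.comp (contDiff_id.const_smul _)).const_smul _
  have hTd : ∀ n w, HasFDerivAt (T n) (fderiv ℝ Φ (((n : ℝ) + 1)⁻¹ • w)) w := by
    intro n w
    have h1 := (((hΦ1.differentiable one_ne_zero) (((n : ℝ) + 1)⁻¹ • w)).hasFDerivAt.comp w
      ((hasFDerivAt_id w).const_smul (((n : ℝ) + 1)⁻¹))).const_smul ((n : ℝ) + 1)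
    refine h1.congr_fderiv ?_
    ext v
    have hn : (n : ℝ) + 1 ≠ 0 := by positivity
    simp only [smul_apply, ContinuousLinearMap.comp_apply,
      ContinuousLinearMap.id_apply, map_smul]
    rw [smul_smul, mul_inv_cancel₀ hn, one_smul]
  set αn : ℕ → RealForm := fun n p => (fderiv ℝ Φ (((n : ℝ) + 1)⁻¹ • f p)).comp (α p) with hαn
  have hle : ∀ n p, ‖αn n p‖ ≤ C * ‖α p‖ := fun n p =>
    (ContinuousLinearMap.opNorm_comp_le _ _).trans (by gcongr; exact hC _)
  have hprim : ∀ n, IsPrimitive μ u (fun p => T n (f p)) (αn n) := fun n s ζ hs =>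
    ⟨(hT1 n).comp_contDiffOn (hf s ζ hs).1, fun x hx =>
      HasFDerivAt.comp (g := T n) x (hTd n (f (x, ζ x))) ((hf s ζ hs).2 x hx)⟩
  have hbd : ∀ n, IsBoundedForm μ u (αn n) := by
    intro n
    obtain ⟨K, hK⟩ := hα
    refine ⟨C * K, fun p hp => ?_⟩
    calc ‖αn n p‖ * ‖yCoord μ p‖ ≤ C * ‖α p‖ * ‖yCoord μ p‖ := by gcongr; exact hle n p
      _ = C * (‖α p‖ * ‖yCoord μ p‖) := by ring
      _ ≤ C * (K * (1 + ‖p.1‖) ^ (2 * N - 2)) := mul_le_mul_of_nonneg_left (hK p hp) hC0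
      _ = _ := by ring
  have hzero : ∀ n, ∫ x, sheetSum μ u (wedgeAt (αn n) β) x = 0 := fun n =>
    (hprim n).integral_wedgeAt_eq_zero_of_bounded hN hu (hbd n) (M := ((n : ℝ) + 1) * M)
      (fun p _ => by
        simp only [hT]
        rw [norm_smul, Real.norm_of_nonneg (by positivity)]
        gcongr
        exact hM _) hβ
  have hβc : ∀ s ζ, IsSection μ u s ζ → ContinuousOn (fun x => β (x, ζ x)) s :=
    fun s ζ hs => (hβ.1 s ζ hs).1.continuousOn
  obtain ⟨b, hbi, hb0, hb⟩ := exists_wedge_bound hN hu hα hβ.2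
  have hlim : Filter.Tendsto (fun n => ∫ x, sheetSum μ u (wedgeAt (αn n) β) x) Filter.atTop
      (𝓝 (∫ x, sheetSum μ u (wedgeAt α β) x)) := by
    refine tendsto_integral_of_dominated_convergence (fun x => 4 * C * b x) (fun n => ?_)
      (hbi.const_mul _) (fun n => ae_of_all _ fun x => ?_) ?_
    · exact (integrable_sheetSum_wedgeAt hN hu (hprim n).continuousOn hβc (hbd n)
        hβ.2).aestronglyMeasurable
    · refine (norm_sheetSum_le hμ (b := 2 * C * b x) (by have := hb0 x; positivity)
        fun z hz => ?_).trans (by linarith)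
      refine (norm_wedgeAt_le _ β _).trans ?_
      calc 2 * (‖αn n (x, z)‖ * ‖β (x, z)‖) ≤ 2 * (C * ‖α (x, z)‖ * ‖β (x, z)‖) := by
            gcongr; exact hle n _
        _ = 2 * C * (‖α (x, z)‖ * ‖β (x, z)‖) := by ring
        _ ≤ _ := by gcongr; exact hb _ hz
    · filter_upwards [hu.ae_mem_regularSet] with x hx
      obtain ⟨z, hz⟩ := exists_mem_curve hμ hx
      -- the truncation is the identity near each given point from some `n` on
      have hev : ∀ p : ℂ × ℂ, ∀ᶠ n in Filter.atTop, αn n p = α p := by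
        intro p
        filter_upwards [Filter.eventually_ge_atTop ⌈‖f p‖⌉₊] with n hn
        have h1 : ‖f p‖ ≤ n := (Nat.le_ceil _).trans (by exact_mod_cast hn)
        have h2 : (((n : ℝ) + 1)⁻¹ • f p) ∈ Metric.ball (0 : ℂ) θ.rIn := by
          rw [mem_ball_zero_iff, norm_smul, Real.norm_of_nonneg (by positivity),
            inv_mul_lt_iff₀ (by positivity)]
          show ‖f p‖ < (n + 1) * 1
          linarith
        have h3 : Φ =ᶠ[𝓝 (((n : ℝ) + 1)⁻¹ • f p)] id := by
          filter_upwards [θ.eventuallyEq_one_of_mem_ball h2] with w hw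
          simp [hΦ, hw]
        simp only [hαn]
        rw [h3.fderiv_eq, fderiv_id]
        exact ContinuousLinearMap.id_comp _
      refine tendsto_const_nhds.congr' ?_
      filter_upwards [hev (x, z), hev (tau μ (x, z))] with n h1 h2
      rw [sheetSum_eq hμ _ hz, sheetSum_eq hμ _ hz, wedgeAt, wedgeAt, wedgeAt, wedgeAt, h1, h2]
  simp only [hzero] at hlim
  exact tendsto_nhds_unique hlim tendsto_const_nhds

/-! ### Primitives of forms with vanishing periods -/

/-- Integral of the form `α` along a path, over an interval. -/
def pathIntegral (α : RealForm) (γ : ℝ → ℂ × ℂ) (a b : ℝ) : ℂ :=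
  ∫ t in a..b, α (γ t) (deriv (fun s => (γ s).1) t)

/-- Continuity of `α` along local sections. -/
def IsContinuousForm {N : ℕ} (μ : ℂ) (u : Fin N → ℂ) (α : RealForm) : Prop :=
  ∀ s ζ, IsSection μ u s ζ → ContinuousOn (fun x => α (x, ζ x)) s

theorem continuous_comp_of_section {N : ℕ} {E : Type*} [TopologicalSpace E] {μ : ℂ} (hμ : μ ≠ 0)
    {u : Fin N → ℂ} {F : ℂ × ℂ → E}
    (hF : ∀ s ζ, IsSection μ u s ζ → ContinuousOn (fun x => F (x, ζ x)) s)
    {γ : ℝ → ℂ × ℂ} (hγ : Continuous γ) (hmem : ∀ t, γ t ∈ curve μ u) :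
    Continuous fun t => F (γ t) := by
  rw [continuous_iff_continuousAt]
  intro t
  obtain ⟨r, hr, ζ, hζ, -, hev⟩ := exists_section hμ (hmem t)
  have h1 : ContinuousAt (fun x => F (x, ζ x)) (γ t).1 :=
    (hF _ ζ hζ).continuousAt (Metric.ball_mem_nhds _ hr)
  have h2 : ContinuousAt (fun t => (γ t).1) t := (continuous_fst.comp hγ).continuousAt
  have h3 : ContinuousAt (fun t => F ((γ t).1, ζ (γ t).1)) t :=
    ContinuousAt.comp (f := fun t => (γ t).1) (x := t) h1 h2
  refine h3.congr ?_
  filter_upwards [hγ.continuousAt.eventually hev] with s hs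
  rw [← hs (hmem s)]

theorem continuous_deriv_fst {γ : ℝ → ℂ × ℂ} (hγ : ContDiff ℝ ∞ γ) :
    Continuous (deriv fun s => (γ s).1) :=
  (contDiff_fst.comp hγ).continuous_deriv (by simp)

theorem intervalIntegrable_form {N : ℕ} {μ : ℂ} (hμ : μ ≠ 0) {u : Fin N → ℂ} {α : RealForm}
    (hα : IsContinuousForm μ u α) {γ : ℝ → ℂ × ℂ} (hγ : ContDiff ℝ ∞ γ)
    (hmem : ∀ t, γ t ∈ curve μ u) (a b : ℝ) :
    IntervalIntegrable (fun t => α (γ t) (deriv (fun s => (γ s).1) t)) volume a b :=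
  ((continuous_comp_of_section hμ hα hγ.continuous hmem).clm_apply
    (continuous_deriv_fst hγ)).intervalIntegrable a b

theorem pathIntegral_congr {α : RealForm} {γ δ : ℝ → ℂ × ℂ} {a b : ℝ} (hab : a ≤ b)
    (h : ∀ t ∈ Set.Ioo a b, γ t = δ t) : pathIntegral α γ a b = pathIntegral α δ a b := by
  refine intervalIntegral.integral_congr_Ioo_of_le hab fun t ht => ?_
  have h1 : (fun s => (γ s).1) =ᶠ[𝓝 t] fun s => (δ s).1 := by
    filter_upwards [Ioo_mem_nhds ht.1 ht.2] with s hs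
    rw [h s hs]
  simp only [h t ht, h1.deriv_eq]

/-- A smooth path in the curve from `p` to `q`, constant before time `0` and after time `1`. -/
structure IsArc {N : ℕ} (μ : ℂ) (u : Fin N → ℂ) (p q : ℂ × ℂ) (γ : ℝ → ℂ × ℂ) : Prop where
  smooth : ContDiff ℝ ∞ γ
  mem : ∀ t, γ t ∈ curve μ u
  source : ∀ t ≤ 0, γ t = p
  target : ∀ t, 1 ≤ t → γ t = q

/-- There is a smooth path from `p` to `q` along which `α` has the integral `c`. -/
def Reach {N : ℕ} (μ : ℂ) (u : Fin N → ℂ) (α : RealForm) (p q : ℂ × ℂ) (c : ℂ) : Prop :=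
  ∃ γ, IsArc μ u p q γ ∧ pathIntegral α γ 0 1 = c

theorem Reach.symm {N : ℕ} {μ : ℂ} {u : Fin N → ℂ} {α : RealForm} {p q : ℂ × ℂ} {c : ℂ}
    (h : Reach μ u α p q c) : Reach μ u α q p (-c) := by
  obtain ⟨γ, hγ, rfl⟩ := h
  refine ⟨fun t => γ (1 - t), ⟨hγ.smooth.comp (contDiff_const.sub contDiff_id), fun t => hγ.mem _,
    fun t ht => hγ.target _ (by linarith), fun t ht => hγ.source _ (by linarith)⟩, ?_⟩
  have h1 : ∀ t, deriv (fun s => (γ (1 - s)).1) t = -deriv (fun s => (γ s).1) (1 - t) :=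
    fun t => deriv_comp_const_sub (f := fun s => (γ s).1) 1 t
  simp only [pathIntegral, h1, map_neg]
  rw [intervalIntegral.integral_neg,
    intervalIntegral.integral_comp_sub_left (fun t => α (γ t) (deriv (fun s => (γ s).1) t)) 1]
  simp

theorem Reach.trans {N : ℕ} {μ : ℂ} (hμ : μ ≠ 0) {u : Fin N → ℂ} {α : RealForm}
    (hα : IsContinuousForm μ u α) {p q r : ℂ × ℂ} {c d : ℂ}
    (h : Reach μ u α p q c) (h' : Reach μ u α q r d) : Reach μ u α p r (c + d) := by
  obtain ⟨γ, hγ, rfl⟩ := h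
  obtain ⟨δ, hδ, rfl⟩ := h'
  -- at each time one of the two paths has the value `q`
  set ε : ℝ → ℂ × ℂ := fun t => γ (2 * t) + δ (2 * t - 1) - q with hε
  have h1 : ∀ t ≤ 1 / 2, ε t = γ (2 * t) := fun t ht => by
    simp only [hε]; rw [hδ.source _ (by linarith)]; abel
  have h2 : ∀ t, 1 / 2 ≤ t → ε t = δ (2 * t - 1) := fun t ht => by
    simp only [hε]; rw [hγ.target _ (by linarith)]; abel
  have hsm : ContDiff ℝ ∞ ε := by
    have h3 : ContDiff ℝ ∞ fun t : ℝ => 2 * t := contDiff_const.mul contDiff_id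
    exact ((hγ.smooth.comp h3).add (hδ.smooth.comp (h3.sub contDiff_const))).sub contDiff_const
  have hmem : ∀ t, ε t ∈ curve μ u := fun t => by
    rcases le_total t (1 / 2) with ht | ht
    · rw [h1 t ht]; exact hγ.mem _
    · rw [h2 t ht]; exact hδ.mem _
  refine ⟨ε, ⟨hsm, hmem, fun t ht => ?_, fun t ht => ?_⟩, ?_⟩
  · rw [h1 t (by linarith)]; exact hγ.source _ (by linarith)
  · rw [h2 t (by linarith)]; exact hδ.target _ (by linarith)
  have hscale : ∀ (η : ℝ → ℂ × ℂ) (b x y : ℝ), pathIntegral α (fun t => η (2 * t - b)) x y =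
      pathIntegral α η (2 * x - b) (2 * y - b) := by
    intro η b x y
    have h4 : ∀ t, deriv (fun s => (η (2 * s - b)).1) t =
        (2 : ℝ) • deriv (fun s => (η s).1) (2 * t - b) := by
      intro t
      have h5 := deriv_comp_mul_left (2 : ℝ) (fun s => (η (s - b)).1) t
      rw [h5, deriv_comp_sub_const (f := fun s => (η s).1)]
    simp only [pathIntegral, h4, map_smul]
    rw [intervalIntegral.integral_smul]
    exact intervalIntegral.smul_integral_comp_mul_sub
      (fun t => α (η t) (deriv (fun s => (η s).1) t)) 2 b
  have hsplit : pathIntegral α ε 0 1 = pathIntegral α ε 0 (1 / 2) + pathIntegral α ε (1 / 2) 1 :=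
    (intervalIntegral.integral_add_adjacent_intervals (intervalIntegrable_form hμ hα hsm hmem _ _)
      (intervalIntegrable_form hμ hα hsm hmem _ _)).symm
  rw [hsplit, pathIntegral_congr (δ := fun t => γ (2 * t - 0)) (by norm_num)
    (fun t ht => by rw [h1 t ht.2.le, sub_zero]),
    pathIntegral_congr (γ := ε) (δ := fun t => δ (2 * t - 1)) (by norm_num)
    (fun t ht => h2 t ht.1.le), hscale, hscale]
  norm_num

theorem IsArc.isLoop {N : ℕ} {μ : ℂ} {u : Fin N → ℂ} {p : ℂ × ℂ} {γ : ℝ → ℂ × ℂ}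
    (h : IsArc μ u p p γ) : IsLoop μ u (fun t => γ (Int.fract t)) := by
  refine ⟨?_, fun t => by simp, fun t => h.mem _⟩
  rw [contDiff_iff_contDiffAt]
  intro t
  set n : ℤ := ⌊t⌋ with hn
  have h1 : ContDiff ℝ ∞ fun s : ℝ => γ (s - n + 1) + γ (s - n) - p := by
    have h3 : ContDiff ℝ ∞ fun s : ℝ => s - n := contDiff_id.sub contDiff_const
    exact ((h.smooth.comp (h3.add contDiff_const)).add (h.smooth.comp h3)).sub contDiff_const
  refine h1.contDiffAt.congr_of_eventuallyEq ?_
  have ht1 : (n : ℝ) ≤ t := Int.floor_le t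
  have ht2 : t < n + 1 := Int.lt_floor_add_one t
  filter_upwards [Ioo_mem_nhds (show (n : ℝ) - 1 < t by linarith) ht2] with s hs
  rcases lt_or_ge s n with hsn | hsn
  · have h2 : Int.fract s = s - n + 1 := by
      rw [Int.fract_eq_iff]
      exact ⟨by linarith [hs.1], by linarith, n - 1, by push_cast; ring⟩
    rw [h2, h.source (s - n) (by linarith)]
    abel
  · have h2 : Int.fract s = s - n := by
      rw [Int.fract_eq_iff]
      exact ⟨by linarith, by linarith [hs.2], n, by ring⟩
    rw [h2, h.target (s - n + 1) (by linarith)]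
    abel

theorem Reach.eq_zero {N : ℕ} {μ : ℂ} {u : Fin N → ℂ} {α : RealForm}
    (hα : ∀ δ, IsLoop μ u δ → loopIntegral δ α = 0) {p : ℂ × ℂ} {c : ℂ}
    (h : Reach μ u α p p c) : c = 0 := by
  obtain ⟨γ, hγ, rfl⟩ := h
  rw [← hα _ hγ.isLoop]
  refine pathIntegral_congr zero_le_one fun t ht => ?_
  rw [Int.fract_eq_self.2 ⟨ht.1.le, ht.2⟩]

theorem reach_of_section {N : ℕ} {μ : ℂ} {u : Fin N → ℂ} {α : RealForm} {c : ℂ} {r : ℝ}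
    {ζ : ℂ → ℂ} (hζ : IsSection μ u (Metric.ball c r) ζ)
    (hα : ContinuousOn (fun x => α (x, ζ x)) (Metric.ball c r)) {g : ℂ → ℂ}
    (hg : ∀ x ∈ Metric.ball c r, HasFDerivAt g (α (x, ζ x)) x) {x y : ℂ}
    (hx : x ∈ Metric.ball c r) (hy : y ∈ Metric.ball c r) :
    Reach μ u α (x, ζ x) (y, ζ y) (g y - g x) := by
  set ℓ : ℝ → ℂ := fun t => x + Real.smoothTransition t • (y - x) with hℓ
  have hsm : ContDiff ℝ ∞ ℓ :=
    contDiff_const.add (Real.smoothTransition.contDiff.smul contDiff_const)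
  have hmem : ∀ t, ℓ t ∈ Metric.ball c r := fun t =>
    (convex_ball c r).add_smul_sub_mem hx hy
      ⟨Real.smoothTransition.nonneg t, Real.smoothTransition.le_one t⟩
  have hζsm : ContDiffOn ℝ ∞ ζ (Metric.ball c r) :=
    (hζ.2.1.contDiffOn Metric.isOpen_ball).restrict_scalars ℝ
  have hγ : ContDiff ℝ ∞ fun t => (ℓ t, ζ (ℓ t)) := by
    refine hsm.prodMk (contDiff_iff_contDiffAt.2 fun t => ?_)
    exact (hζsm.contDiffAt (Metric.isOpen_ball.mem_nhds (hmem t))).comp t hsm.contDiffAt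
  have hℓc : Continuous (deriv ℓ) := hsm.continuous_deriv (by simp)
  have hαc : Continuous fun t => α (ℓ t, ζ (ℓ t)) :=
    hα.comp_continuous hsm.continuous hmem
  refine ⟨fun t => (ℓ t, ζ (ℓ t)), ⟨hγ, fun t => hζ.2.2 _ (hmem t), fun t ht => ?_,
    fun t ht => ?_⟩, ?_⟩
  · simp [hℓ, Real.smoothTransition.zero_of_nonpos ht]
  · simp [hℓ, Real.smoothTransition.one_of_one_le ht]
  · have h1 : ∀ t, HasDerivAt (fun t => g (ℓ t)) (α (ℓ t, ζ (ℓ t)) (deriv ℓ t)) t := fun t =>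
      (hg _ (hmem t)).comp_hasDerivAt t
        ((hsm.differentiable (by simp)).differentiableAt.hasDerivAt)
    have h2 := intervalIntegral.integral_eq_sub_of_hasDerivAt (a := 0) (b := 1)
      (fun t _ => h1 t) ((hαc.clm_apply hℓc).intervalIntegrable 0 1)
    rw [pathIntegral]
    refine h2.trans ?_
    simp [hℓ]

/-- A closed form all of whose periods vanish has a primitive. -/
theorem IsClosedForm.exists_isPrimitive {N : ℕ} {μ : ℂ} (hμ : μ ≠ 0) {u : Fin N → ℂ}
    {α : RealForm} (hα : IsClosedForm μ u α)
    (hper : ∀ δ, IsLoop μ u δ → loopIntegral δ α = 0) : ∃ f, IsPrimitive μ u f α := by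
  classical
  have hc : IsContinuousForm μ u α := fun s ζ hs => (hα.1 s ζ hs).1.continuousOn
  have huniq : ∀ p q c d, Reach μ u α p q c → Reach μ u α p q d → c = d := by
    intro p q c d h1 h2
    have := (h1.trans hμ hc h2.symm).eq_zero hper
    linear_combination this
  -- a base point in each path component
  set cls : ℂ × ℂ → Set (ℂ × ℂ) := fun p => {q | ∃ c, Reach μ u α q p c} with hcls
  have hclseq : ∀ p q c, Reach μ u α p q c → cls p = cls q := by
    intro p q c h
    ext x
    exact ⟨fun ⟨d, hd⟩ => ⟨_, hd.trans hμ hc h⟩, fun ⟨d, hd⟩ => ⟨_, hd.trans hμ hc h.symm⟩⟩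
  set base : Set (ℂ × ℂ) → ℂ × ℂ := fun s => if h : s.Nonempty then h.some else 0 with hbase
  set f : ℂ × ℂ → ℂ := fun p =>
    if h : ∃ c, Reach μ u α (base (cls p)) p c then h.choose else 0 with hf
  have hfr : ∀ p c, Reach μ u α p p c → Reach μ u α (base (cls p)) p (f p) := by
    intro p c h
    have hne : (cls p).Nonempty := ⟨p, c, h⟩
    have h1 : ∃ c, Reach μ u α (base (cls p)) p c := by
      have : base (cls p) = hne.some := by simp only [hbase, dif_pos hne]
      rw [this]
      exact hne.some_mem
    simp only [hf, dif_pos h1]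
    exact h1.choose_spec
  have hfadd : ∀ p q c, Reach μ u α p q c → f q = f p + c := by
    intro p q c h
    have h1 := hfr p _ (h.trans hμ hc h.symm)
    have h2 := hfr q _ (h.symm.trans hμ hc h)
    rw [← hclseq p q c h] at h2
    exact huniq _ _ _ _ h2 (h1.trans hμ hc h)
  refine ⟨f, fun s ζ hs => ?_⟩
  have hd : ∀ x ∈ s, HasFDerivAt (fun x => f (x, ζ x)) (α (x, ζ x)) x := by
    intro x hx
    obtain ⟨r, hr, hrs⟩ := Metric.isOpen_iff.1 hs.1 x hx
    have hζ := hs.mono Metric.isOpen_ball hrs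
    obtain ⟨hsm, hclosed⟩ := hα.1 _ ζ hζ
    obtain ⟨g, hg⟩ := (convex_ball x r).exists_forall_hasFDerivAt_of_fderiv_symmetric
      Metric.isOpen_ball (hsm.differentiableOn (by simp)) (fun a ha v w => by
        have h1 := hclosed a ha
        set L := fderiv ℝ (fun x => α (x, ζ x)) a
        have h2 : ∀ z : ℂ, z = z.re • (1 : ℂ) + z.im • Complex.I := fun z => by
          simp [Complex.re_add_im]
        rw [h2 v, h2 w]
        simp only [map_add, map_smul, add_apply, smul_apply]
        rw [h1]
        simp only [smul_add, smul_smul]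
        rw [mul_comm v.re w.re, mul_comm v.im w.im, mul_comm v.re w.im, mul_comm v.im w.re]
        abel)
    have h2 : HasFDerivAt (fun y => f (x, ζ x) + (g y - g x)) (α (x, ζ x)) x :=
      ((hg x (Metric.mem_ball_self hr)).sub_const _).const_add _
    refine h2.congr_of_eventuallyEq ?_
    filter_upwards [Metric.ball_mem_nhds x hr] with y hy
    exact hfadd _ _ _ (reach_of_section hζ (hc _ ζ hζ) hg (Metric.mem_ball_self hr) hy)
  refine ⟨?_, hd⟩
  rw [show (1 : WithTop ℕ∞) = 0 + 1 by simp, contDiffOn_succ_iff_fderiv_of_isOpen hs.1]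
  refine ⟨fun x hx => (hd x hx).differentiableAt.differentiableWithinAt, by simp, ?_⟩
  rw [contDiffOn_zero]
  exact (hc s ζ hs).congr fun x hx => (hd x hx).fderiv

/-! ### Riemann's bilinear relation -/

theorem IsClosedForm.isContinuousForm {N : ℕ} {μ : ℂ} {u : Fin N → ℂ} {α : RealForm}
    (h : IsClosedForm μ u α) : IsContinuousForm μ u α :=
  fun s ζ hs => (h.1 s ζ hs).1.continuousOn

theorem IsClosedForm.zero {N : ℕ} (μ : ℂ) (u : Fin N → ℂ) : IsClosedForm μ u 0 := by
  refine ⟨fun s ζ _ => ⟨contDiffOn_const, fun x _ => ?_⟩, 0, fun p _ => by simp⟩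
  simp only [Pi.zero_apply, fderiv_const_apply, zero_apply]

theorem IsClosedForm.add_smul {N : ℕ} {μ : ℂ} {u : Fin N → ℂ} {α β : RealForm}
    (hα : IsClosedForm μ u α) (hβ : IsClosedForm μ u β) (c : ℂ) :
    IsClosedForm μ u (α + c • β) := by
  refine ⟨fun s ζ hs => ⟨(hα.1 s ζ hs).1.add ((hβ.1 s ζ hs).1.const_smul c), fun x hx => ?_⟩, ?_⟩
  · have h1 := ((hα.1 s ζ hs).1.differentiableOn (by simp) x hx).differentiableAt
      (hs.1.mem_nhds hx)
    have h2 := ((hβ.1 s ζ hs).1.differentiableOn (by simp) x hx).differentiableAt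
      (hs.1.mem_nhds hx)
    have h3 := (h1.hasFDerivAt.add (h2.hasFDerivAt.const_smul c)).fderiv
    have h4 : (fun x => (α + c • β) (x, ζ x)) =
      (fun x => α (x, ζ x)) + c • fun x => β (x, ζ x) := rfl
    rw [h4, h3]
    simp only [add_apply, smul_apply]
    rw [(hα.1 s ζ hs).2 x hx, (hβ.1 s ζ hs).2 x hx]
  · obtain ⟨K, hK⟩ := hα.2
    obtain ⟨L, hL⟩ := hβ.2
    refine ⟨K + ‖c‖ * L, fun p hp => ?_⟩
    calc ‖α p + c • β p‖ * ‖yCoord μ p‖ ≤ (‖α p‖ + ‖c‖ * ‖β p‖) * ‖yCoord μ p‖ := by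
          gcongr
          exact (norm_add_le _ _).trans (by rw [norm_smul])
      _ = ‖α p‖ * ‖yCoord μ p‖ + ‖c‖ * (‖β p‖ * ‖yCoord μ p‖) := by ring
      _ ≤ K * (1 + ‖p.1‖) ^ (2 * N - 2) + ‖c‖ * (L * (1 + ‖p.1‖) ^ (2 * N - 2)) := by
          exact add_le_add (hK p hp) (mul_le_mul_of_nonneg_left (hL p hp) (norm_nonneg c))
      _ = _ := by ring

theorem IsClosedForm.sum_smul {N : ℕ} {μ : ℂ} {u : Fin N → ℂ} {ι : Type*} (s : Finset ι)
    {η : ι → RealForm} (hη : ∀ i, IsClosedForm μ u (η i)) (c : ι → ℂ) :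
    IsClosedForm μ u (∑ i ∈ s, c i • η i) := by
  classical
  induction s using Finset.induction_on with
  | empty => exact IsClosedForm.zero μ u
  | insert i s hi ih =>
    rw [Finset.sum_insert hi, add_comm]
    exact ih.add_smul (hη i) _

theorem sheetSum_neg {N : ℕ} {μ : ℂ} {u : Fin N → ℂ} (F : ℂ × ℂ → ℂ) (x : ℂ) :
    sheetSum μ u (fun p => -F p) x = -sheetSum μ u F x := by
  simp only [sheetSum, finsum_neg_distrib]

theorem wedgeIntegral_swap {N : ℕ} (μ : ℂ) (u : Fin N → ℂ) (α β : RealForm) :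
    wedgeIntegral μ u β α = -wedgeIntegral μ u α β := by
  have h : ∀ x, sheetSum μ u (wedgeAt β α) x = -sheetSum μ u (wedgeAt α β) x := fun x => by
    rw [← sheetSum_neg]
    congr 1
    ext p
    simp only [wedgeAt]
    ring
  show ∫ x, sheetSum μ u (wedgeAt β α) x = -∫ x, sheetSum μ u (wedgeAt α β) x
  rw [← integral_neg]
  exact integral_congr_ae (ae_of_all _ h)

theorem IsClosedForm.integrable_wedge {N : ℕ} (hN : 2 ≤ N) {μ : ℂ} {u : Fin N → ℂ}
    (hu : IsSmoothCurve μ u) {α β : RealForm} (hα : IsClosedForm μ u α)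
    (hβ : IsClosedForm μ u β) : Integrable (sheetSum μ u (wedgeAt α β)) :=
  integrable_sheetSum_wedgeAt hN hu hα.isContinuousForm hβ.isContinuousForm hα.2 hβ.2

theorem wedgeIntegral_add_smul {N : ℕ} (hN : 2 ≤ N) {μ : ℂ} {u : Fin N → ℂ}
    (hu : IsSmoothCurve μ u) {α β γ : RealForm} (hα : IsClosedForm μ u α)
    (hβ : IsClosedForm μ u β) (hγ : IsClosedForm μ u γ) (c : ℂ) :
    wedgeIntegral μ u (α + c • β) γ = wedgeIntegral μ u α γ + c * wedgeIntegral μ u β γ := by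
  show ∫ x, sheetSum μ u (wedgeAt (α + c • β) γ) x = (∫ x, sheetSum μ u (wedgeAt α γ) x) +
    c * ∫ x, sheetSum μ u (wedgeAt β γ) x
  rw [← integral_const_mul, ← integral_add (hα.integrable_wedge hN hu hγ)
    ((hβ.integrable_wedge hN hu hγ).const_mul c)]
  refine integral_congr_ae ?_
  filter_upwards [hu.ae_mem_regularSet] with x hx
  obtain ⟨z, hz⟩ := exists_mem_curve (hu.ne_zero hN) hx
  simp only [sheetSum_eq (hu.ne_zero hN) _ hz, wedgeAt, Pi.add_apply, Pi.smul_apply, add_apply,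
    smul_apply, smul_eq_mul]
  ring

theorem wedgeIntegral_sum_smul {N : ℕ} (hN : 2 ≤ N) {μ : ℂ} {u : Fin N → ℂ}
    (hu : IsSmoothCurve μ u) {ι : Type*} (s : Finset ι) {η : ι → RealForm} {γ : RealForm}
    (hη : ∀ i, IsClosedForm μ u (η i)) (hγ : IsClosedForm μ u γ) (c : ι → ℂ) :
    wedgeIntegral μ u (∑ i ∈ s, c i • η i) γ = ∑ i ∈ s, c i * wedgeIntegral μ u (η i) γ := by
  classical
  induction s using Finset.induction_on with
  | empty => simp [wedgeIntegral]
  | insert i s hi ih =>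
    rw [Finset.sum_insert hi, add_comm, Finset.sum_insert hi, add_comm (_ * _),
      wedgeIntegral_add_smul hN hu (IsClosedForm.sum_smul s hη c) (hη i) hγ, ih]

theorem loopIntegral_add_smul {N : ℕ} {μ : ℂ} (hμ : μ ≠ 0) {u : Fin N → ℂ} {α β : RealForm}
    (hα : IsClosedForm μ u α) (hβ : IsClosedForm μ u β) (c : ℂ) {γ : ℝ → ℂ × ℂ}
    (hγ : IsLoop μ u γ) :
    loopIntegral γ (α + c • β) = loopIntegral γ α + c * loopIntegral γ β := by
  have h1 := intervalIntegrable_form hμ hα.isContinuousForm hγ.1 hγ.2.2 0 1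
  have h2 := intervalIntegrable_form hμ hβ.isContinuousForm hγ.1 hγ.2.2 0 1
  simp only [loopIntegral]
  rw [← intervalIntegral.integral_const_mul, ← intervalIntegral.integral_add h1 (h2.const_mul c)]
  rfl

theorem loopIntegral_sum_smul {N : ℕ} {μ : ℂ} (hμ : μ ≠ 0) {u : Fin N → ℂ} {ι : Type*}
    (s : Finset ι) {η : ι → RealForm} (hη : ∀ i, IsClosedForm μ u (η i)) (c : ι → ℂ)
    {γ : ℝ → ℂ × ℂ} (hγ : IsLoop μ u γ) :
    loopIntegral γ (∑ i ∈ s, c i • η i) = ∑ i ∈ s, c i * loopIntegral γ (η i) := by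
  classical
  induction s using Finset.induction_on with
  | empty => simp [loopIntegral]
  | insert i s hi ih =>
    rw [Finset.sum_insert hi, add_comm, Finset.sum_insert hi, add_comm (_ * _),
      loopIntegral_add_smul hμ (IsClosedForm.sum_smul s hη c) (hη i) _ hγ, ih]

/-- The real form of the differential `φ dx`. -/
def holForm (φ : Differential) : RealForm := fun p => φ p • ContinuousLinearMap.id ℝ ℂ

/-- The complex conjugate of the differential `φ dx`. -/
def conjForm (φ : Differential) : RealForm := fun p =>
  (starRingEnd ℂ (φ p)) • (Complex.conjCLE : ℂ →L[ℝ] ℂ)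

theorem IsHolomorphic.isClosedForm_holForm {N : ℕ} {μ : ℂ} {u : Fin N → ℂ} {φ : Differential}
    (hφ : IsHolomorphic μ u φ) : IsClosedForm μ u (holForm φ) := by
  refine ⟨fun s ζ hs => ?_, ?_⟩
  · have h1 : ContDiffOn ℝ ∞ (fun x => φ (x, ζ x)) s :=
      ((hφ.1 s ζ hs).contDiffOn hs.1).restrict_scalars ℝ
    refine ⟨h1.smul contDiffOn_const, fun x hx => ?_⟩
    have h2 := (((hφ.1 s ζ hs) x hx).differentiableAt (hs.1.mem_nhds hx)).hasDerivAt
    have h3 := (h2.complexToReal_fderiv.smul_const (ContinuousLinearMap.id ℝ ℂ)).fderiv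
    simp only [holForm]
    rw [h3]
    simp
  · obtain ⟨K, hK⟩ := hφ.2
    refine ⟨K, fun p hp => ?_⟩
    rw [holForm, norm_smul, ContinuousLinearMap.norm_id, mul_one]
    exact hK p hp

theorem IsHolomorphic.isClosedForm_conjForm {N : ℕ} {μ : ℂ} {u : Fin N → ℂ} {φ : Differential}
    (hφ : IsHolomorphic μ u φ) : IsClosedForm μ u (conjForm φ) := by
  refine ⟨fun s ζ hs => ?_, ?_⟩
  · have h1 : ContDiffOn ℝ ∞ (fun x => φ (x, ζ x)) s :=
      ((hφ.1 s ζ hs).contDiffOn hs.1).restrict_scalars ℝ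
    have h1' : ContDiffOn ℝ ∞ (fun x => Complex.conjCLE (φ (x, ζ x))) s :=
      Complex.conjCLE.contDiff.comp_contDiffOn h1
    refine ⟨h1'.smul contDiffOn_const, fun x hx => ?_⟩
    have h2 := (((hφ.1 s ζ hs) x hx).differentiableAt (hs.1.mem_nhds hx)).hasDerivAt
    have h3 := ((Complex.conjCLE.hasFDerivAt.comp x h2.complexToReal_fderiv).smul_const
      (Complex.conjCLE : ℂ →L[ℝ] ℂ)).fderiv
    have h4 : (fun x => conjForm φ (x, ζ x)) = fun y => (Complex.conjCLE ∘ fun x => φ (x, ζ x)) y •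
      (Complex.conjCLE : ℂ →L[ℝ] ℂ) := rfl
    rw [h4, h3]
    simp
  · obtain ⟨K, hK⟩ := hφ.2
    refine ⟨K, fun p hp => ?_⟩
    rw [conjForm, norm_smul, Complex.conjCLE_norm, mul_one, RCLike.norm_conj]
    exact hK p hp

theorem loopIntegral_holForm (γ : ℝ → ℂ × ℂ) (φ : Differential) :
    loopIntegral γ (holForm φ) = period γ φ := rfl

theorem loopIntegral_conjForm (γ : ℝ → ℂ × ℂ) (φ : Differential) :
    loopIntegral γ (conjForm φ) = starRingEnd ℂ (period γ φ) := by
  rw [period, ← intervalIntegral.intervalIntegral_conj]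
  simp [loopIntegral, conjForm]

theorem periodic_deriv {f : ℝ → ℂ} (hf : Function.Periodic f 1) :
    Function.Periodic (deriv f) 1 := fun t => by
  have h1 : (fun s => f (s + 1)) = f := funext hf
  have h2 := deriv_comp_add_const (f := f) 1 t
  rw [h1] at h2
  exact h2.symm

/-- An odd differential has the same periods along `γ` and `-σ₂(γ)`. -/
theorem period_revLoop_sigma2Loop {N : ℕ} {μ : ℂ} {u : Fin N → ℂ} {γ : ℝ → ℂ × ℂ}
    (h : IsLoop μ u γ) {φ : Differential} (hφ : ∀ p, φ (sigma2 p) = φ p) :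
    period (revLoop (sigma2Loop γ)) φ = period γ φ := by
  set g : ℝ → ℂ := fun t => φ (γ t) * deriv (fun s => (γ s).1) t with hg
  have hper : Function.Periodic g 1 := fun t => by
    have h1 : Function.Periodic (fun s => (γ s).1) 1 := fun s => by
      show (γ (s + 1)).1 = _
      rw [h.2.1 s]
    show φ (γ (t + 1)) * deriv (fun s => (γ s).1) (t + 1) = _
    rw [h.2.1 t, periodic_deriv h1 t]
  have h2 : ∀ t, φ (revLoop (sigma2Loop γ) t) *
      deriv (fun s => (revLoop (sigma2Loop γ) s).1) t = g (-t) := by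
    intro t
    have h3 : deriv (fun s => (revLoop (sigma2Loop γ) s).1) t = deriv (fun s => (γ s).1) (-t) := by
      have h4 : (fun s => (revLoop (sigma2Loop γ) s).1) = fun s => -(fun s => (γ s).1) (-s) := rfl
      rw [h4, deriv.fun_neg, deriv_comp_neg (f := fun s => (γ s).1), neg_neg]
    rw [h3]
    simp only [hg, revLoop, sigma2Loop, hφ]
  rw [period]
  simp only [h2]
  rw [intervalIntegral.integral_comp_neg g, neg_zero]
  have h5 := hper.intervalIntegral_add_eq (-1) 0
  simpa [period, hg] using h5

/-- If a holomorphic differential satisfies `∬ ω ∧ ω̄ = 0`, then it vanishes almost everywhere: the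
integrand is `-2i (|φ|² + |φ ∘ τ|²)`. -/
theorem IsHolomorphic.ae_eq_zero_of_wedgeIntegral_eq_zero {N : ℕ} (hN : 2 ≤ N) {μ : ℂ}
    {u : Fin N → ℂ} (hu : IsSmoothCurve μ u) {φ : Differential} (hφ : IsHolomorphic μ u φ)
    (h0 : wedgeIntegral μ u (holForm φ) (conjForm φ) = 0) :
    ∀ᵐ x : ℂ, ∀ z, (x, z) ∈ curve μ u → φ (x, z) = 0 := by
  have hμ := hu.ne_zero hN
  set F : ℂ → ℂ := sheetSum μ u (wedgeAt (holForm φ) (conjForm φ)) with hF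
  have hint : Integrable F :=
    hφ.isClosedForm_holForm.integrable_wedge hN hu hφ.isClosedForm_conjForm
  have hw : ∀ p, wedgeAt (holForm φ) (conjForm φ) p =
      -(2 * Complex.I) * (Complex.normSq (φ p) : ℂ) := fun p => by
    rw [Complex.normSq_eq_conj_mul_self]
    simp only [wedgeAt, holForm, conjForm, smul_apply, ContinuousLinearMap.id_apply, smul_eq_mul,
      ContinuousLinearEquiv.coe_coe, Complex.conjCLE_apply, Complex.conj_I, map_one]
    ring
  have hF' : ∀ p ∈ curve μ u, F p.1 = -(2 * Complex.I) *
      ((Complex.normSq (φ p) + Complex.normSq (φ (tau μ p)) : ℝ) : ℂ) := fun p hp => by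
    rw [hF, sheetSum_eq hμ _ hp, hw, hw]
    push_cast
    ring
  have hnn : 0 ≤ᵐ[volume] fun x => -(F x).im := by
    filter_upwards [hu.ae_mem_regularSet] with x hx
    obtain ⟨z, hz⟩ := exists_mem_curve hμ hx
    have := hF' _ hz
    simp only at this
    rw [this]
    have h1 := Complex.normSq_nonneg (φ (x, z))
    have h2 := Complex.normSq_nonneg (φ (tau μ (x, z)))
    simp [-Complex.ofReal_add]
    linarith
  have hi : ∫ x, -(F x).im = 0 := by
    rw [integral_neg]
    have h1 : ∫ x, (F x).im = (∫ x, F x).im := integral_im (𝕜 := ℂ) hint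
    rw [h1]
    have h2 : ∫ x, F x = 0 := h0
    simp [h2]
  have hz := (integral_eq_zero_iff_of_nonneg_ae hnn hint.im.neg).1 hi
  filter_upwards [hz] with x hx z hxz
  have h1 := hF' _ hxz
  simp only at h1
  have h2 : -(F x).im = 0 := hx
  rw [h1] at h2
  have h3 := Complex.normSq_nonneg (φ (x, z))
  have h4 := Complex.normSq_nonneg (φ (tau μ (x, z)))
  simp [-Complex.ofReal_add] at h2
  exact Complex.normSq_eq_zero.1 (by linarith)

theorem eq_zero_of_oddDiff_ae_eq_zero {N : ℕ} (hN : 2 ≤ N) {μ : ℂ} {u : Fin N → ℂ}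
    (hu : IsSmoothCurve μ u) {c : Fin N → ℂ}
    (h : ∀ᵐ x : ℂ, ∀ z, (x, z) ∈ curve μ u → oddDiff μ c (x, z) = 0) : c = 0 := by
  set P : ℂ[X] := ∑ i : Fin N, C (c i) * X ^ (2 * (i : ℕ)) with hP
  have hae : ∀ᵐ x : ℂ, P.IsRoot x := by
    filter_upwards [h, hu.ae_mem_regularSet] with x hx hr
    obtain ⟨z, hz⟩ := exists_mem_curve (hu.ne_zero hN) hr
    have h1 := hx z hz
    rw [oddDiff, div_eq_zero_iff, or_iff_left (yCoord_ne_zero hz)] at h1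
    simpa [hP, IsRoot, eval_finsetSum] using h1
  have hP0 : P = 0 := by
    refine eq_zero_of_infinite_isRoot P fun hfin => ?_
    have h1 : volume {x | P.IsRoot x}ᶜ = 0 := mem_ae_iff.1 hae
    have h2 : volume (Set.univ : Set ℂ) = 0 := by
      rw [← Set.union_compl_self {x | P.IsRoot x}]
      exact measure_union_null (hfin.measure_zero _) h1
    exact (isOpen_univ.measure_pos volume Set.univ_nonempty).ne' h2
  ext i
  have h3 := congrArg (fun q : ℂ[X] => q.coeff (2 * (i : ℕ))) hP0
  simp only [hP, finsetSum_coeff, coeff_C_mul, coeff_X_pow, coeff_zero] at h3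
  rw [Finset.sum_eq_single i (fun j _ hj => by
    rw [if_neg (fun h => hj (Fin.ext (by omega))), mul_zero]) (by simp)] at h3
  simpa using h3

/-- A holomorphic differential `ω` whose periods along the cycles `a i` of a symplectic basis vanish
satisfies `∬ ω ∧ ω̄ = 0`. A combination `ψ` of the Poincaré duals `η i` of the `a i` has the same
periods as `ω`, so that `ω - ψ` is exact and `∬ (ω - ψ) ∧ ω̄ = 0` by Stokes' theorem; and
`∬ η i ∧ ω̄` is a period of `ω̄` along `a i`. -/
theorem IsSymplecticBasis.wedgeIntegral_eq_zero {N : ℕ} (hN : 2 ≤ N) {μ : ℂ} {u : Fin N → ℂ}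
    (hu : IsSmoothCurve μ u) {ι : Type} [Fintype ι] [DecidableEq ι] {a b : ι → ℝ → ℂ × ℂ}
    (h : IsSymplecticBasis μ u a b) {φ : Differential} (hφ : IsHolomorphic μ u φ)
    (h0 : ∀ i, period (a i) φ = 0) : wedgeIntegral μ u (holForm φ) (conjForm φ) = 0 := by
  have hμ := hu.ne_zero hN
  choose η θ hη hθ hηθ using fun i => h.inter_aa i i
  -- the periods of the Poincaré duals of the cycles `a i`
  have ha : ∀ i k, loopIntegral (a k) (η i) = 0 := by
    intro i k
    obtain ⟨η', θ', h1, h2, h3⟩ := h.inter_aa i k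
    rw [h2.2 _ (hη i).1, wedgeIntegral_swap, ← (hη i).2 _ h2.1, h1.2 _ h2.1, wedgeIntegral_swap,
      h3]
    simp
  have hb : ∀ i k, loopIntegral (b k) (η i) = if i = k then 1 else 0 := by
    intro i k
    obtain ⟨η', θ', h1, h2, h3⟩ := h.inter_ab i k
    rw [h2.2 _ (hη i).1, wedgeIntegral_swap, ← (hη i).2 _ h2.1, h1.2 _ h2.1, wedgeIntegral_swap,
      h3]
    split_ifs <;> simp
  have hω := hφ.isClosedForm_holForm
  have hη' : ∀ i, IsClosedForm μ u (η i) := fun i => (hη i).1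
  set β : ι → ℂ := fun i => period (b i) φ with hβ
  set ψ : RealForm := ∑ i, β i • η i with hψ
  have hψc : IsClosedForm μ u ψ := IsClosedForm.sum_smul _ hη' β
  have hdiff : IsClosedForm μ u (holForm φ + (-1 : ℂ) • ψ) := hω.add_smul hψc (-1)
  have hper : ∀ δ, IsLoop μ u δ → loopIntegral δ (holForm φ + (-1 : ℂ) • ψ) = 0 := by
    intro δ hδ
    have h1 : ∀ k, loopIntegral (a k) (holForm φ + (-1 : ℂ) • ψ) = 0 := fun k => by
      rw [loopIntegral_add_smul hμ hω hψc _ (h.isLoop_a k), hψ,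
        loopIntegral_sum_smul hμ _ hη' β (h.isLoop_a k), loopIntegral_holForm, h0]
      simp [ha]
    have h2 : ∀ k, loopIntegral (b k) (holForm φ + (-1 : ℂ) • ψ) = 0 := fun k => by
      rw [loopIntegral_add_smul hμ hω hψc _ (h.isLoop_b k), hψ,
        loopIntegral_sum_smul hμ _ hη' β (h.isLoop_b k), loopIntegral_holForm]
      simp [hb, hβ]
    obtain ⟨n, hn⟩ := h.generate δ hδ
    rw [hn _ hdiff, Fintype.sum_sum_type]
    simp [h1, h2]
  obtain ⟨f, hf⟩ := hdiff.exists_isPrimitive hμ hper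
  have h1 : wedgeIntegral μ u (holForm φ + (-1 : ℂ) • ψ) (conjForm φ) = 0 :=
    hf.integral_wedgeAt_eq_zero hN hu hdiff.2 hφ.isClosedForm_conjForm
  rw [wedgeIntegral_add_smul hN hu hω hψc hφ.isClosedForm_conjForm, hψ,
    wedgeIntegral_sum_smul hN hu _ hη' hφ.isClosedForm_conjForm] at h1
  have h2 : ∀ i, wedgeIntegral μ u (η i) (conjForm φ) = 0 := fun i => by
    rw [wedgeIntegral_swap, ← (hη i).2 _ hφ.isClosedForm_conjForm, loopIntegral_conjForm, h0]
    simp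
  simpa [h2] using h1

/-- Odd holomorphic differentials are determined by their periods along `A_1, …, A_N`, since these
periods are also the periods along the cycles `-σ₂(A_j)` of the symplectic basis. -/
theorem IsPrymCycles.eq_zero_of_period_eq_zero {N : ℕ} (hN : 2 ≤ N) {μ : ℂ} {u : Fin N → ℂ}
    (hu : IsSmoothCurve μ u) {A B : Fin N → ℝ → ℂ × ℂ} (h : IsPrymCycles μ u A B)
    {c : Fin N → ℂ} (h0 : ∀ j, period (A j) (oddDiff μ c) = 0) : c = 0 := by
  have hφ := isHolomorphic_oddDiff μ u c
  refine eq_zero_of_oddDiff_ae_eq_zero hN hu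
    (hφ.ae_eq_zero_of_wedgeIntegral_eq_zero hN hu ?_)
  refine h.symplectic.wedgeIntegral_eq_zero hN hu hφ ?_
  rintro (j | j)
  · exact h0 j
  · exact (period_revLoop_sigma2Loop (h.symplectic.isLoop_a (Sum.inl _))
      (oddDiff_sigma2 μ c)).trans (h0 _)

/-! ### Derivatives of the periods with respect to the moduli -/

theorem continuousOn_intervalIntegral_of_continuousOn {E G : Type*} [TopologicalSpace E]
    [FirstCountableTopology E] [NormedAddCommGroup G] [NormedSpace ℝ G] {U : Set E}
    {F : E × ℝ → G} (hF : ContinuousOn F (U ×ˢ Set.univ)) :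
    ContinuousOn (fun u => ∫ t in (0 : ℝ)..1, F (u, t)) U := by
  rw [continuousOn_iff_continuous_domRestrict]
  refine intervalIntegral.continuous_parametric_intervalIntegral_of_continuous'
    (f := fun (u : U) t => F (u, t)) ?_ 0 1
  exact hF.comp_continuous (by fun_prop) fun q => ⟨q.1.2, trivial⟩

/-- Differentiation under the integral sign. -/
theorem hasFDerivAt_intervalIntegral_of_contDiffOn {E : Type*} [NormedAddCommGroup E]
    [NormedSpace ℝ E] [ProperSpace E] {U : Set E} (hU : IsOpen U) {F : E × ℝ → ℂ}
    (hF : ContDiffOn ℝ 1 F (U ×ˢ Set.univ)) {u : E} (hu : u ∈ U) :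
    HasFDerivAt (fun u => ∫ t in (0 : ℝ)..1, F (u, t))
      (∫ t in (0 : ℝ)..1, (fderiv ℝ F (u, t)).comp (ContinuousLinearMap.inl ℝ E ℝ)) u := by
  have hUo : IsOpen (U ×ˢ (Set.univ : Set ℝ)) := hU.prod isOpen_univ
  have hd : ContinuousOn (fun q => (fderiv ℝ F q).comp (ContinuousLinearMap.inl ℝ E ℝ))
      (U ×ˢ Set.univ) := (hF.continuousOn_fderiv_of_isOpen hUo le_rfl).clm_comp continuousOn_const
  obtain ⟨r, hr, hrU⟩ := Metric.nhds_basis_closedBall.mem_iff.1 (hU.mem_nhds hu)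
  obtain ⟨C, hC⟩ := ((isCompact_closedBall u r).prod (isCompact_Icc (a := (0 : ℝ)) (b := 1))
    ).exists_bound_of_continuousOn (hd.mono (Set.prod_mono hrU (Set.subset_univ _)))
  have hsub : ∀ {v}, v ∈ Metric.ball u r → v ∈ U := fun hv => hrU (Metric.ball_subset_closedBall hv)
  have hct : ∀ {v}, v ∈ U → Continuous fun t : ℝ => F (v, t) := fun hv =>
    hF.continuousOn.comp_continuous (by fun_prop) fun t => ⟨hv, trivial⟩
  refine intervalIntegral.hasFDerivAt_integral_of_dominated_of_fderiv_le (bound := fun _ => C)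
    (F := fun u t => F (u, t))
    (F' := fun v t => (fderiv ℝ F (v, t)).comp (ContinuousLinearMap.inl ℝ E ℝ))
    (Metric.ball_mem_nhds u hr) ?_ ((hct hu).intervalIntegrable 0 1) ?_ ?_ (by simp) ?_
  · filter_upwards [Metric.ball_mem_nhds u hr] with v hv
    exact (hct (hsub hv)).aestronglyMeasurable
  · exact Continuous.aestronglyMeasurable
      (hd.comp_continuous (by fun_prop) fun t => ⟨hu, trivial⟩)
  · refine ae_of_all _ fun t ht v hv => hC (v, t) ⟨Metric.ball_subset_closedBall hv, ?_⟩
    rw [Set.uIoc_of_le zero_le_one] at ht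
    exact ⟨ht.1.le, ht.2⟩
  · refine ae_of_all _ fun t _ v hv => ?_
    have h1 : HasFDerivAt F (fderiv ℝ F (v, t)) (v, t) :=
      ((hF.differentiableOn one_ne_zero).differentiableAt
        (hUo.mem_nhds ⟨hsub hv, trivial⟩)).hasFDerivAt
    exact h1.comp v (hasFDerivAt_prodMk_left v t)

/-- Variation of the integral of the one-form `G dz` along a family of closed paths: the derivative
is the integral of the contraction of `dG ∧ dz`. The rest of the derivative of the integrand is a
total derivative in `t`, which integrates to zero over a period. -/
theorem exists_hasFDerivAt_integral_mul_fderiv {E : Type*} [NormedAddCommGroup E]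
    [NormedSpace ℝ E] [ProperSpace E] {U : Set E} (hU : IsOpen U) {G z : E × ℝ → ℂ}
    (hG : ContDiffOn ℝ ∞ G (U ×ˢ Set.univ)) (hz : ContDiffOn ℝ ∞ z (U ×ˢ Set.univ))
    (hGp : ∀ u ∈ U, ∀ t, G (u, t + 1) = G (u, t)) (hzp : ∀ u ∈ U, ∀ t, z (u, t + 1) = z (u, t)) :
    ∃ L : E → E →L[ℝ] ℂ, ContinuousOn L U ∧ ∀ u ∈ U,
      HasFDerivAt (fun u => ∫ t in (0 : ℝ)..1, G (u, t) * fderiv ℝ z (u, t) (0, 1)) (L u) u ∧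
      ∀ v, L u v = ∫ t in (0 : ℝ)..1, (fderiv ℝ G (u, t) (v, 0) * fderiv ℝ z (u, t) (0, 1) -
        fderiv ℝ G (u, t) (0, 1) * fderiv ℝ z (u, t) (v, 0)) := by
  have hUo : IsOpen (U ×ˢ (Set.univ : Set ℝ)) := hU.prod isOpen_univ
  have hdz : ContDiffOn ℝ ∞ (fderiv ℝ z) (U ×ˢ Set.univ) := hz.fderiv_of_isOpen hUo (by simp)
  set F : E × ℝ → ℂ := fun q => G q * fderiv ℝ z q (0, 1) with hF
  have hFs : ContDiffOn ℝ ∞ F (U ×ˢ Set.univ) := hG.mul (hdz.clm_apply contDiffOn_const)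
  have hFd := (hFs.of_le (m := 1) (by simp)).continuousOn_fderiv_of_isOpen hUo le_rfl
  refine ⟨fun u => ∫ t in (0 : ℝ)..1, (fderiv ℝ F (u, t)).comp (ContinuousLinearMap.inl ℝ E ℝ),
    continuousOn_intervalIntegral_of_continuousOn
      (F := fun q => (fderiv ℝ F q).comp (ContinuousLinearMap.inl ℝ E ℝ))
      (hFd.clm_comp continuousOn_const), fun u hu =>
    ⟨hasFDerivAt_intervalIntegral_of_contDiffOn hU (hFs.of_le (by simp)) hu, fun v => ?_⟩⟩
  have hmem : ∀ t : ℝ, (u, t) ∈ U ×ˢ (Set.univ : Set ℝ) := fun t => ⟨hu, trivial⟩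
  have hpath : Continuous fun t : ℝ => (u, t) := by fun_prop
  have hF1 : Continuous fun t => (fderiv ℝ F (u, t)).comp (ContinuousLinearMap.inl ℝ E ℝ) :=
    (hFd.comp_continuous hpath hmem).clm_comp continuous_const
  rw [ContinuousLinearMap.intervalIntegral_apply (hF1.intervalIntegrable 0 1)]
  have dG : ∀ t, HasFDerivAt G (fderiv ℝ G (u, t)) (u, t) := fun t =>
    ((hG.differentiableOn (by simp)).differentiableAt (hUo.mem_nhds (hmem t))).hasFDerivAt
  have ddz : ∀ t, HasFDerivAt (fderiv ℝ z) (fderiv ℝ (fderiv ℝ z) (u, t)) (u, t) := fun t =>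
    ((hdz.differentiableOn (by simp)).differentiableAt (hUo.mem_nhds (hmem t))).hasFDerivAt
  have hsymm : ∀ t, IsSymmSndFDerivAt ℝ z (u, t) := fun t =>
    ((hz.contDiffAt (hUo.mem_nhds (hmem t))).of_le (m := 2)
      (WithTop.coe_le_coe.2 (le_top : (2 : ℕ∞) ≤ ⊤))).isSymmSndFDerivAt (by simp)
  -- the total derivative that makes up the difference
  set H : ℝ → ℂ := fun t => G (u, t) * fderiv ℝ z (u, t) (v, 0) with hH
  have dline : ∀ t, HasDerivAt (fun t : ℝ => (u, t)) ((0 : E), (1 : ℝ)) t := fun t =>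
    (hasDerivAt_const t u).prodMk (hasDerivAt_id t)
  have dH : ∀ t, HasDerivAt H (fderiv ℝ G (u, t) (0, 1) * fderiv ℝ z (u, t) (v, 0) +
      G (u, t) * fderiv ℝ (fderiv ℝ z) (u, t) (0, 1) (v, 0)) t := by
    intro t
    have h1 := (dG t).comp_hasDerivAt t (dline t)
    have h2 := ((ddz t).comp_hasDerivAt t (dline t)).clm_apply (hasDerivAt_const t ((v, 0) : E × ℝ))
    refine (h1.mul h2).congr_deriv ?_
    simp
  have hval : ∀ t, ((fderiv ℝ F (u, t)).comp (ContinuousLinearMap.inl ℝ E ℝ)) v =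
      (fderiv ℝ G (u, t) (v, 0) * fderiv ℝ z (u, t) (0, 1) -
        fderiv ℝ G (u, t) (0, 1) * fderiv ℝ z (u, t) (v, 0)) +
      (fderiv ℝ G (u, t) (0, 1) * fderiv ℝ z (u, t) (v, 0) +
        G (u, t) * fderiv ℝ (fderiv ℝ z) (u, t) (0, 1) (v, 0)) := by
    intro t
    have h1 := ((dG t).mul ((ddz t).clm_apply (hasFDerivAt_const ((0, 1) : E × ℝ) (u, t)))).fderiv
    have h2 := (hsymm t).eq (v, 0) (0, 1)
    rw [ContinuousLinearMap.comp_apply, ContinuousLinearMap.inl_apply]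
    have h3 : F = G * fun q => fderiv ℝ z q (0, 1) := rfl
    rw [h3, h1]
    simp only [add_apply, smul_apply, smul_eq_mul, ContinuousLinearMap.comp_apply,
      ContinuousLinearMap.flip_apply, zero_apply, map_zero, zero_add, h2]
    ring
  have cG : Continuous fun t => fderiv ℝ G (u, t) :=
    (hG.continuousOn_fderiv_of_isOpen hUo (by simp)).comp_continuous hpath hmem
  have cz : Continuous fun t => fderiv ℝ z (u, t) := hdz.continuousOn.comp_continuous hpath hmem
  have cdz : Continuous fun t => fderiv ℝ (fderiv ℝ z) (u, t) :=
    (hdz.continuousOn_fderiv_of_isOpen hUo (by simp)).comp_continuous hpath hmem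
  have cG0 : Continuous fun t => G (u, t) := hG.continuousOn.comp_continuous hpath hmem
  have c1 : ∀ w, Continuous fun t => fderiv ℝ G (u, t) w := fun w => cG.clm_apply continuous_const
  have c2 : ∀ w, Continuous fun t => fderiv ℝ z (u, t) w := fun w => cz.clm_apply continuous_const
  have c3 : Continuous fun t => fderiv ℝ (fderiv ℝ z) (u, t) (0, 1) (v, 0) :=
    (cdz.clm_apply continuous_const).clm_apply continuous_const
  have c4 : Continuous fun t => fderiv ℝ G (u, t) (0, 1) * fderiv ℝ z (u, t) (v, 0) +
      G (u, t) * fderiv ℝ (fderiv ℝ z) (u, t) (0, 1) (v, 0) :=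
    ((c1 (0, 1)).mul (c2 (v, 0))).add (cG0.mul c3)
  have c5 : Continuous fun t => fderiv ℝ G (u, t) (v, 0) * fderiv ℝ z (u, t) (0, 1) -
      fderiv ℝ G (u, t) (0, 1) * fderiv ℝ z (u, t) (v, 0) :=
    ((c1 (v, 0)).mul (c2 (0, 1))).sub ((c1 (0, 1)).mul (c2 (v, 0)))
  simp only [hval]
  rw [intervalIntegral.integral_add
    (c5.intervalIntegrable 0 1) (c4.intervalIntegrable 0 1),
    intervalIntegral.integral_eq_sub_of_hasDerivAt (fun t _ => dH t)
      (c4.intervalIntegrable 0 1), add_eq_left, sub_eq_zero]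
  have hzfd : fderiv ℝ z (u, (1 : ℝ)) = fderiv ℝ z (u, (0 : ℝ)) := by
    have h1 : (fun q : E × ℝ => z (q + (0, 1))) =ᶠ[𝓝 (u, (0 : ℝ))] z := by
      filter_upwards [hUo.mem_nhds (hmem 0)] with q hq
      rw [show q + (0, 1) = (q.1, q.2 + 1) by ext <;> simp, hzp _ hq.1]
    have h2 := h1.fderiv_eq (𝕜 := ℝ)
    rw [fderiv_comp_add_right] at h2
    simpa using h2
  have h4 : G (u, 1) = G (u, 0) := by simpa using hGp u hu 0
  simp only [hH, h4, hzfd]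

theorem hasFDerivAt_prod_of_partial {E : Type*} [NormedAddCommGroup E] [NormedSpace ℂ E]
    {f : E × ℂ → ℂ} {u : E} {x : ℂ} (hf : DifferentiableAt ℂ f (u, x)) {A : E →L[ℂ] ℂ} {b : ℂ}
    (hA : HasFDerivAt (fun u => f (u, x)) A u) (hb : HasDerivAt (fun x => f (u, x)) b x) :
    ∀ v w, fderiv ℂ f (u, x) (v, w) = A v + b * w := by
  intro v w
  have h1 := (hf.hasFDerivAt.comp u (hasFDerivAt_prodMk_left u x)).unique hA
  have h2 := (hf.hasFDerivAt.comp_hasDerivAt x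
    ((hasDerivAt_const x u).prodMk (hasDerivAt_id x))).unique hb
  have h3 : ((v, w) : E × ℂ) = (v, 0) + w • (0, 1) := by simp
  rw [h3, map_add, map_smul, ← h1, ← h2, smul_eq_mul, mul_comm]
  rfl

theorem contDiff_eval_R (N n : ℕ) :
    ContDiff ℂ ω (fun q : (Fin N → ℂ) × ℂ => (R q.1 n).eval q.2) := by
  simp only [R, eval_finsetSum, eval_mul, eval_C, eval_pow, eval_X]
  refine ContDiff.sum fun k _ => ?_
  exact ((contDiff_coeff_powSeries _ k).comp contDiff_fst).mul (contDiff_snd.pow _)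

theorem fderiv_eval_R {N : ℕ} (n : ℕ) (u v : Fin N → ℂ) (x w : ℂ) :
    fderiv ℂ (fun q : (Fin N → ℂ) × ℂ => (R q.1 n).eval q.2) (u, x) (v, w) =
      (RDot u v n).eval x + (derivative (R u n)).eval x * w := by
  set A : (Fin N → ℂ) →L[ℂ] ℂ := ∑ k ∈ Finset.range (2 * n),
    x ^ (2 * n - 1 - k) •
      fderiv ℂ (fun u : Fin N → ℂ => PowerSeries.coeff k (powSeries u (rExp N n))) u with hA
  have h1 : HasFDerivAt (fun u : Fin N → ℂ => (R u n).eval x) A u := by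
    simp only [R, eval_finsetSum, eval_mul, eval_C, eval_pow, eval_X, hA]
    refine HasFDerivAt.fun_sum fun k _ => ?_
    have h2 := ((contDiff_coeff_powSeries (N := N) (rExp N n) k).differentiable
      (by simp) u).hasFDerivAt
    exact h2.mul_const _
  rw [hasFDerivAt_prod_of_partial (f := fun q : (Fin N → ℂ) × ℂ => (R q.1 n).eval q.2)
    ((contDiff_eval_R N n).differentiable (by simp) _) h1 ((R u n).hasDerivAt x)]
  congr 1
  simp only [hA, RDot, eval_finsetSum, eval_mul, eval_C, eval_pow, eval_X, sum_apply, smul_apply,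
    fderiv_coeff_powSeries, smul_eq_mul]
  exact Finset.sum_congr rfl fun k _ => mul_comm _ _

theorem W_eq_sub {N : ℕ} (u : Fin N → ℂ) (x : ℂ) :
    W u x = (x ^ 2)⁻¹ * ((x ^ 2) ^ N - ∑ j : Fin N, u j * (x ^ 2) ^ (N - 1 - (j : ℕ))) := by
  simp [W, Q, eval_finsetSum]

theorem contDiffAt_W {N : ℕ} (u : Fin N → ℂ) {x : ℂ} (hx : x ≠ 0) :
    ContDiffAt ℂ ω (fun q : (Fin N → ℂ) × ℂ => W q.1 q.2) (u, x) := by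
  simp only [W_eq_sub]
  have h1 : ContDiff ℂ ω (fun q : (Fin N → ℂ) × ℂ => q.2 ^ 2) := contDiff_snd.pow 2
  refine (h1.contDiffAt.inv (pow_ne_zero 2 hx)).mul (ContDiff.contDiffAt ?_)
  refine (h1.pow N).sub (ContDiff.sum fun j _ => ?_)
  exact ((contDiff_apply ℂ ℂ j).comp contDiff_fst).mul (h1.pow _)

theorem differentiableAt_W {N : ℕ} (u : Fin N → ℂ) {x : ℂ} (hx : x ≠ 0) :
    DifferentiableAt ℂ (W u) x := by
  have h1 : DifferentiableAt ℂ (fun q : (Fin N → ℂ) × ℂ => W q.1 q.2) (u, x) :=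
    (contDiffAt_W u hx).differentiableAt (by simp)
  exact h1.comp x (f := fun x => (u, x)) (by fun_prop)

theorem W_add {N : ℕ} (u v : Fin N → ℂ) (x : ℂ) : W (u + v) x = W u x + WDot v x := by
  simp only [W_eq_sub, WDot, Pi.add_apply, add_mul, Finset.sum_add_distrib]
  ring

/-- `WDot v x` as a linear function of `v`. -/
def WDotCLM {N : ℕ} (x : ℂ) : (Fin N → ℂ) →L[ℂ] ℂ :=
  -((x ^ 2)⁻¹ • ∑ j : Fin N, (x ^ 2) ^ (N - 1 - (j : ℕ)) • ContinuousLinearMap.proj j)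

theorem WDotCLM_apply {N : ℕ} (v : Fin N → ℂ) (x : ℂ) : WDotCLM x v = WDot v x := by
  simp only [WDotCLM, WDot, neg_apply, smul_apply, sum_apply, ContinuousLinearMap.proj_apply,
    smul_eq_mul]
  congr 2
  exact Finset.sum_congr rfl fun k _ => mul_comm _ _

theorem fderiv_W {N : ℕ} (u v : Fin N → ℂ) {x : ℂ} (hx : x ≠ 0) (w : ℂ) :
    fderiv ℂ (fun q : (Fin N → ℂ) × ℂ => W q.1 q.2) (u, x) (v, w) =
      WDot v x + deriv (W u) x * w := by
  have h1 : HasFDerivAt (fun u : Fin N → ℂ => W u x) (WDotCLM x) u := by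
    have h2 : (fun u : Fin N → ℂ => W u x) = fun u => W 0 x + WDotCLM x u := funext fun u => by
      rw [WDotCLM_apply, ← W_add, zero_add]
    rw [h2]
    exact (WDotCLM x).hasFDerivAt.const_add _
  rw [hasFDerivAt_prod_of_partial (f := fun q : (Fin N → ℂ) × ℂ => W q.1 q.2)
    ((contDiffAt_W u hx).differentiableAt (by simp)) h1 (differentiableAt_W u hx).hasDerivAt,
    WDotCLM_apply]

theorem eval_RDot_smul {N : ℕ} (n : ℕ) (u v : Fin N → ℂ) (c x : ℂ) :
    (RDot u (c • v) n).eval x = c * (RDot u v n).eval x := by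
  have h := (fderiv ℂ (fun q : (Fin N → ℂ) × ℂ => (R q.1 n).eval q.2) (u, x)).map_smul c (v, 0)
  rw [Prod.smul_mk, smul_zero, fderiv_eval_R, fderiv_eval_R] at h
  simpa using h

theorem eval_RDot_zero {N : ℕ} (n : ℕ) (u : Fin N → ℂ) (x : ℂ) : (RDot u 0 n).eval x = 0 := by
  simpa using eval_RDot_smul n u 0 0 x

theorem dOmegaHatDot_smul {N : ℕ} (μ : ℂ) (u v : Fin N → ℂ) (n : ℕ) (c : ℂ) (p : ℂ × ℂ) :
    dOmegaHatDot μ u (c • v) n p = c * dOmegaHatDot μ u v n p := by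
  rw [dOmegaHatDot, dOmegaHatDot, eval_RDot_smul, ← WDotCLM_apply, ← WDotCLM_apply, map_smul,
    smul_eq_mul]
  ring

theorem sub_div_eq {μ z : ℂ} (hz : z ≠ 0) : z - μ ^ 2 / z = z * (1 - μ ^ 2 / z ^ 2) := by
  field_simp

theorem one_sub_div_ne_zero {N : ℕ} {μ : ℂ} {u : Fin N → ℂ} {p : ℂ × ℂ} (hp : p ∈ curve μ u) :
    1 - μ ^ 2 / p.2 ^ 2 ≠ 0 := fun h => by
  have h1 := sub_div_ne_zero hp
  rw [sub_div_eq hp.2.1, h, mul_zero] at h1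
  exact h1 rfl

/-- The `A`-periods of `dΩ̂_n` are continuously differentiable functions of the moduli; their
derivative is the period of the derivative of `dΩ̂_n` at constant `z`. With `dΩ̂_n = R_n dz / z`, the
contraction of `d(R_n / z) ∧ dz` is evaluated by the differential of the equation of the curve. The
family of paths is only real differentiable in the moduli, but the resulting derivative is complex
linear. -/
theorem IsLoopFamily.exists_hasFDerivAt_period {N : ℕ} {μ : ℂ} {U : Set (Fin N → ℂ)}
    (hU : IsOpen U) {γ : (Fin N → ℂ) → ℝ → ℂ × ℂ} (hγ : IsLoopFamily μ U γ) (n : ℕ) :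
    ∃ Λ : (Fin N → ℂ) → (Fin N → ℂ) →L[ℂ] ℂ, ContinuousOn Λ U ∧ ∀ u ∈ U,
      HasFDerivAt (fun u => period (γ u) (dOmegaHat μ u n)) (Λ u) u ∧
      ∀ v, Λ u v = period (γ u) (dOmegaHatDot μ u v n) := by
  have hUo : IsOpen (U ×ˢ (Set.univ : Set ℝ)) := hU.prod isOpen_univ
  set x : (Fin N → ℂ) × ℝ → ℂ := fun q => (γ q.1 q.2).1 with hx
  set z : (Fin N → ℂ) × ℝ → ℂ := fun q => (γ q.1 q.2).2 with hz
  have hxs : ContDiffOn ℝ ∞ x (U ×ˢ Set.univ) := contDiff_fst.comp_contDiffOn hγ.1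
  have hzs : ContDiffOn ℝ ∞ z (U ×ˢ Set.univ) := contDiff_snd.comp_contDiffOn hγ.1
  have hc : ∀ q ∈ U ×ˢ (Set.univ : Set ℝ), (x q, z q) ∈ curve μ q.1 := fun q hq =>
    (hγ.2 q.1 hq.1).2.2 q.2
  set G : (Fin N → ℂ) × ℝ → ℂ := fun q => (R q.1 n).eval (x q) / z q with hG
  have hGs : ContDiffOn ℝ ∞ G (U ×ˢ Set.univ) := by
    have h1 : ContDiff ℝ ∞ (fun q : (Fin N → ℂ) × ℂ => (R q.1 n).eval q.2) :=
      ((contDiff_eval_R N n).restrict_scalars ℝ).of_le le_top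
    simp only [hG, div_eq_mul_inv]
    exact (h1.comp_contDiffOn (contDiff_fst.contDiffOn.prodMk hxs)).mul
      (hzs.inv fun q hq => (hc q hq).2.1)
  have hper : ∀ u ∈ U, ∀ t, γ u (t + 1) = γ u t := fun u hu => (hγ.2 u hu).2.1
  obtain ⟨L, hLc, hL⟩ := exists_hasFDerivAt_integral_mul_fderiv hU hGs hzs
    (fun u hu t => by simp only [hG, hx, hz, hper u hu t])
    (fun u hu t => by simp only [hz, hper u hu t])
  have dx : ∀ q ∈ U ×ˢ (Set.univ : Set ℝ), HasFDerivAt x (fderiv ℝ x q) q := fun q hq =>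
    ((hxs.differentiableOn (by simp)).differentiableAt (hUo.mem_nhds hq)).hasFDerivAt
  have dz : ∀ q ∈ U ×ˢ (Set.univ : Set ℝ), HasFDerivAt z (fderiv ℝ z q) q := fun q hq =>
    ((hzs.differentiableOn (by simp)).differentiableAt (hUo.mem_nhds hq)).hasFDerivAt
  have dxt : ∀ u ∈ U, ∀ t : ℝ, deriv (fun s => (γ u s).1) t = fderiv ℝ x (u, t) (0, 1) :=
    fun u hu t => ((dx (u, t) ⟨hu, trivial⟩).comp_hasDerivAt t
      ((hasDerivAt_const t u).prodMk (hasDerivAt_id t))).deriv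
  -- the differential of the equation of the curve
  have hcurve : ∀ q ∈ U ×ˢ (Set.univ : Set ℝ), ∀ v s, (1 - μ ^ 2 / z q ^ 2) *
      fderiv ℝ z q (v, s) = WDot v (x q) + deriv (W q.1) (x q) * fderiv ℝ x q (v, s) := by
    intro q hq v s
    have hz0 : z q ≠ 0 := (hc q hq).2.1
    have h1 : HasDerivAt (fun w => w + μ ^ 2 / w) (1 - μ ^ 2 / z q ^ 2) (z q) := by
      have h2 := (hasDerivAt_id (z q)).add ((hasDerivAt_inv hz0).const_mul (μ ^ 2))
      refine h2.congr_deriv ?_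
      ring
    have h3 := (h1.hasFDerivAt.restrictScalars ℝ).comp q (dz q hq)
    have h4 := (((contDiffAt_W q.1 (hc q hq).1).differentiableAt (by simp)
      ).hasFDerivAt.restrictScalars ℝ).comp q (hasFDerivAt_fst.prodMk (dx q hq))
    have h5 := h3.unique (h4.congr_of_eventuallyEq (by
      filter_upwards [hUo.mem_nhds hq] with q' hq'
      exact (hc q' hq').2.2.2))
    have h6 := DFunLike.congr_fun h5 (v, s)
    simp only [ContinuousLinearMap.comp_apply, ContinuousLinearMap.prod_apply,
      ContinuousLinearMap.coe_restrictScalars', ContinuousLinearMap.coe_fst'] at h6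
    rw [fderiv_W q.1 v (hc q hq).1] at h6
    rw [← h6]
    simp [mul_comm]
  have dG : ∀ q ∈ U ×ˢ (Set.univ : Set ℝ), ∀ v s, fderiv ℝ G q (v, s) =
      ((RDot q.1 v n).eval (x q) + (derivative (R q.1 n)).eval (x q) * fderiv ℝ x q (v, s)) / z q -
        (R q.1 n).eval (x q) * fderiv ℝ z q (v, s) / z q ^ 2 := by
    intro q hq v s
    have hz0 : z q ≠ 0 := (hc q hq).2.1
    have h3 := ((hasDerivAt_inv hz0).hasFDerivAt.restrictScalars ℝ).comp q (dz q hq)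
    have h4 := (((contDiff_eval_R N n).differentiable (by simp) (q.1, x q)
      ).hasFDerivAt.restrictScalars ℝ).comp q (hasFDerivAt_fst.prodMk (dx q hq))
    have h5 : G = ((fun q : (Fin N → ℂ) × ℂ => (R q.1 n).eval q.2) ∘ fun q => (q.1, x q)) *
      ((fun w => w⁻¹) ∘ z) := by
      ext q
      simp [hG, div_eq_mul_inv]
    rw [h5, (h4.mul h3).fderiv]
    simp only [ContinuousLinearMap.comp_apply, ContinuousLinearMap.prod_apply, add_apply,
      smul_apply, Function.comp_apply,
      ContinuousLinearMap.coe_restrictScalars', ContinuousLinearMap.coe_fst', fderiv_eval_R]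
    simp
    ring
  have hfun : ∀ u ∈ U, period (γ u) (dOmegaHat μ u n) =
      ∫ t in (0 : ℝ)..1, G (u, t) * fderiv ℝ z (u, t) (0, 1) := by
    intro u hu
    rw [period]
    congr 1
    ext t
    have hq : (u, t) ∈ U ×ˢ (Set.univ : Set ℝ) := ⟨hu, trivial⟩
    have h1 := hcurve _ hq 0 1
    rw [← WDotCLM_apply, map_zero, zero_add] at h1
    have hm := one_sub_div_ne_zero (hc _ hq)
    have hz0 : z (u, t) ≠ 0 := (hc _ hq).2.1
    rw [dxt u hu, dOmegaHat, dlogz]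
    show (R u n).eval (x (u, t)) * (deriv (W u) (x (u, t)) / (z (u, t) - μ ^ 2 / z (u, t))) * _ =
      (R u n).eval (x (u, t)) / z (u, t) * _
    rw [sub_div_eq hz0]
    simp only at hm h1
    generalize 1 - μ ^ 2 / z (u, t) ^ 2 = m at *
    field_simp
    linear_combination -(R u n).eval (x (u, t)) * h1
  have hval : ∀ u ∈ U, ∀ v, L u v = period (γ u) (dOmegaHatDot μ u v n) := by
    intro u hu v
    rw [(hL u hu).2 v, period]
    congr 1
    ext t
    have hq : (u, t) ∈ U ×ˢ (Set.univ : Set ℝ) := ⟨hu, trivial⟩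
    have h1 := hcurve _ hq 0 1
    have h2 := hcurve _ hq v 0
    rw [← WDotCLM_apply, map_zero, zero_add] at h1
    have hm := one_sub_div_ne_zero (hc _ hq)
    have hz0 : z (u, t) ≠ 0 := (hc _ hq).2.1
    rw [dxt u hu, dOmegaHatDot, dG _ hq, dG _ hq, eval_RDot_zero]
    show _ = ((RDot u v n).eval (x (u, t)) * deriv (W u) (x (u, t)) -
      (derivative (R u n)).eval (x (u, t)) * WDot v (x (u, t))) /
      (z (u, t) - μ ^ 2 / z (u, t)) * _
    rw [sub_div_eq hz0]
    simp only at hm h1 h2 ⊢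
    generalize 1 - μ ^ 2 / z (u, t) ^ 2 = m at *
    field_simp
    linear_combination (RDot u v n).eval (x (u, t)) * z (u, t) * h1 +
      (derivative (R u n)).eval (x (u, t)) * z (u, t) * (fderiv ℝ x (u, t) (v, 0) * h1 -
        fderiv ℝ x (u, t) (0, 1) * h2)
  have hsmul : ∀ u ∈ U, ∀ (c : ℂ) v, L u (c • v) = c * L u v := by
    intro u hu c v
    rw [hval u hu, hval u hu, period, period, ← intervalIntegral.integral_const_mul]
    simp only [dOmegaHatDot_smul, mul_assoc]
  classical
  let Λ : (Fin N → ℂ) → (Fin N → ℂ) →L[ℂ] ℂ := fun u =>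
    if hu : u ∈ U then
      { toFun := L u
        map_add' := (L u).map_add
        map_smul' := hsmul u hu
        cont := (L u).continuous }
    else 0
  have hΛ : ∀ u ∈ U, (Λ u).restrictScalars ℝ = L u := by
    intro u hu
    simp only [Λ, dif_pos hu]
    rfl
  refine ⟨Λ, ?_, fun u hu => ⟨?_, fun v => ?_⟩⟩
  · have h1 := (ContinuousLinearMap.restrictScalarsIsometry ℂ (Fin N → ℂ) ℂ ℝ ℝ
      ).isometry.isEmbedding.isInducing
    rw [h1.continuousOn_iff]
    exact hLc.congr hΛ
  · refine hasFDerivAt_of_restrictScalars ℝ ((hL u hu).1.congr_of_eventuallyEq ?_) (hΛ u hu)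
    filter_upwards [hU.mem_nhds hu] with w hw
    exact hfun w hw
  · rw [← hval u hu, ← hΛ u hu]
    rfl

/-! ### The period map and its inverse -/

theorem continuous_coeff_hyperellipticPoly {N : ℕ} (μ : ℂ) (k : ℕ) :
    Continuous fun u : Fin N → ℂ => (hyperellipticPoly μ u).coeff k := by
  have h1 : ∀ u : Fin N → ℂ, (Q u).comp (X ^ 2) =
      X ^ (2 * N) - ∑ j : Fin N, C (u j) * X ^ (2 * (N - 1 - (j : ℕ))) := fun u => by
    simp [Q, Polynomial.sum_comp, ← pow_mul]
  have h2 : ∀ k, Continuous fun u : Fin N → ℂ => ((Q u).comp (X ^ 2)).coeff k := fun k => by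
    simp only [h1, coeff_sub, finsetSum_coeff, coeff_C_mul]
    fun_prop
  simp only [hyperellipticPoly, sq ((Q _).comp _), coeff_sub, coeff_mul (Polynomial.comp _ _)]
  fun_prop

/-- Smoothness is the nonvanishing of the resultant of the hyperelliptic polynomial and its
derivative. -/
theorem isOpen_setOf_isSmoothCurve {N : ℕ} (hN : 2 ≤ N) (μ : ℂ) :
    IsOpen {u : Fin N → ℂ | IsSmoothCurve μ u} := by
  have h1 : ∀ u : Fin N → ℂ, (derivative (hyperellipticPoly μ u)).natDegree = 4 * N - 1 :=
    fun u => by rw [natDegree_derivative, natDegree_hyperellipticPoly hN]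
  have h2 : {u : Fin N → ℂ | IsSmoothCurve μ u} = {u | (hyperellipticPoly μ u).resultant
      (derivative (hyperellipticPoly μ u)) (4 * N) (4 * N - 1) ≠ 0} := by
    ext u
    have h3 := isUnit_resultant_iff_isCoprime (g := derivative (hyperellipticPoly μ u))
      (monic_hyperellipticPoly hN μ u)
    rw [natDegree_hyperellipticPoly hN, h1, isUnit_iff_ne_zero] at h3
    exact h3.symm
  rw [h2]
  refine isOpen_ne.preimage
    (Continuous.matrix_det (continuous_pi fun i => continuous_pi fun j => ?_))
  refine Fin.addCases (fun j => ?_) (fun j => ?_) j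
  · simp only [sylvester, Matrix.of_apply, Fin.addCases_left, coeff_derivative]
    split_ifs
    · exact (continuous_coeff_hyperellipticPoly μ _).mul continuous_const
    · exact continuous_const
  · simp only [sylvester, Matrix.of_apply, Fin.addCases_right]
    split_ifs
    · exact continuous_coeff_hyperellipticPoly μ _
    · exact continuous_const

theorem continuousOn_sub_div {N : ℕ} (μ : ℂ) (u : Fin N → ℂ) :
    ContinuousOn (fun p : ℂ × ℂ => p.2 - μ ^ 2 / p.2) (curve μ u) :=
  continuousOn_snd.sub (continuousOn_const.div continuousOn_snd fun _ hp => hp.2.1)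

theorem continuousOn_oddDiff {N : ℕ} (μ : ℂ) (u c : Fin N → ℂ) :
    ContinuousOn (oddDiff μ c) (curve μ u) := by
  refine ContinuousOn.div (Continuous.continuousOn (by fun_prop)) ?_ fun p hp => yCoord_ne_zero hp
  exact (continuousOn_fst.pow 2).mul (continuousOn_sub_div μ u)

theorem continuousOn_dOmegaHat {N : ℕ} (μ : ℂ) (u : Fin N → ℂ) (n : ℕ) :
    ContinuousOn (dOmegaHat μ u n) (curve μ u) := by
  have h1 : ContinuousOn (deriv (W u)) {0}ᶜ := by
    refine (DifferentiableOn.deriv (fun x hx => ?_) isOpen_compl_singleton).continuousOn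
    exact (differentiableAt_W u hx).differentiableWithinAt
  refine ContinuousOn.mul ((R u n).continuous.comp continuous_fst).continuousOn ?_
  exact (h1.comp continuousOn_fst fun p hp => hp.1).div (continuousOn_sub_div μ u)
    fun p hp => sub_div_ne_zero hp

theorem period_congr {N : ℕ} {μ : ℂ} {u : Fin N → ℂ} {γ : ℝ → ℂ × ℂ} (hγ : IsLoop μ u γ)
    {φ ψ : Differential} (h : Set.EqOn φ ψ (curve μ u)) : period γ φ = period γ ψ := by
  simp only [period, h (hγ.2.2 _)]

theorem period_sum {N : ℕ} {μ : ℂ} {u : Fin N → ℂ} {γ : ℝ → ℂ × ℂ} (hγ : IsLoop μ u γ)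
    {ι : Type*} (s : Finset ι) (c : ι → ℂ) {φ : ι → Differential}
    (hφ : ∀ i, ContinuousOn (φ i) (curve μ u)) :
    period γ (fun p => ∑ i ∈ s, c i * φ i p) = ∑ i ∈ s, c i * period γ (φ i) := by
  have h1 : ∀ i, IntervalIntegrable (fun t => φ i (γ t) * deriv (fun s => (γ s).1) t) volume 0 1 :=
    fun i => (((hφ i).comp_continuous hγ.1.continuous hγ.2.2).mul
      (continuous_deriv_fst hγ.1)).intervalIntegrable 0 1
  simp only [period, Finset.sum_mul, mul_assoc]
  rw [intervalIntegral.integral_finsetSum fun i _ => (h1 i).const_mul _]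
  simp only [intervalIntegral.integral_const_mul]

theorem period_add {N : ℕ} {μ : ℂ} {u : Fin N → ℂ} {γ : ℝ → ℂ × ℂ} (hγ : IsLoop μ u γ)
    {φ ψ : Differential} (hφ : ContinuousOn φ (curve μ u)) (hψ : ContinuousOn ψ (curve μ u)) :
    period γ (fun p => φ p + ψ p) = period γ φ + period γ ψ := by
  have h := period_sum hγ Finset.univ (fun _ => 1) (φ := ![φ, ψ]) (by
    intro i
    fin_cases i
    · exact hφ
    · exact hψ)
  simpa using h

/-- The periods of the odd holomorphic differential `oddDiff μ c`, as a linear function of its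
coefficients `c`. -/
def oddPeriods {N : ℕ} {μ : ℂ} {u : Fin N → ℂ} {A : Fin N → ℝ → ℂ × ℂ}
    (hA : ∀ j, IsLoop μ u (A j)) : (Fin N → ℂ) →ₗ[ℂ] (Fin N → ℂ) where
  toFun c j := period (A j) (oddDiff μ c)
  map_add' c d := by
    ext j
    rw [Pi.add_apply, ← period_add (hA j) (continuousOn_oddDiff μ u c) (continuousOn_oddDiff μ u d)]
    congr 1
    ext p
    simp only [oddDiff, Pi.add_apply, add_mul, Finset.sum_add_distrib, add_div]
  map_smul' a c := by
    ext j
    simp only [period, oddDiff, Pi.smul_apply, smul_eq_mul, RingHom.id_apply]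
    rw [← intervalIntegral.integral_const_mul]
    congr 1
    ext t
    simp only [mul_assoc, ← Finset.mul_sum]
    ring

theorem oddPeriods_apply {N : ℕ} {μ : ℂ} {u : Fin N → ℂ} {A : Fin N → ℝ → ℂ × ℂ}
    (hA : ∀ j, IsLoop μ u (A j)) (c : Fin N → ℂ) (j : Fin N) :
    oddPeriods hA c j = period (A j) (oddDiff μ c) := rfl

/-- Odd holomorphic differentials with the same periods are equal. -/
theorem eqOn_of_period_eq {N : ℕ} (hN : 2 ≤ N) {μ : ℂ} {u : Fin N → ℂ} (hu : IsSmoothCurve μ u)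
    {A : Fin N → ℝ → ℂ × ℂ} (hA : ∀ j, IsLoop μ u (A j))
    (hinj : Function.Injective (oddPeriods hA)) {φ ψ : Differential} (hφ : IsHolomorphic μ u φ)
    (hφ' : IsOdd μ u φ) (hψ : IsHolomorphic μ u ψ) (hψ' : IsOdd μ u ψ)
    (h : ∀ j, period (A j) φ = period (A j) ψ) : Set.EqOn φ ψ (curve μ u) := by
  obtain ⟨c, hc⟩ := hφ.exists_eq_oddDiff hN hu hφ'
  obtain ⟨d, hd⟩ := hψ.exists_eq_oddDiff hN hu hψ'
  have h1 : c = d := hinj <| by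
    ext j
    rw [oddPeriods_apply, oddPeriods_apply, ← period_congr (hA j) hc, ← period_congr (hA j) hd, h j]
  intro p hp
  rw [hc p hp, hd p hp, h1]

/-- If the matrix of periods of the odd holomorphic differentials is injective, it is invertible, and
normalized differentials exist. -/
theorem exists_isNormalizedPrym {N : ℕ} {μ : ℂ} {u : Fin N → ℂ}
    {A : Fin N → ℝ → ℂ × ℂ} (hA : ∀ j, IsLoop μ u (A j))
    (hinj : Function.Injective (oddPeriods hA)) :
    ∃ c : Fin N → Fin N → ℂ, IsNormalizedPrym μ u A fun j => oddDiff μ (c j) := by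
  have hsurj : Function.Surjective (oddPeriods hA) := LinearMap.injective_iff_surjective.1 hinj
  choose c hc using fun j : Fin N => hsurj fun k => if j = k then 1 else 0
  refine ⟨c, fun j => ⟨isHolomorphic_oddDiff μ u _, isOdd_oddDiff μ u _, fun k => ?_⟩⟩
  rw [← oddPeriods_apply hA, hc]

theorem IsLoopFamily.contDiffOn_period {N : ℕ} {μ : ℂ} {U : Set (Fin N → ℂ)} (hU : IsOpen U)
    {γ : (Fin N → ℂ) → ℝ → ℂ × ℂ} (hγ : IsLoopFamily μ U γ) (n : ℕ) :
    ContDiffOn ℂ 1 (fun u => period (γ u) (dOmegaHat μ u n)) U ∧ ∀ u ∈ U, ∀ v,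
      fderiv ℂ (fun u => period (γ u) (dOmegaHat μ u n)) u v =
        period (γ u) (dOmegaHatDot μ u v n) := by
  obtain ⟨Λ, hΛc, hΛ⟩ := hγ.exists_hasFDerivAt_period hU n
  refine ⟨?_, fun u hu v => by rw [(hΛ u hu).1.fderiv, (hΛ u hu).2]⟩
  rw [show (1 : WithTop ℕ∞) = 0 + 1 by simp, contDiffOn_succ_iff_fderiv_of_isOpen hU]
  refine ⟨fun u hu => (hΛ u hu).1.differentiableAt.differentiableWithinAt, by simp, ?_⟩
  rw [contDiffOn_zero]
  exact hΛc.congr fun u hu => (hΛ u hu).1.fderiv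

theorem periodMap_eq_sum {N M : ℕ} {μ : ℂ} {A : Fin N → (Fin N → ℂ) → ℝ → ℂ × ℂ}
    {u : Fin N → ℂ} (hA : ∀ j, IsLoop μ u (A j u)) (T : Fin M → ℂ) (j : Fin N) :
    periodMap μ A u T j = ∑ n : Fin M, T n * period (A j u) (dOmegaHat μ u ((n : ℕ) + 1)) :=
  period_sum (hA j) Finset.univ T fun _ => continuousOn_dOmegaHat μ u _

/-- The map `(u, T) ↦ (a, T)` is continuously differentiable, with derivative expressed by periods
of `dΩ̂_n` and of its derivatives at constant `z`. -/
theorem contDiffOn_periodMap {N M : ℕ} {μ : ℂ} {U : Set (Fin N → ℂ)} (hU : IsOpen U)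
    {A : Fin N → (Fin N → ℂ) → ℝ → ℂ × ℂ} (hA : ∀ j, IsLoopFamily μ U (A j)) :
    ContDiffOn ℂ 1 (fun q : (Fin N → ℂ) × (Fin M → ℂ) => (periodMap μ A q.1 q.2, q.2))
      (U ×ˢ Set.univ) ∧
    ∀ u ∈ U, ∀ (T : Fin M → ℂ) δ S, fderiv ℂ
      (fun q : (Fin N → ℂ) × (Fin M → ℂ) => (periodMap μ A q.1 q.2, q.2)) (u, T) (δ, S) =
      (fun j => ∑ n : Fin M, (S n * period (A j u) (dOmegaHat μ u ((n : ℕ) + 1)) +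
        T n * period (A j u) (dOmegaHatDot μ u δ ((n : ℕ) + 1))), S) := by
  have hUo : IsOpen (U ×ˢ (Set.univ : Set (Fin M → ℂ))) := hU.prod isOpen_univ
  set P : Fin N → Fin M → (Fin N → ℂ) → ℂ := fun j n u =>
    period (A j u) (dOmegaHat μ u ((n : ℕ) + 1)) with hP
  have hPs : ∀ j n, ContDiffOn ℂ 1 (P j n) U := fun j n => ((hA j).contDiffOn_period hU _).1
  set Ψ : (Fin N → ℂ) × (Fin M → ℂ) → (Fin N → ℂ) × (Fin M → ℂ) := fun q =>
    (fun j => ∑ n : Fin M, q.2 n * P j n q.1, q.2) with hΨ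
  have heq : Set.EqOn (fun q : (Fin N → ℂ) × (Fin M → ℂ) => (periodMap μ A q.1 q.2, q.2)) Ψ
      (U ×ˢ Set.univ) := fun q hq => by
    simp only [hΨ, Prod.mk.injEq, and_true]
    ext j
    exact periodMap_eq_sum (fun j => (hA j).2 q.1 hq.1) q.2 j
  have hproj : ∀ n : Fin M, ContDiff ℂ 1 fun q : (Fin N → ℂ) × (Fin M → ℂ) => q.2 n := fun n =>
    (contDiff_apply ℂ ℂ n).comp contDiff_snd
  constructor
  · refine ContDiffOn.congr ?_ heq
    refine (contDiffOn_pi.2 fun j => ContDiffOn.sum fun n _ => ?_).prodMk contDiff_snd.contDiffOn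
    exact (hproj n).contDiffOn.mul ((hPs j n).comp contDiff_fst.contDiffOn fun q hq => hq.1)
  · intro u hu T δ S
    have hmem : (u, T) ∈ U ×ˢ (Set.univ : Set (Fin M → ℂ)) := ⟨hu, trivial⟩
    have h1 := (heq.eventuallyEq_of_mem (hUo.mem_nhds hmem)).fderiv_eq (𝕜 := ℂ)
    have hPd : ∀ j n, HasFDerivAt (P j n) (fderiv ℂ (P j n) u) u := fun j n =>
      (((hPs j n).differentiableOn one_ne_zero).differentiableAt (hU.mem_nhds hu)).hasFDerivAt
    have h2 : ∀ n : Fin M, HasFDerivAt (fun q : (Fin N → ℂ) × (Fin M → ℂ) => q.2 n)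
        ((ContinuousLinearMap.proj n).comp (ContinuousLinearMap.snd ℂ _ _)) (u, T) := fun n =>
      ((ContinuousLinearMap.proj (R := ℂ) (φ := fun _ : Fin M => ℂ) n).comp
        (ContinuousLinearMap.snd ℂ (Fin N → ℂ) (Fin M → ℂ))).hasFDerivAt
    have h4 : ∀ j n, HasFDerivAt (fun q : (Fin N → ℂ) × (Fin M → ℂ) => P j n q.1)
        ((fderiv ℂ (P j n) u).comp (ContinuousLinearMap.fst ℂ _ _)) (u, T) := fun j n =>
      HasFDerivAt.comp (u, T) (f := Prod.fst) (hPd j n) hasFDerivAt_fst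
    have h3 : HasFDerivAt Ψ _ (u, T) := HasFDerivAt.prodMk
      (hasFDerivAt_pi.2 fun j => HasFDerivAt.fun_sum (u := Finset.univ) fun n _ =>
        (h2 n).mul (h4 j n)) hasFDerivAt_snd
    rw [h1, h3.fderiv]
    ext j
    · simp only [ContinuousLinearMap.prod_apply, ContinuousLinearMap.pi_apply, sum_apply,
        add_apply, smul_apply, ContinuousLinearMap.comp_apply, ContinuousLinearMap.coe_fst',
        ContinuousLinearMap.coe_snd', ContinuousLinearMap.proj_apply, smul_eq_mul]
      refine Finset.sum_congr rfl fun n _ => ?_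
      rw [hP, ((hA j).contDiffOn_period hU _).2 u hu]
      ring
    · rfl

theorem R_one {N : ℕ} (u : Fin N → ℂ) : R u 1 = X := by
  have h0 : ∀ r, PowerSeries.coeff 0 (powSeries u r) = 1 := fun r => by
    have h := coeff_subst_moduliSeries u (PowerSeries.binomialSeries ℂ r) 0
    rw [powSeries]
    refine h.trans ?_
    simp
  have h1 : ∀ r, PowerSeries.coeff 1 (powSeries u r) = 0 := fun r =>
    isEvenSeries_subst_moduliSeries u _ 1 (by decide)
  simp [R, Finset.sum_range_succ, h0, h1]

/-- Since `R_1 = x`, the derivatives of `dΩ̂_1` with respect to the moduli are the `x^{2i} dx / y`,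
which span the odd holomorphic differentials. -/
theorem dOmegaHatDot_one {N : ℕ} {μ : ℂ} {u : Fin N → ℂ} (v : Fin N → ℂ) {p : ℂ × ℂ}
    (hp : p ∈ curve μ u) : dOmegaHatDot μ u v 1 p = oddDiff μ (v ∘ Fin.rev) p := by
  have h1 : (RDot u v 1).eval p.1 = 0 := by
    have h2 := fderiv_eval_R 1 u v p.1 0
    simp only [R_one, eval_X, derivative_X] at h2
    have h3 : fderiv ℂ (fun q : (Fin N → ℂ) × ℂ => q.2) (u, p.1) (v, 0) = 0 := by
      rw [fderiv_snd]
      rfl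
    rw [h3] at h2
    simpa using h2.symm
  have hx := hp.1
  have hy := sub_div_ne_zero hp
  rw [dOmegaHatDot, h1, R_one, derivative_X, eval_one, oddDiff, yCoord, WDot]
  have h4 : ∑ i, (v ∘ Fin.rev) i * p.1 ^ (2 * (i : ℕ)) =
      ∑ j, v j * (p.1 ^ 2) ^ (N - 1 - (j : ℕ)) := by
    rw [← Equiv.sum_comp Fin.revPerm]
    refine Finset.sum_congr rfl fun j _ => ?_
    simp only [Fin.revPerm_apply, Function.comp_apply, Fin.rev_rev, Fin.val_rev, ← pow_mul]
    congr 2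
    omega
  rw [h4]
  field_simp
  ring

/-- The inverse function theorem, with a box in the source on which the derivative stays
invertible. -/
theorem exists_openPartialHomeomorph_box {E F : Type*} [NormedAddCommGroup E] [NormedSpace ℂ E]
    [FiniteDimensional ℂ E] [NormedAddCommGroup F] [NormedSpace ℂ F] [FiniteDimensional ℂ F]
    {Ω : Set (E × F)} (hΩ : IsOpen Ω) {Φ : E × F → E × F} (hΦ : ContDiffOn ℂ 1 Φ Ω) {u : E} {T : F}
    (hq : (u, T) ∈ Ω) (hinj : ∀ v, fderiv ℂ Φ (u, T) v = 0 → v = 0) :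
    ∃ (e : OpenPartialHomeomorph (E × F) (E × F)) (V : Set E) (𝒯 : Set F), ⇑e = Φ ∧
      IsOpen V ∧ u ∈ V ∧ IsOpen 𝒯 ∧ T ∈ 𝒯 ∧ V ×ˢ 𝒯 ⊆ Ω ∧ V ×ˢ 𝒯 ⊆ e.source ∧
      ∀ q ∈ V ×ˢ 𝒯, ∃ f' : (E × F) ≃L[ℂ] E × F, HasFDerivAt Φ (f' : E × F →L[ℂ] E × F) q := by
  have : CompleteSpace E := FiniteDimensional.complete ℂ E
  have : CompleteSpace F := FiniteDimensional.complete ℂ F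
  have hinj' : Function.Injective (fderiv ℂ Φ (u, T) : E × F →ₗ[ℂ] E × F) :=
    (injective_iff_map_eq_zero _).2 hinj
  set f₀ : (E × F) ≃L[ℂ] E × F :=
    (LinearEquiv.ofInjectiveEndo _ hinj').toContinuousLinearEquiv with hf₀
  have hf₀' : (f₀ : E × F →L[ℂ] E × F) = fderiv ℂ Φ (u, T) := by
    ext v <;> rfl
  have hd : ∀ q ∈ Ω, HasFDerivAt Φ (fderiv ℂ Φ q) q := fun q hq =>
    ((hΦ.differentiableOn one_ne_zero).differentiableAt (hΩ.mem_nhds hq)).hasFDerivAt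
  have hc : ContDiffAt ℂ 1 Φ (u, T) := hΦ.contDiffAt (hΩ.mem_nhds hq)
  have h0 : HasFDerivAt Φ (f₀ : E × F →L[ℂ] E × F) (u, T) := hf₀' ▸ hd _ hq
  set e := hc.toOpenPartialHomeomorph Φ h0 one_ne_zero with he
  have hS : ∀ᶠ q in 𝓝 (u, T), q ∈ Ω ∧ q ∈ e.source ∧ fderiv ℂ Φ q ∈
      Set.range (ContinuousLinearEquiv.toContinuousLinearMap : ((E × F) ≃L[ℂ] E × F) → _) := by
    filter_upwards [hΩ.mem_nhds hq, e.open_source.mem_nhds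
      (hc.mem_toOpenPartialHomeomorph_source h0 one_ne_zero),
      ((hΦ.continuousOn_fderiv_of_isOpen hΩ le_rfl).continuousAt (hΩ.mem_nhds hq)
      ).eventually_mem (ContinuousLinearEquiv.isOpen.mem_nhds ⟨f₀, hf₀'⟩)] with q h1 h2 h3
    exact ⟨h1, h2, h3⟩
  obtain ⟨V, 𝒯, hV, huV, hT, hTT, hsub⟩ := mem_nhds_prod_iff'.1 hS
  refine ⟨e, V, 𝒯, rfl, hV, huV, hT, hTT, fun q hq => (hsub hq).1, fun q hq => (hsub hq).2.1,
    fun q hq => ?_⟩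
  obtain ⟨f', hf'⟩ := (hsub hq).2.2
  exact ⟨f', hf' ▸ hd q (hsub hq).1⟩

theorem sum_T₀_mul {M : ℕ} (hM : 1 ≤ M) (f : ℕ → ℂ) :
    ∑ n : Fin M, T₀ M n * f ((n : ℕ) + 1) = f 1 := by
  rw [Finset.sum_eq_single (⟨0, hM⟩ : Fin M)]
  · simp [T₀]
  · intro n _ hn
    rw [T₀, if_neg fun h => hn (Fin.ext h), zero_mul]
  · simp

theorem comp_rev_rev {N : ℕ} (c : Fin N → ℂ) : (c ∘ Fin.rev) ∘ Fin.rev = c :=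
  funext fun i => by simp

/-- At `T = (1, 0, …, 0)` the derivative of the period map is the matrix of periods of the odd
holomorphic differentials. -/
theorem fderiv_periodMap_T₀ {N M : ℕ} (hM : 1 ≤ M) {μ : ℂ} {U : Set (Fin N → ℂ)} (hU : IsOpen U)
    {A : Fin N → (Fin N → ℂ) → ℝ → ℂ × ℂ} (hA : ∀ j, IsLoopFamily μ U (A j)) {u : Fin N → ℂ}
    (hu : u ∈ U) (δ : Fin N → ℂ) :
    fderiv ℂ (fun q : (Fin N → ℂ) × (Fin M → ℂ) => (periodMap μ A q.1 q.2, q.2)) (u, T₀ M) (δ, 0) =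
      (oddPeriods (fun j => (hA j).2 u hu) (δ ∘ Fin.rev), 0) := by
  rw [(contDiffOn_periodMap hU hA).2 u hu]
  ext j
  · simp only [Pi.zero_apply, zero_mul, zero_add]
    rw [sum_T₀_mul hM fun n => period (A j u) (dOmegaHatDot μ u δ n), oddPeriods_apply]
    exact period_congr ((hA j).2 u hu) fun p hp => dOmegaHatDot_one δ hp
  · rfl

theorem fderiv_periodMap_injective {N M : ℕ} (hM : 1 ≤ M) {μ : ℂ} {U : Set (Fin N → ℂ)}
    (hU : IsOpen U) {A : Fin N → (Fin N → ℂ) → ℝ → ℂ × ℂ} (hA : ∀ j, IsLoopFamily μ U (A j))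
    {u : Fin N → ℂ} (hu : u ∈ U)
    (hinj : ∀ c : Fin N → ℂ, (∀ j, period (A j u) (oddDiff μ c) = 0) → c = 0)
    (v : (Fin N → ℂ) × (Fin M → ℂ)) (hv : fderiv ℂ
      (fun q : (Fin N → ℂ) × (Fin M → ℂ) => (periodMap μ A q.1 q.2, q.2)) (u, T₀ M) v = 0) :
    v = 0 := by
  obtain ⟨δ, S⟩ := v
  have hS : S = 0 := by
    rw [(contDiffOn_periodMap hU hA).2 u hu] at hv
    exact (Prod.ext_iff.1 hv).2
  subst hS
  rw [fderiv_periodMap_T₀ hM hU hA hu] at hv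
  have h1 := hinj (δ ∘ Fin.rev) fun j => congrFun (Prod.ext_iff.1 hv).1 j
  have h2 : δ = 0 := by
    rw [← comp_rev_rev δ, h1]
    rfl
  rw [h2]
  rfl

/-- Invertibility of the derivative of the period map at `(u, T₀)` gives injectivity of the period
matrix at `u`, so that no symplectic basis is needed on the curves near the given one. -/
theorem oddPeriods_injective {N M : ℕ} (hM : 1 ≤ M) {μ : ℂ} {U : Set (Fin N → ℂ)}
    (hU : IsOpen U) {A : Fin N → (Fin N → ℂ) → ℝ → ℂ × ℂ} (hA : ∀ j, IsLoopFamily μ U (A j))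
    {u : Fin N → ℂ} (hu : u ∈ U)
    (h : Function.Injective (fderiv ℂ
      (fun q : (Fin N → ℂ) × (Fin M → ℂ) => (periodMap μ A q.1 q.2, q.2)) (u, T₀ M))) :
    Function.Injective (oddPeriods fun j => (hA j).2 u hu) := by
  rw [injective_iff_map_eq_zero]
  intro c hc
  have h1 := fderiv_periodMap_T₀ (M := M) hM hU hA hu (c ∘ Fin.rev)
  rw [comp_rev_rev, hc] at h1
  have h2 : ((c ∘ Fin.rev, 0) : (Fin N → ℂ) × (Fin M → ℂ)) = 0 := h (h1.trans (map_zero _).symm)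
  have h3 : c ∘ Fin.rev = 0 := (Prod.ext_iff.1 h2).1
  rw [← comp_rev_rev c, h3]
  rfl

/-! ### Differentiation at constant `z` -/

theorem isInvertible_of_apply_one {b : ℂ} (hb : b ≠ 0) {L : ℂ →L[ℂ] ℂ} (hL : L 1 = b) :
    L.IsInvertible := by
  refine ⟨ContinuousLinearEquiv.unitsEquivAut ℂ (Units.mk0 b hb), ?_⟩
  ext
  simp [hL]

/-- Near a point with `W'(x) ≠ 0` the equation `W_u(x) = const` has a unique solution `x = x(u)`,
with the derivative given by implicit differentiation. -/
theorem exists_implicit_W {N : ℕ} (u : Fin N → ℂ) {x : ℂ} (hx : x ≠ 0) (hW : deriv (W u) x ≠ 0) :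
    ∃ (f : (Fin N → ℂ) → ℂ) (f' : (Fin N → ℂ) →L[ℂ] ℂ), f u = x ∧ HasFDerivAt f f' u ∧
      (∀ v, deriv (W u) x * f' v = -WDot v x) ∧ (∀ᶠ v in 𝓝 u, W v (f v) = W u x) ∧
      ∀ᶠ q : (Fin N → ℂ) × ℂ in 𝓝 (u, x), W q.1 q.2 = W u x → q.2 = f q.1 := by
  set F : (Fin N → ℂ) × ℂ → ℂ := fun q => W q.1 q.2 with hF
  have hs : HasStrictFDerivAt F (fderiv ℂ F (u, x)) (u, x) :=
    (contDiffAt_W u hx).hasStrictFDerivAt (by simp)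
  have hL : ((fderiv ℂ F (u, x)).comp (ContinuousLinearMap.inr ℂ (Fin N → ℂ) ℂ)) 1 =
      deriv (W u) x := by
    rw [ContinuousLinearMap.comp_apply, ContinuousLinearMap.inr_apply, fderiv_W u 0 hx,
      ← WDotCLM_apply, map_zero, zero_add, mul_one]
  have hinv := isInvertible_of_apply_one hW hL
  have hd := (hs.hasStrictFDerivAt_implicitFunctionOfProdDomain hinv).hasFDerivAt
  have h1 := hs.eventually_apply_eq_iff_implicitFunctionOfProdDomain hinv
  refine ⟨_, _, h1.self_of_nhds.1 rfl, hd, fun v => ?_,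
    hs.eventually_apply_implicitFunctionOfProdDomain hinv, ?_⟩
  · obtain ⟨g, hg⟩ := hinv
    have h2 : ∀ w : ℂ, g w = deriv (W u) x * w := fun w => by
      have h3 := congrArg (fun L : ℂ →L[ℂ] ℂ => L w) hg
      simp only [ContinuousLinearEquiv.coe_coe] at h3
      rw [h3]
      have h4 : w = w • (1 : ℂ) := by simp
      rw [h4, map_smul, hL]
      simp [mul_comm]
    have h5 := fderiv_W u v hx 0
    rw [mul_zero, add_zero] at h5
    rw [← h2, ← hg, ContinuousLinearMap.inverse_equiv]
    simp only [neg_apply, ContinuousLinearMap.comp_apply, ContinuousLinearEquiv.coe_coe,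
      ContinuousLinearMap.inl_apply, map_neg, ContinuousLinearEquiv.apply_symm_apply]
    rw [neg_inj]
    exact h5
  · filter_upwards [h1] with q hq hW
    exact (hq.1 hW).symm

theorem dzCoeff_dOmegaHat {N : ℕ} {μ : ℂ} {u : Fin N → ℂ} (n : ℕ) {p : ℂ × ℂ}
    (hp : p ∈ curve μ u) (hW : deriv (W u) p.1 ≠ 0) :
    dzCoeff μ u (dOmegaHat μ u n) p = (R u n).eval p.1 / p.2 := by
  have hm := one_sub_div_ne_zero hp
  have hz := hp.2.1
  rw [dzCoeff, dOmegaHat, dlogz, sub_div_eq hz]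
  generalize 1 - μ ^ 2 / p.2 ^ 2 = m at *
  field_simp

theorem dzCoeff_dS {N M : ℕ} {μ : ℂ} {u : Fin N → ℂ} (T : Fin M → ℂ) {p : ℂ × ℂ}
    (hp : p ∈ curve μ u) (hW : deriv (W u) p.1 ≠ 0) :
    dzCoeff μ u (dS μ u T) p = (∑ n : Fin M, T n * (R u ((n : ℕ) + 1)).eval p.1) / p.2 := by
  rw [dzCoeff, dS, Finset.sum_mul, Finset.sum_div]
  refine Finset.sum_congr rfl fun n _ => ?_
  rw [mul_assoc, mul_div_assoc, ← dzCoeff_dOmegaHat _ hp hW, dzCoeff]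

/-- The coefficient of `dz` in `dOmegaHatDot` is the derivative of `R_n(x) / z` along `x = x(u)`, where
`x'` is the derivative of `x` at constant `z`. -/
theorem dzCoeff_dOmegaHatDot {N : ℕ} {μ : ℂ} {u : Fin N → ℂ} (v : Fin N → ℂ) (n : ℕ) {p : ℂ × ℂ}
    (hp : p ∈ curve μ u) (hW : deriv (W u) p.1 ≠ 0) {x' : ℂ}
    (hx' : deriv (W u) p.1 * x' = -WDot v p.1) :
    dzCoeff μ u (dOmegaHatDot μ u v n) p =
      ((RDot u v n).eval p.1 + (derivative (R u n)).eval p.1 * x') / p.2 := by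
  have hm := one_sub_div_ne_zero hp
  have hz := hp.2.1
  rw [dzCoeff, dOmegaHatDot, sub_div_eq hz]
  generalize 1 - μ ^ 2 / p.2 ^ 2 = m at *
  field_simp
  linear_combination -(derivative (R u n)).eval p.1 * hx'

/-- The derivative of `dS` at constant `z` along a curve in the space of the moduli and the times
`T`: only the implicit function `x = x(u)` is used, so the curve needs just one derivative. -/
theorem hasDerivConstZ_dS {N M : ℕ} {μ : ℂ} {v : ℂ → Fin N → ℂ} {T : ℂ → Fin M → ℂ}
    {δ : Fin N → ℂ} {S : Fin M → ℂ} {s₀ : ℂ} (hv : HasDerivAt v δ s₀) (hT : HasDerivAt T S s₀)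
    {ψ : Differential} (hψ : ∀ p ∈ curve μ (v s₀), ψ p = ∑ n : Fin M,
      (S n * dOmegaHat μ (v s₀) ((n : ℕ) + 1) p +
        T s₀ n * dOmegaHatDot μ (v s₀) δ ((n : ℕ) + 1) p)) :
    HasDerivConstZ μ v (fun s => dS μ (v s) (T s)) ψ s₀ := by
  intro p hp hW
  obtain ⟨f, f', hf0, hf, hf', hfW, huniq⟩ := exists_implicit_W (v s₀) hp.1 hW
  have hcurve : p.2 + μ ^ 2 / p.2 = W (v s₀) p.1 := hp.2.2.2
  refine ⟨⟨fun s => f (v s), hf0, hf.continuousAt.comp hv.continuousAt, ?_⟩, fun x hx => ?_⟩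
  · have h1 : ContinuousAt (fun s => f (v s)) s₀ := hf.continuousAt.comp hv.continuousAt
    filter_upwards [hv.continuousAt.eventually hfW, h1.eventually_ne (by rw [hf0]; exact hp.1)]
      with s hs hs'
    exact ⟨hs', hp.2.1, hp.2.2.1, by rw [hcurve, ← hs]⟩
  · obtain ⟨hx0, hxc, hxm⟩ := hx
    have hpair : ContinuousAt (fun s => (v s, x s)) s₀ := hv.continuousAt.prodMk hxc
    have hxf : x =ᶠ[𝓝 s₀] fun s => f (v s) := by
      have h1 : ∀ᶠ s in 𝓝 s₀, W (v s) (x s) = W (v s₀) p.1 → x s = f (v s) :=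
        hpair.eventually (by simpa [hx0] using huniq)
      filter_upwards [h1, hxm] with s h2 h3
      exact h2 (by rw [← hcurve]; exact h3.2.2.2.symm)
    have hxd : HasDerivAt x (f' δ) s₀ :=
      (hf.comp_hasDerivAt s₀ hv).congr_of_eventuallyEq hxf
    have hWne : ∀ᶠ s in 𝓝 s₀, deriv (W (v s)) (x s) ≠ 0 := by
      have h1 : ContinuousAt (fun q : (Fin N → ℂ) × ℂ =>
          fderiv ℂ (fun q : (Fin N → ℂ) × ℂ => W q.1 q.2) q (0, 1)) (v s₀, p.1) :=
        (((contDiffAt_W (v s₀) hp.1).fderiv_right (m := 0) le_top).continuousAt).clm_apply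
          continuousAt_const
      have h2 : ContinuousAt (fun s =>
          fderiv ℂ (fun q : (Fin N → ℂ) × ℂ => W q.1 q.2) (v s, x s) (0, 1)) s₀ :=
        ContinuousAt.comp (f := fun s => (v s, x s)) (g := fun q : (Fin N → ℂ) × ℂ =>
          fderiv ℂ (fun q : (Fin N → ℂ) × ℂ => W q.1 q.2) q (0, 1)) (by rw [hx0]; exact h1) hpair
      have h3 : ∀ (w : Fin N → ℂ) {y : ℂ}, y ≠ 0 →
          fderiv ℂ (fun q : (Fin N → ℂ) × ℂ => W q.1 q.2) (w, y) (0, 1) = deriv (W w) y :=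
        fun w y hy => by
          rw [fderiv_W w 0 hy, ← WDotCLM_apply, map_zero, zero_add, mul_one]
      filter_upwards [h2.eventually_ne (by rw [hx0, h3 _ hp.1]; exact hW),
        hxc.eventually_ne (by rw [hx0]; exact hp.1)] with s h4 h5
      rwa [h3 _ h5] at h4
    have hRd : ∀ n, HasDerivAt (fun s => (R (v s) n).eval (x s)) ((RDot (v s₀) δ n).eval p.1 +
        (derivative (R (v s₀) n)).eval p.1 * f' δ) s₀ := by
      intro n
      have h1 := ((contDiff_eval_R N n).differentiable (by simp) (v s₀, x s₀)).hasFDerivAt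
      have h2 := h1.comp_hasDerivAt s₀ (hv.prodMk hxd)
      rw [fderiv_eval_R, hx0] at h2
      exact h2
    have hTd : ∀ n, HasDerivAt (fun s => T s n) (S n) s₀ := hasDerivAt_pi.1 hT
    have hsum := (HasDerivAt.fun_sum (u := Finset.univ) fun (n : Fin M) _ =>
      (hTd n).mul (hRd ((n : ℕ) + 1))).div_const p.2
    refine (hsum.congr_of_eventuallyEq ?_).congr_deriv ?_
    · filter_upwards [hxm, hWne] with s h1 h2
      exact dzCoeff_dS (T s) h1 h2
    · rw [dzCoeff, hψ p hp, Finset.sum_mul, Finset.sum_div]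
      refine Finset.sum_congr rfl fun n _ => ?_
      have h1 := dzCoeff_dOmegaHat ((n : ℕ) + 1) hp hW
      have h2 := dzCoeff_dOmegaHatDot δ ((n : ℕ) + 1) hp hW (hf' δ)
      rw [dzCoeff] at h1 h2
      rw [add_mul, mul_assoc, mul_assoc, h1, h2, hx0]
      ring

/-! ### The Whitham equations -/

theorem oddDiff_sum_smul {N : ℕ} (μ : ℂ) {ι : Type*} (s : Finset ι) (a : ι → ℂ)
    (c : ι → Fin N → ℂ) (p : ℂ × ℂ) :
    oddDiff μ (∑ i ∈ s, a i • c i) p = ∑ i ∈ s, a i * oddDiff μ (c i) p := by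
  simp only [oddDiff, Finset.sum_apply, Pi.smul_apply, smul_eq_mul, Finset.sum_mul, mul_div_assoc',
    Finset.mul_sum, ← Finset.sum_div]
  rw [Finset.sum_comm]
  simp only [mul_assoc]

theorem period_dOmega {N : ℕ} {μ : ℂ} {u : Fin N → ℂ} {A : Fin N → ℝ → ℂ × ℂ}
    (hA : ∀ j, IsLoop μ u (A j)) {d : Fin N → Fin N → ℂ}
    (hd : IsNormalizedPrym μ u A fun j => oddDiff μ (d j)) (n : ℕ) (j : Fin N) :
    period (A j) (dOmega μ A u (fun j => oddDiff μ (d j)) n) = 0 := by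
  have h1 : dOmega μ A u (fun j => oddDiff μ (d j)) n = fun p => dOmegaHat μ u n p +
      ∑ k, -period (A k) (dOmegaHat μ u n) * oddDiff μ (d k) p := by
    ext p
    simp only [dOmega, neg_mul, Finset.sum_neg_distrib, sub_eq_add_neg]
  have hc : ∀ k, ContinuousOn (oddDiff μ (d k)) (curve μ u) := fun k => continuousOn_oddDiff μ u _
  have h2 : ContinuousOn (fun p => ∑ k, -period (A k) (dOmegaHat μ u n) * oddDiff μ (d k) p)
      (curve μ u) := continuousOn_finsetSum _ fun k _ => continuousOn_const.mul (hc k)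
  rw [h1, period_add (hA j) (continuousOn_dOmegaHat μ u n) h2, period_sum (hA j) _ _ hc]
  simp [(hd _).2.2 j]

theorem dS_eq_sum {N M : ℕ} {μ : ℂ} {A : Fin N → (Fin N → ℂ) → ℝ → ℂ × ℂ}
    {u : Fin N → ℂ} (hA : ∀ j, IsLoop μ u (A j u)) (om : Fin N → Differential) (T : Fin M → ℂ)
    (p : ℂ × ℂ) : dS μ u T p =
      ∑ n : Fin M, T n * dOmega μ (fun k => A k u) u om ((n : ℕ) + 1) p +
        ∑ j, periodMap μ A u T j * om j p := by
  simp only [periodMap_eq_sum hA, dOmega, dS, mul_sub, Finset.sum_sub_distrib, Finset.mul_sum,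
    Finset.sum_mul]
  rw [Finset.sum_comm (s := (Finset.univ : Finset (Fin N)))]
  simp only [mul_assoc, sub_add_cancel]

/-- The derivative of `dS` at constant `z` is determined by its periods: both sides differ from
`∑ S_n dΩ̂_n` by an odd holomorphic differential, and they have the same periods. -/
theorem sum_dOmega_add_eq {N M : ℕ} (hN : 2 ≤ N) {μ : ℂ} {u : Fin N → ℂ}
    {A : Fin N → ℝ → ℂ × ℂ} (hA : ∀ j, IsLoop μ u (A j))
    (hinj : Function.Injective (oddPeriods hA)) {d : Fin N → Fin N → ℂ}
    (hd : IsNormalizedPrym μ u A fun j => oddDiff μ (d j)) {T S : Fin M → ℂ} {δ b : Fin N → ℂ}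
    (hb : ∀ k, ∑ n : Fin M, (S n * period (A k) (dOmegaHat μ u ((n : ℕ) + 1)) +
      T n * period (A k) (dOmegaHatDot μ u δ ((n : ℕ) + 1))) = b k)
    {p : ℂ × ℂ} (hp : p ∈ curve μ u) :
    ∑ n : Fin M, S n * dOmega μ A u (fun j => oddDiff μ (d j)) ((n : ℕ) + 1) p +
      ∑ j, b j * oddDiff μ (d j) p =
    ∑ n : Fin M, (S n * dOmegaHat μ u ((n : ℕ) + 1) p +
      T n * dOmegaHatDot μ u δ ((n : ℕ) + 1) p) := by
  choose c hc using fun n : ℕ => exists_dOmegaHatDot_eq_oddDiff hN μ u δ n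
  have hcd : ∑ n : Fin M, T n • c n =
      ∑ j, (b j - ∑ n : Fin M, S n * period (A j) (dOmegaHat μ u ((n : ℕ) + 1))) • d j := by
    apply hinj
    ext k
    rw [map_sum, map_sum]
    simp only [map_smul, Finset.sum_apply, Pi.smul_apply, oddPeriods_apply, smul_eq_mul,
      (hd _).2.2 k, ← hb, Finset.sum_add_distrib]
    simp only [← period_congr (hA k) (hc _)]
    simp
  have h1 := oddDiff_sum_smul μ Finset.univ T (fun n : Fin M => c n) p
  rw [hcd, oddDiff_sum_smul] at h1
  simp only [← hc _ p hp] at h1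
  rw [Finset.sum_add_distrib, ← h1]
  simp only [dOmega, mul_sub, sub_mul, Finset.sum_sub_distrib, Finset.mul_sum, Finset.sum_mul]
  rw [Finset.sum_comm (s := (Finset.univ : Finset (Fin N)))]
  simp only [mul_assoc]
  ring

end SOWhitham

end

theorem mainTheorem1 (N M : ℕ) (hN : 2 ≤ N) (hM : 1 ≤ M) (μ : ℂ)
    (u₀ : Fin N → ℂ) (hu₀ : SOWhitham.IsSmoothCurve μ u₀)
    (U : Set (Fin N → ℂ)) (hU : IsOpen U) (hu₀U : u₀ ∈ U)
    (A : Fin N → (Fin N → ℂ) → ℝ → ℂ × ℂ) (hA : ∀ j, SOWhitham.IsLoopFamily μ U (A j))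
    (B : Fin N → ℝ → ℂ × ℂ) (hAB : SOWhitham.IsPrymCycles μ u₀ (fun j => A j u₀) B) :
    ∃ (V : Set (Fin N → ℂ)) (𝒯 : Set (Fin M → ℂ))
      (om : (Fin N → ℂ) → Fin N → SOWhitham.Differential)
      (u : (Fin N → ℂ) × (Fin M → ℂ) → Fin N → ℂ) (D : Set ((Fin N → ℂ) × (Fin M → ℂ))),
      IsOpen V ∧ u₀ ∈ V ∧ V ⊆ U ∧ IsOpen 𝒯 ∧ SOWhitham.T₀ M ∈ 𝒯 ∧
      -- on every curve with moduli in `V` the normalized odd holomorphic differentials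
      -- exist and are unique
      (∀ v ∈ V, SOWhitham.IsSmoothCurve μ v ∧
        SOWhitham.IsNormalizedPrym μ v (fun j => A j v) (om v) ∧
        ∀ om', SOWhitham.IsNormalizedPrym μ v (fun j => A j v) om' →
          ∀ j, Set.EqOn (om' j) (om v j) (SOWhitham.curve μ v)) ∧
      -- for `T ∈ 𝒯` the period map is invertible on `V`, with holomorphic inverse `u(a, T)`
      D = {q | q.2 ∈ 𝒯 ∧ ∃ v ∈ V, SOWhitham.periodMap μ A v q.2 = q.1} ∧
      IsOpen D ∧ DifferentiableOn ℂ u D ∧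
      (∀ v ∈ V, ∀ T ∈ 𝒯, u (SOWhitham.periodMap μ A v T, T) = v) ∧
      ∀ (a : Fin N → ℂ) (T : Fin M → ℂ), (a, T) ∈ D →
        -- the differentials `dΩ_n` have vanishing A-periods
        (∀ (n : Fin M) (j : Fin N), SOWhitham.period (A j (u (a, T)))
          (SOWhitham.dOmega μ (fun k => A k (u (a, T))) (u (a, T)) (om (u (a, T))) (n + 1)) = 0) ∧
        -- `dS = ∑ T_n dΩ_n + ∑ a_j dω_j`
        (∀ p ∈ SOWhitham.curve μ (u (a, T)),
          SOWhitham.dS μ (u (a, T)) T p =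
            ∑ n : Fin M, T n * SOWhitham.dOmega μ (fun k => A k (u (a, T))) (u (a, T))
              (om (u (a, T))) (n + 1) p +
            ∑ j, a j * om (u (a, T)) j p) ∧
        -- `∂dS/∂a_j |_z = dω_j`
        (∀ j : Fin N, SOWhitham.HasDerivConstZ μ
          (fun s => u (Function.update a j s, T))
          (fun s => SOWhitham.dS μ (u (Function.update a j s, T)) T)
          (om (u (a, T)) j) (a j)) ∧
        -- `∂dS/∂T_n |_z = dΩ_n`
        (∀ n : Fin M, SOWhitham.HasDerivConstZ μ
          (fun s => u (a, Function.update T n s))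
          (fun s => SOWhitham.dS μ (u (a, Function.update T n s)) (Function.update T n s))
          (SOWhitham.dOmega μ (fun k => A k (u (a, T))) (u (a, T)) (om (u (a, T))) (n + 1))
          (T n)) := by
  have hinj₀ : ∀ c : Fin N → ℂ, (∀ j, SOWhitham.period (A j u₀) (SOWhitham.oddDiff μ c) = 0) →
      c = 0 := fun c => hAB.eq_zero_of_period_eq_zero hN hu₀
  -- the curves with moduli in `U'` are smooth
  set U' : Set (Fin N → ℂ) := U ∩ {u | SOWhitham.IsSmoothCurve μ u}
  have hU'o : IsOpen U' := hU.inter (SOWhitham.isOpen_setOf_isSmoothCurve hN μ)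
  obtain ⟨hΦs, hΦd⟩ := SOWhitham.contDiffOn_periodMap (M := M) hU hA
  obtain ⟨e, V, 𝒯, he, hV, hu₀V, h𝒯, hT₀, hbox, hsource, hequiv⟩ :=
    SOWhitham.exists_openPartialHomeomorph_box (hU'o.prod isOpen_univ)
      (hΦs.mono (Set.prod_mono Set.inter_subset_left subset_rfl))
      (show (u₀, SOWhitham.T₀ M) ∈ U' ×ˢ Set.univ from ⟨⟨hu₀U, hu₀⟩, trivial⟩)
      (SOWhitham.fderiv_periodMap_injective hM hU hA hu₀U hinj₀)
  have hVU : ∀ v ∈ V, v ∈ U := fun v hv => (hbox (show (v, SOWhitham.T₀ M) ∈ V ×ˢ 𝒯 from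
    ⟨hv, hT₀⟩)).1.1
  have hVs : ∀ v ∈ V, SOWhitham.IsSmoothCurve μ v := fun v hv =>
    (hbox (show (v, SOWhitham.T₀ M) ∈ V ×ˢ 𝒯 from ⟨hv, hT₀⟩)).1.2
  have hloop : ∀ v ∈ V, ∀ j, SOWhitham.IsLoop μ v (A j v) := fun v hv j => (hA j).2 v (hVU v hv)
  -- the period matrix stays invertible on `V`, since the derivative of the period map does
  have hinj : ∀ v (hv : v ∈ V), Function.Injective (SOWhitham.oddPeriods (hloop v hv)) := by
    intro v hv
    obtain ⟨f', hf'⟩ := hequiv (v, SOWhitham.T₀ M) ⟨hv, hT₀⟩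
    refine SOWhitham.oddPeriods_injective hM hU hA (hVU v hv) ?_
    rw [hf'.fderiv]
    exact f'.injective
  choose! d hd using fun v hv => SOWhitham.exists_isNormalizedPrym (hloop v hv) (hinj v hv)
  have hleft : ∀ v ∈ V, ∀ T ∈ 𝒯, e.symm (SOWhitham.periodMap μ A v T, T) = (v, T) := by
    intro v hv T hT
    have h1 := e.left_inv (hsource (show (v, T) ∈ V ×ˢ 𝒯 from ⟨hv, hT⟩))
    rw [he] at h1
    exact h1
  set D : Set ((Fin N → ℂ) × (Fin M → ℂ)) :=
    {q | q.2 ∈ 𝒯 ∧ ∃ v ∈ V, SOWhitham.periodMap μ A v q.2 = q.1}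
  have hDimage : D = e '' (V ×ˢ 𝒯) := by
    ext ⟨a, T⟩
    rw [he]
    constructor
    · rintro ⟨hT, v, hv, h1⟩
      exact ⟨(v, T), ⟨hv, hT⟩, Prod.ext h1 rfl⟩
    · rintro ⟨⟨v, T'⟩, ⟨hv, hT⟩, h1⟩
      obtain ⟨h2, h3⟩ := Prod.mk.inj h1
      subst h3
      exact ⟨hT, v, hv, h2⟩
  -- the derivative of the inverse map, in terms of the periods
  have hsymm : ∀ v ∈ V, ∀ T ∈ 𝒯, ∃ g : (Fin N → ℂ) × (Fin M → ℂ) →L[ℂ] Fin N → ℂ,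
      HasFDerivAt (fun q => (e.symm q).1) g (SOWhitham.periodMap μ A v T, T) ∧
      ∀ b S k, ∑ n : Fin M,
        (S n * SOWhitham.period (A k v) (SOWhitham.dOmegaHat μ v ((n : ℕ) + 1)) +
        T n * SOWhitham.period (A k v) (SOWhitham.dOmegaHatDot μ v (g (b, S)) ((n : ℕ) + 1))) =
          b k := by
    intro v hv T hT
    have hmem : (v, T) ∈ V ×ˢ 𝒯 := ⟨hv, hT⟩
    obtain ⟨f', hf'⟩ := hequiv (v, T) hmem
    have h1 : HasFDerivAt e.symm (f'.symm : _ →L[ℂ] _) (SOWhitham.periodMap μ A v T, T) := by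
      refine e.hasFDerivAt_symm ?_ ?_
      · have h2 := e.map_source (hsource hmem)
        rwa [he] at h2
      · rw [hleft v hv T hT, he]
        exact hf'
    refine ⟨_, hasFDerivAt_fst.comp _ h1, fun b S k => ?_⟩
    have h3 := hΦd v (hVU v hv) T (f'.symm (b, S)).1 (f'.symm (b, S)).2
    rw [hf'.fderiv] at h3
    have h4 : f' (f'.symm (b, S)) = (b, S) := f'.apply_symm_apply _
    obtain ⟨h5, h6⟩ := Prod.mk.inj (h4.symm.trans h3)
    have h7 := congrFun h5 k
    rw [← h6] at h7
    exact h7.symm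
  refine ⟨V, 𝒯, fun v j => SOWhitham.oddDiff μ (d v j), fun q => (e.symm q).1, D, hV, hu₀V, hVU,
    h𝒯, hT₀, fun v hv => ⟨hVs v hv, hd v hv, fun om' h' j => ?_⟩, rfl, ?_, ?_, ?_, ?_⟩
  · exact SOWhitham.eqOn_of_period_eq hN (hVs v hv) (hloop v hv) (hinj v hv) (h' j).1 (h' j).2.1
      (hd v hv j).1 (hd v hv j).2.1 fun k => ((h' j).2.2 k).trans ((hd v hv j).2.2 k).symm
  · rw [hDimage]
    exact e.isOpen_image_of_subset_source (hV.prod h𝒯) hsource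
  · rintro ⟨a, T⟩ ⟨hT, v, hv, h1⟩
    simp only at h1
    subst h1
    obtain ⟨g, hg, -⟩ := hsymm v hv T hT
    exact hg.differentiableAt.differentiableWithinAt
  · intro v hv T hT
    simp only [hleft v hv T hT]
  · rintro a T ⟨hT, v, hv, h1⟩
    simp only at h1
    subst h1
    obtain ⟨g, hg, hgb⟩ := hsymm v hv T hT
    simp only [hleft v hv T hT]
    -- both Whitham equations: the derivative of `dS` at constant `z` is identified by its A-periods
    refine ⟨fun n j => SOWhitham.period_dOmega (hloop v hv) (hd v hv) _ j,
      fun p _ => SOWhitham.dS_eq_sum (hloop v hv) _ T p, fun j => ?_, fun n => ?_⟩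
    · have hline : HasDerivAt
          (fun s => (Function.update (SOWhitham.periodMap μ A v T) j s, T))
          (Pi.single j (1 : ℂ), (0 : Fin M → ℂ)) (SOWhitham.periodMap μ A v T j) :=
        (hasDerivAt_update _ j _).prodMk (hasDerivAt_const _ _)
      have hcomp := HasFDerivAt.comp_hasDerivAt_of_eq _ hg hline (by simp)
      refine SOWhitham.hasDerivConstZ_dS hcomp (hasDerivAt_const _ T) ?_
      simp only [Function.comp_apply, Function.update_eq_self, hleft v hv T hT]
      intro p hp
      rw [← SOWhitham.sum_dOmega_add_eq hN (hloop v hv) (hinj v hv) (hd v hv) (hgb _ _) hp]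
      simp [Pi.single_apply]
    · have hline : HasDerivAt
          (fun s => (SOWhitham.periodMap μ A v T, Function.update T n s))
          ((0 : Fin N → ℂ), Pi.single n (1 : ℂ)) (T n) :=
        (hasDerivAt_const _ _).prodMk (hasDerivAt_update T n _)
      have hcomp := HasFDerivAt.comp_hasDerivAt_of_eq _ hg hline (by simp)
      refine SOWhitham.hasDerivConstZ_dS hcomp (hasDerivAt_update T n _) ?_
      simp only [Function.comp_apply, Function.update_eq_self, hleft v hv T hT]
      intro p hp
      rw [← SOWhitham.sum_dOmega_add_eq hN (hloop v hv) (hinj v hv) (hd v hv) (hgb _ _) hp]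
      simp [Pi.single_apply]
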